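/- **Conventions.** Fix a universe of small sets. For a locally small category $\mathscr C$, let $\mathrm{Ind}(\mathscr C)$ be the category whose objects are functors $X\colon I\to\mathscr C$ with $I$ a small filtered category, and whose morphisms are $\mathrm{Hom}(X,Y)=\lim_{i}\operatorname{colim}_{j}\mathscr C(X_i,Y_j)$. This defines a pseudofunctor $\mathrm{Ind}$ from locally small categories to (larger) categories. There is a canonical functor $\mathscr C\to\mathrm{Ind}(\mathscr C)$, and a functor $\mathrm{Ind}(\mathscr A)\times\mathrm{Ind}(\mathscr C)\to\mathrm{Ind}(\mathscr A\times\mathscr C)$ given by $((X_i)_{i\in I},(Y_j)_{j\in J})\mapsto (X_i,Y_j)_{(i,j)\in I\times J}$. A *tangent category* is a category $\mathscr X$ with a tangent structure $\mathbb T=(T,p,0,+,\ell,c)$: an endofunctor $T$; a projection $p\colon T\to\mathrm{id}$ whose finite pullback powers $T_nX$ over $X$ exist and are preserved by all powers of $T$; a zero $0\colon \mathrm{id}\to T$ and an addition $+\colon T_2\to T$ making each $p_X$ a commutative monoid over $X$; a vertical lift $\ell\colon T\to T^2$ and a canonical flip $c\colon T^2\to T^2$ subject to the usual additivity, coherence and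 universality axioms. A (lax) morphism of tangent categories $(\mathscr X,\mathbb T)\to(\mathscr Y,\mathbb S)$ is a functor $F$ with a natural transformation $F\circ T\to S\circ F$ compatible with $p,0,+,\ell,c$; a tangent transformation is a natural transformation compatible with these. These form a 2-category $\mathfrak{Tan}$. For a tangent category $(\mathscr X,\mathbb T)$, let $\mathrm{Ind}(\mathbb T)$ be obtained by applying $\mathrm{Ind}$ to $T,p,0,+,\ell,c$ (up to the canonical isomorphisms $\mathrm{Ind}(\mathrm{id})\cong\mathrm{id}$ and $\mathrm{Ind}(T)\circ\mathrm{Ind}(T)\cong\mathrm{Ind}(T\circ T)$). Let $W^n=\mathbb N[x_1,\dots,x_n]/(x_ix_j)_{1\le i,j\le n}$ and $W=W^1$. Let $\mathsf{Weil}_1$ be the category whose objects are the finite tensor products $W^{n_1}\otimes\cdots\otimes W^{n_k}$ of commutative semirings ($k\ge 0$, $n_i\geq 0$), and whose morphisms are the semiring morphisms commuting with the augmentations to $\mathbb N$. It carries the structure $T=W\otimes -$, $T_2=W^2\otimes-$, with $p\colon x\mapsto 0$, $0\colon a\mapsto 1\otimes a$, $+\colon x_1,x_2\mapsto x$, $\ell\colon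 x\mapsto x\otimes x$, and $c$ the exchange of the two factors $W$. For a category $\mathscr C$, let $\mathrm{Free}(\mathscr C)=\mathsf{Weil}_1\times\mathscr C$, with the product of this structure and the trivial structure (all of whose data are identities) on $\mathscr C$. **Proposition.** 1. For every category $\mathscr C$, $\mathrm{Free}(\mathscr C)$ is a tangent category, and for every tangent category $(\mathscr X,\mathbb T)$, $(\mathrm{Ind}(\mathscr X),\mathrm{Ind}(\mathbb T))$ is a tangent category. Hence one has pseudofunctors $\mathrm{Free}$ from categories to $\mathfrak{Tan}$, with $\mathrm{Free}(F)=\mathrm{id}\times F$, and $\mathrm{Ind}$ from $\mathfrak{Tan}$ to $\mathfrak{Tan}$ (the source being the locally small tangent categories), with $(F,\alpha)\mapsto(\mathrm{Ind}(F),\mathrm{Ind}(\alpha))$ up to the canonical isomorphisms. 2. For every locally small category $\mathscr C$, the functor $\mathrm{Ind}(\mathsf{Weil}_1)\times\mathrm{Ind}(\mathscr C)\to\mathrm{Ind}(\mathsf{Weil}_1\times\mathscr C)$ is an equivalence of categories. 3. There is a pseudonatural transformation $\alpha\colon\mathrm{Free}\circ\mathrm{Ind}\Rightarrow\mathrm{Ind}\circ\mathrm{Free}$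 of pseudofunctors from locally small categories to $\mathfrak{Tan}$, such that the functor underlying $\alpha_{\mathscr C}$ is, for every $\mathscr C$, the composite $$\mathsf{Weil}_1\times\mathrm{Ind}(\mathscr C)\longrightarrow\mathrm{Ind}(\mathsf{Weil}_1)\times\mathrm{Ind}(\mathscr C)\overset{\simeq}{\longrightarrow}\mathrm{Ind}(\mathsf{Weil}_1\times\mathscr C)$$ of the canonical inclusion times the identity with the equivalence of part 2. 4. For every pseudonatural transformation $\beta\colon\mathrm{Free}\circ\mathrm{Ind}\Rightarrow\mathrm{Ind}\circ\mathrm{Free}$ (in particular for $\beta=\alpha$) and every locally small category $\mathscr C$, the functor underlying $\beta_{\mathscr C}$ is an equivalence of categories if and only if $\mathscr C$ is empty. In particular there is no pseudonatural equivalence between $\mathrm{Free}\circ\mathrm{Ind}$ and $\mathrm{Ind}\circ\mathrm{Free}$. -/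

import Mathlib

open CategoryTheory

universe w v u

namespace TangentInd

universe v₁ u₁ v₂ u₂ v₃ u₃ v₄ u₄

/-! ### Ind-categories -/

/-- An ind-object of `C`: a functor to `C` from a small filtered category. -/
structure IndObj (C : Type u) [Category.{v} C] where
  I : Type w
  [smallCategory : SmallCategory I]
  [isFiltered : IsFiltered I]
  F : I ⥤ C

attribute [instance] IndObj.smallCategory IndObj.isFiltered

section Ind

variable {C : Type u} [Category.{v} C]

/-- The equivalence relation whose quotient is the filtered colimit of the sets `C(c, Y_j)`. -/
def IndObj.germSetoid (Y : IndObj.{w} C) (c : C) : Setoid (Σ j : Y.I, (c ⟶ Y.F.obj j)) where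
  r a b := ∃ (k : Y.I) (f : a.1 ⟶ k) (g : b.1 ⟶ k), a.2 ≫ Y.F.map f = b.2 ≫ Y.F.map g
  iseqv :=
    { refl := fun a => ⟨a.1, 𝟙 _, 𝟙 _, rfl⟩
      symm := fun ⟨k, f, g, h⟩ => ⟨k, g, f, h.symm⟩
      trans := by
        rintro a b c ⟨k, f, g, h⟩ ⟨l, f', g', h'⟩
        obtain ⟨m, s, t, e⟩ := IsFiltered.span g f'
        refine ⟨m, f ≫ s, g' ≫ t, ?_⟩
        rw [Functor.map_comp, Functor.map_comp, ← Category.assoc, ← Category.assoc, h, ← h',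
          Category.assoc, Category.assoc, ← Functor.map_comp, ← Functor.map_comp, e] }

/-- The filtered colimit `colim_j C(c, Y_j)`. -/
def IndObj.Germ (Y : IndObj.{w} C) (c : C) : Type (max w v) := Quotient (Y.germSetoid c)

/-- The class of `u : c ⟶ Y_j` in `colim_j C(c, Y_j)`. -/
def IndObj.germ (Y : IndObj.{w} C) {c : C} (j : Y.I) (u : c ⟶ Y.F.obj j) : Y.Germ c :=
  Quotient.mk (Y.germSetoid c) ⟨j, u⟩

lemma IndObj.germ_eq_iff (Y : IndObj.{w} C) {c : C} {j j' : Y.I} (u : c ⟶ Y.F.obj j)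
    (u' : c ⟶ Y.F.obj j') : Y.germ j u = Y.germ j' u' ↔
      ∃ (k : Y.I) (f : j ⟶ k) (g : j' ⟶ k), u ≫ Y.F.map f = u' ≫ Y.F.map g :=
  Quotient.eq (r := Y.germSetoid c)

lemma IndObj.germ_surj (Y : IndObj.{w} C) {c : C} (x : Y.Germ c) :
    ∃ (j : Y.I) (u : c ⟶ Y.F.obj j), x = Y.germ j u := by
  obtain ⟨⟨j, u⟩, rfl⟩ := Quotient.exists_rep x
  exact ⟨j, u, rfl⟩

@[simp]
lemma IndObj.germ_map (Y : IndObj.{w} C) {c : C} {j k : Y.I} (u : c ⟶ Y.F.obj j) (f : j ⟶ k) :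
    Y.germ k (u ≫ Y.F.map f) = Y.germ j u :=
  (Y.germ_eq_iff _ _).2 ⟨k, 𝟙 k, f, by simp⟩

/-- Precomposition `colim_j C(c, Y_j) → colim_j C(c', Y_j)` with `a : c' ⟶ c`. -/
def IndObj.restrict (Y : IndObj.{w} C) {c' c : C} (a : c' ⟶ c) : Y.Germ c → Y.Germ c' :=
  Quotient.map (fun x => ⟨x.1, a ≫ x.2⟩) (by
    rintro x y ⟨k, f, g, h⟩
    exact ⟨k, f, g, by simp [h]⟩)

@[simp]
lemma IndObj.restrict_germ (Y : IndObj.{w} C) {c' c : C} (a : c' ⟶ c) (j : Y.I)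
    (u : c ⟶ Y.F.obj j) : Y.restrict a (Y.germ j u) = Y.germ j (a ≫ u) := rfl

@[simp]
lemma IndObj.restrict_id (Y : IndObj.{w} C) {c : C} (x : Y.Germ c) : Y.restrict (𝟙 c) x = x := by
  obtain ⟨j, u, rfl⟩ := Y.germ_surj x
  simp

@[simp]
lemma IndObj.restrict_restrict (Y : IndObj.{w} C) {c'' c' c : C} (b : c'' ⟶ c') (a : c' ⟶ c)
    (x : Y.Germ c) : Y.restrict b (Y.restrict a x) = Y.restrict (b ≫ a) x := by
  obtain ⟨j, u, rfl⟩ := Y.germ_surj x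
  simp

/-- A morphism of ind-objects: an element of `lim_i colim_j C(X_i, Y_j)`. -/
@[ext]
structure IndObj.Hom (X Y : IndObj.{w} C) where
  val : ∀ i : X.I, Y.Germ (X.F.obj i)
  compat : ∀ {i i' : X.I} (f : i ⟶ i'), Y.restrict (X.F.map f) (val i') = val i

/-- The extension of `g : X ⟶ Y` to a map `colim_i C(c, X_i) → colim_j C(c, Y_j)`,
sending the class of `u : c ⟶ X_i` to `g_i ∘ u`. -/
def IndObj.Hom.bind {X Y : IndObj.{w} C} (g : X.Hom Y) {c : C} : X.Germ c → Y.Germ c :=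
  Quotient.lift (fun x => Y.restrict x.2 (g.val x.1)) (by
    rintro x y ⟨k, f, g', h⟩
    rw [← g.compat f, ← g.compat g', IndObj.restrict_restrict, IndObj.restrict_restrict, h])

@[simp]
lemma IndObj.Hom.bind_germ {X Y : IndObj.{w} C} (g : X.Hom Y) {c : C} (i : X.I)
    (u : c ⟶ X.F.obj i) : g.bind (X.germ i u) = Y.restrict u (g.val i) := rfl

lemma IndObj.Hom.bind_restrict {X Y : IndObj.{w} C} (g : X.Hom Y) {c' c : C} (a : c' ⟶ c)
    (x : X.Germ c) : g.bind (X.restrict a x) = Y.restrict a (g.bind x) := by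
  obtain ⟨j, u, rfl⟩ := X.germ_surj x
  simp

/-- The category `Ind(C)` of ind-objects, with
`Ind(C)(X, Y) = lim_i colim_j C(X_i, Y_j)` and levelwise composition. -/
instance IndObj.category : Category.{max w v} (IndObj.{w} C) where
  Hom X Y := X.Hom Y
  id X :=
    { val := fun i => X.germ i (𝟙 _)
      compat := fun f => by
        rw [IndObj.restrict_germ, Category.comp_id, ← Category.id_comp (X.F.map f),
          IndObj.germ_map] }
  comp f g :=
    { val := fun i => g.bind (f.val i)
      compat := fun a => by rw [← g.bind_restrict, f.compat] }
  id_comp f := by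
    apply IndObj.Hom.ext
    funext i
    simp
  comp_id {X Y} f := by
    apply IndObj.Hom.ext
    funext i
    obtain ⟨j, u, h⟩ := Y.germ_surj (f.val i)
    simp [h]
  assoc {W X Y Z} f g h := by
    apply IndObj.Hom.ext
    funext i
    obtain ⟨j, u, e⟩ := X.germ_surj (f.val i)
    simp [e, IndObj.Hom.bind_restrict]

@[ext]
lemma IndObj.hom_ext {X Y : IndObj.{w} C} {f g : X ⟶ Y} (h : ∀ i, f.val i = g.val i) : f = g :=
  IndObj.Hom.ext (funext h)

@[simp]
lemma IndObj.id_val (X : IndObj.{w} C) (i : X.I) :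
    IndObj.Hom.val (𝟙 X) i = X.germ i (𝟙 _) := rfl

@[simp]
lemma IndObj.comp_val {X Y Z : IndObj.{w} C} (f : X ⟶ Y) (g : Y ⟶ Z) (i : X.I) :
    IndObj.Hom.val (f ≫ g) i = g.bind (f.val i) := rfl

/-- The morphism of ind-objects with the same indexing category given by
a natural transformation. -/
def levelHom {I : Type w} [SmallCategory I] [IsFiltered I] {F G : I ⥤ C} (ρ : F ⟶ G) :
    (IndObj.mk I F : IndObj.{w} C) ⟶ IndObj.mk I G :=
  IndObj.Hom.mk (X := IndObj.mk I F) (Y := IndObj.mk I G)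
    (fun i => (IndObj.mk I G : IndObj.{w} C).germ i (ρ.app i)) (fun {i i'} f => by
      rw [IndObj.restrict_germ]
      change IndObj.germ _ _ (F.map f ≫ _) = _
      rw [ρ.naturality f]
      exact IndObj.germ_map (IndObj.mk I G : IndObj.{w} C) _ f)

@[simp]
lemma levelHom_val {I : Type w} [SmallCategory I] [IsFiltered I] {F G : I ⥤ C} (ρ : F ⟶ G)
    (i : I) : IndObj.Hom.val (levelHom ρ) i =
      (IndObj.mk I G : IndObj.{w} C).germ i (ρ.app i) := rfl

variable (C) in
/-- The embedding `C ⥤ Ind(C)`, which sends `X` to the ind-object `∗ ↦ X` indexed by the terminal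
category. -/
def incl : C ⥤ IndObj.{w} C where
  obj X := ⟨Discrete PUnit.{w + 1}, (Functor.const _).obj X⟩
  map f := levelHom ((Functor.const _).map f)
  map_id X := by ext i; simp
  map_comp f g := by ext i; simp

end Ind

section IndMap

variable {C : Type u₁} [Category.{v₁} C] {D : Type u₂} [Category.{v₂} D]
  {E : Type u₃} [Category.{v₃} E]

/-- The action of a functor on germs: the class of `u : c ⟶ Y_j` goes to the class of `F u`. -/
def germMap (F : C ⥤ D) (Y : IndObj.{w} C) {c : C} :
    Y.Germ c → (IndObj.mk Y.I (Y.F ⋙ F) : IndObj.{w} D).Germ (F.obj c) :=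
  Quotient.map (fun x => ⟨x.1, F.map x.2⟩) (by
    rintro x y ⟨k, f, g, h⟩
    refine ⟨k, f, g, ?_⟩
    change F.map _ ≫ F.map _ = F.map _ ≫ F.map _
    rw [← F.map_comp, ← F.map_comp, h])

@[simp]
lemma germMap_germ (F : C ⥤ D) (Y : IndObj.{w} C) {c : C} (j : Y.I) (u : c ⟶ Y.F.obj j) :
    germMap F Y (Y.germ j u) = (IndObj.mk Y.I (Y.F ⋙ F) : IndObj.{w} D).germ j (F.map u) := rfl

/-- The functor `Ind(F) : Ind(C) ⥤ Ind(D)`, `(X_i) ↦ (F X_i)`. -/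
@[reducible, simps obj]
def indMap (F : C ⥤ D) : IndObj.{w} C ⥤ IndObj.{w} D where
  obj X := ⟨X.I, X.F ⋙ F⟩
  map {X Y} f :=
    IndObj.Hom.mk (X := ⟨X.I, X.F ⋙ F⟩) (Y := ⟨Y.I, Y.F ⋙ F⟩)
      (fun i => germMap F Y (f.val i)) (fun {i i'} a => by
        rw [← f.compat a]
        obtain ⟨j, u, e⟩ := Y.germ_surj (f.val i')
        simp [e])
  map_id X := by ext i; simp
  map_comp {X Y Z} f g := by
    ext i
    obtain ⟨j, u, e⟩ := Y.germ_surj (f.val i)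
    obtain ⟨k, t, e'⟩ := Z.germ_surj (g.val j)
    simp [e, e']

@[simp]
lemma indMap_map_val (F : C ⥤ D) {X Y : IndObj.{w} C} (f : X ⟶ Y) (i : X.I) :
    ((indMap F).map f).val i = germMap F Y (f.val i) := rfl

/-- The natural transformation `Ind(α) : Ind(F) ⟶ Ind(G)` with components `(α_{X_i})_i`. -/
@[simps]
def indNat {F G : C ⥤ D} (α : F ⟶ G) : (indMap F : IndObj.{w} C ⥤ IndObj.{w} D) ⟶ indMap G where
  app X := levelHom (Functor.whiskerLeft X.F α)
  naturality X Y f := by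
    ext i
    obtain ⟨j, u, e⟩ := Y.germ_surj (f.val i)
    simp [e]

variable (C) in
/-- The unit constraint `Ind(id) ≅ id`, the identity in each degree. -/
@[simps]
def indId : (indMap (𝟭 C) : IndObj.{w} C ⥤ IndObj.{w} C) ≅ 𝟭 _ where
  hom :=
    { app := fun X => levelHom (Functor.rightUnitor X.F).hom
      naturality := fun X Y f => by
        ext i
        obtain ⟨j, u, e⟩ := Y.germ_surj (f.val i)
        simp [e] }
  inv :=
    { app := fun X => levelHom (Functor.rightUnitor X.F).inv
      naturality := fun X Y f => by
        ext i
        obtain ⟨j, u, e⟩ := Y.germ_surj (f.val i)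
        simp [e] }

/-- The compositor `Ind(G) ∘ Ind(F) ≅ Ind(G ∘ F)`, the identity in each degree. -/
@[simps]
def indComp (F : C ⥤ D) (G : D ⥤ E) :
    (indMap F ⋙ indMap G : IndObj.{w} C ⥤ IndObj.{w} E) ≅ indMap (F ⋙ G) where
  hom :=
    { app := fun X => levelHom (Functor.associator X.F F G).hom
      naturality := fun X Y f => by
        ext i
        obtain ⟨j, u, e⟩ := Y.germ_surj (f.val i)
        simp [e] }
  inv :=
    { app := fun X => levelHom (Functor.associator X.F F G).inv
      naturality := fun X Y f => by
        ext i
        obtain ⟨j, u, e⟩ := Y.germ_surj (f.val i)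
        simp [e] }

lemma indNat_id (F : C ⥤ D) : (indNat (𝟙 F) : (indMap F : IndObj.{w} C ⥤ _) ⟶ _) = 𝟙 _ := by
  ext X i; simp

lemma indNat_comp {F G H : C ⥤ D} (α : F ⟶ G) (β : G ⟶ H) :
    (indNat (α ≫ β) : (indMap F : IndObj.{w} C ⥤ _) ⟶ _) = indNat α ≫ indNat β := by
  ext X i; simp

lemma indNat_whiskerLeft (F : C ⥤ D) {G H : D ⥤ E} (α : G ⟶ H) :
    (indNat (Functor.whiskerLeft F α) : (indMap _ : IndObj.{w} C ⥤ _) ⟶ _) =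
      (indComp F G).inv ≫ Functor.whiskerLeft (indMap F) (indNat α) ≫ (indComp F H).hom := by
  ext X i; simp

lemma indNat_whiskerRight {F G : C ⥤ D} (α : F ⟶ G) (H : D ⥤ E) :
    (indNat (Functor.whiskerRight α H) : (indMap _ : IndObj.{w} C ⥤ _) ⟶ _) =
      (indComp F H).inv ≫ Functor.whiskerRight (indNat α) (indMap H) ≫ (indComp G H).hom := by
  ext X i; simp

lemma indNat_associator {E' : Type u₄} [Category.{v₄} E'] (F : C ⥤ D) (G : D ⥤ E) (H : E ⥤ E') :
    (indNat (Functor.associator F G H).hom : (indMap _ : IndObj.{w} C ⥤ _) ⟶ _) =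
      (indComp (F ⋙ G) H).inv ≫ Functor.whiskerRight (indComp F G).inv (indMap H) ≫
        (Functor.associator _ _ _).hom ≫ Functor.whiskerLeft (indMap F) (indComp G H).hom ≫
          (indComp F (G ⋙ H)).hom := by
  ext X i; simp

lemma indNat_leftUnitor (F : C ⥤ D) :
    (indNat (Functor.leftUnitor F).hom : (indMap _ : IndObj.{w} C ⥤ _) ⟶ _) =
      (indComp (𝟭 C) F).inv ≫ Functor.whiskerRight (indId C).hom (indMap F) ≫
        (Functor.leftUnitor _).hom := by
  ext X i; simp

lemma indNat_rightUnitor (F : C ⥤ D) :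
    (indNat (Functor.rightUnitor F).hom : (indMap _ : IndObj.{w} C ⥤ _) ⟶ _) =
      (indComp F (𝟭 D)).inv ≫ Functor.whiskerLeft (indMap F) (indId D).hom ≫
        (Functor.rightUnitor _).hom := by
  ext X i; simp

/-- The external product of germs. -/
def germProd (X : IndObj.{w} C) (Y : IndObj.{w} D) {c : C} {d : D} :
    X.Germ c → Y.Germ d → (IndObj.mk (X.I × Y.I) (X.F.prod Y.F) : IndObj.{w} (C × D)).Germ (c, d) :=
  Quotient.map₂ (fun x y => ⟨(x.1, y.1), (x.2, y.2)⟩) (by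
    rintro x x' ⟨k, f, g, h⟩ y y' ⟨l, f', g', h'⟩
    exact ⟨(k, l), (f, f'), (g, g'), Prod.ext h h'⟩)

@[simp]
lemma germProd_germ (X : IndObj.{w} C) (Y : IndObj.{w} D) {c : C} {d : D} (i : X.I) (j : Y.I)
    (u : c ⟶ X.F.obj i) (u' : d ⟶ Y.F.obj j) :
    germProd X Y (X.germ i u) (Y.germ j u') =
      (IndObj.mk (X.I × Y.I) (X.F.prod Y.F) : IndObj.{w} (C × D)).germ (i, j)
        (show ((c, d) : C × D) ⟶ _ from (u, u')) := rfl

variable (C D) in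
/-- The comparison functor `Ind(C) × Ind(D) ⥤ Ind(C × D)`,
`((X_i)_{i ∈ I}, (Y_j)_{j ∈ J}) ↦ ((X_i, Y_j))_{(i, j) ∈ I × J}`. -/
def indProd : IndObj.{w} C × IndObj.{w} D ⥤ IndObj.{w} (C × D) where
  obj X := ⟨X.1.I × X.2.I, X.1.F.prod X.2.F⟩
  map {X Y} f :=
    IndObj.Hom.mk (X := ⟨X.1.I × X.2.I, X.1.F.prod X.2.F⟩) (Y := ⟨Y.1.I × Y.2.I, Y.1.F.prod Y.2.F⟩)
      (fun i => germProd Y.1 Y.2 (f.1.val i.1) (f.2.val i.2)) (fun {i i'} a => by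
        rw [← f.1.compat a.1, ← f.2.compat a.2]
        obtain ⟨j, u, e⟩ := Y.1.germ_surj (f.1.val i'.1)
        obtain ⟨j', u', e'⟩ := Y.2.germ_surj (f.2.val i'.2)
        simp [e, e'])
  map_id X := by ext i; simp
  map_comp {X Y Z} f g := by
    ext i
    obtain ⟨j, u, e⟩ := Y.1.germ_surj (f.1.val i.1)
    obtain ⟨j', u', e'⟩ := Y.2.germ_surj (f.2.val i.2)
    obtain ⟨k, t, h⟩ := Z.1.germ_surj (g.1.val j)
    obtain ⟨k', t', h'⟩ := Z.2.germ_surj (g.2.val j')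
    simp [e, e', h, h']

end IndMap

/-- The pseudofunctor `Ind` on categories. -/
def indCat : Pseudofunctor Cat.{w, u} Cat.{w, max u (w + 1)} where
  obj C := Cat.of (IndObj.{w} C)
  map F := (indMap F.toFunctor).toCatHom
  map₂ α := (indNat α.toNatTrans).toCatHom₂
  map₂_id F := Cat.Hom₂.ext (indNat_id F.toFunctor)
  map₂_comp α β := Cat.Hom₂.ext (indNat_comp α.toNatTrans β.toNatTrans)
  mapId C := Cat.Hom.isoMk (indId C)
  mapComp F G := Cat.Hom.isoMk (indComp F.toFunctor G.toFunctor).symm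
  map₂_whisker_left F _ _ η := Cat.Hom₂.ext (indNat_whiskerLeft F.toFunctor η.toNatTrans)
  map₂_whisker_right η H := Cat.Hom₂.ext (indNat_whiskerRight η.toNatTrans H.toFunctor)
  map₂_associator F G H :=
    Cat.Hom₂.ext (indNat_associator F.toFunctor G.toFunctor H.toFunctor)
  map₂_left_unitor F := Cat.Hom₂.ext (indNat_leftUnitor F.toFunctor)
  map₂_right_unitor F := Cat.Hom₂.ext (indNat_rightUnitor F.toFunctor)


/-! ### Tangent categories -/

section Tangent

open Limits

variable {C : Type u} [Category.{v} C]

/-- The `n`-fold composite of an endofunctor. -/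
def functorPow (T : C ⥤ C) : ℕ → (C ⥤ C)
  | 0 => 𝟭 C
  | n + 1 => functorPow T n ⋙ T

/-- The data `(T, p, 0, +, ℓ, c)` of a tangent structure on `C`, with a choice `T₂ X` of the
pullback of `p_X : T X ⟶ X` along itself (its universal property is part of
`TangentData.IsTangent`) as the domain of the addition. -/
structure TangentData (C : Type u) [Category.{v} C] where
  T : C ⥤ C
  p : T ⟶ 𝟭 C
  zero : 𝟭 C ⟶ T
  T₂ : C ⥤ C
  fst : T₂ ⟶ T
  snd : T₂ ⟶ T
  add : T₂ ⟶ T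
  lift : T ⟶ T ⋙ T
  flip : T ⋙ T ⟶ T ⋙ T

namespace TangentData

/-- `T₂ X` is the pullback of `p_X` along itself. -/
structure HasPairs (D : TangentData C) : Prop where
  isPullback : ∀ X : C, IsPullback (D.fst.app X) (D.snd.app X) (D.p.app X) (D.p.app X)

variable {D : TangentData C}

/-- The morphism `⟨f, g⟩` into the pullback `T₂ X`. -/
noncomputable def HasPairs.pair (h : D.HasPairs) {Z X : C} (f g : Z ⟶ D.T.obj X)
    (w : f ≫ D.p.app X = g ≫ D.p.app X) : Z ⟶ D.T₂.obj X :=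
  (h.isPullback X).lift f g w

@[simp]
lemma HasPairs.pair_fst (h : D.HasPairs) {Z X : C} (f g : Z ⟶ D.T.obj X)
    (w : f ≫ D.p.app X = g ≫ D.p.app X) : h.pair f g w ≫ D.fst.app X = f :=
  (h.isPullback X).lift_fst f g w

@[simp]
lemma HasPairs.pair_snd (h : D.HasPairs) {Z X : C} (f g : Z ⟶ D.T.obj X)
    (w : f ≫ D.p.app X = g ≫ D.p.app X) : h.pair f g w ≫ D.snd.app X = g :=
  (h.isPullback X).lift_snd f g w

@[simp]
lemma HasPairs.pair_fst_assoc (h : D.HasPairs) {Z X Y : C} (f g : Z ⟶ D.T.obj X)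
    (w : f ≫ D.p.app X = g ≫ D.p.app X) (k : D.T.obj X ⟶ Y) :
    h.pair f g w ≫ D.fst.app X ≫ k = f ≫ k := by
  rw [← Category.assoc, h.pair_fst]

@[simp]
lemma HasPairs.pair_snd_assoc (h : D.HasPairs) {Z X Y : C} (f g : Z ⟶ D.T.obj X)
    (w : f ≫ D.p.app X = g ≫ D.p.app X) (k : D.T.obj X ⟶ Y) :
    h.pair f g w ≫ D.snd.app X ≫ k = g ≫ k := by
  rw [← Category.assoc, h.pair_snd]

lemma HasPairs.hom_ext (h : D.HasPairs) {Z X : C} {a b : Z ⟶ D.T₂.obj X}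
    (h₁ : a ≫ D.fst.app X = b ≫ D.fst.app X) (h₂ : a ≫ D.snd.app X = b ≫ D.snd.app X) : a = b :=
  (h.isPullback X).hom_ext h₁ h₂

lemma HasPairs.w (h : D.HasPairs) (X : C) :
    D.fst.app X ≫ D.p.app X = D.snd.app X ≫ D.p.app X := (h.isPullback X).w

/-- The axioms of a tangent structure. -/
structure IsTangent (D : TangentData C) : Prop extends D.HasPairs where
  /-- All pullback powers of `p_X` exist. -/
  hasPowers : ∀ (n : ℕ) (X : C),
    HasWidePullback X (fun _ : Fin n => D.T.obj X) (fun _ => D.p.app X)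
  /-- The powers of `T` preserve the pullback powers of `p_X`. -/
  preservesPowers : ∀ (m n : ℕ) (X : C),
    PreservesLimit (WidePullbackShape.wideCospan X (fun _ : Fin n => D.T.obj X)
      (fun _ => D.p.app X)) (functorPow D.T m)
  /-- `p : T X ⟶ X`, with `+` and `0`, is a commutative monoid in the slice over `X`. -/
  zero_p : ∀ X : C, D.zero.app X ≫ D.p.app X = 𝟙 X
  add_p : ∀ X : C, D.add.app X ≫ D.p.app X = D.fst.app X ≫ D.p.app X
  zero_add : ∀ X : C,
    toHasPairs.pair (D.p.app X ≫ D.zero.app X) (𝟙 _) (by simp [zero_p]) ≫ D.add.app X = 𝟙 _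
  add_comm : ∀ X : C,
    toHasPairs.pair (D.snd.app X) (D.fst.app X) (toHasPairs.w X).symm ≫ D.add.app X = D.add.app X
  add_assoc : ∀ {Z X : C} (f g k : Z ⟶ D.T.obj X) (h : f ≫ D.p.app X = g ≫ D.p.app X)
    (h' : g ≫ D.p.app X = k ≫ D.p.app X),
    toHasPairs.pair (toHasPairs.pair f g h ≫ D.add.app X) k (by simp [add_p, h, h']) ≫
        D.add.app X =
      toHasPairs.pair f (toHasPairs.pair g k h' ≫ D.add.app X) (by simp [add_p, h]) ≫
        D.add.app X
  /-- `c` is an involution, and `c ∘ ℓ = ℓ`. -/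
  flip_flip : ∀ X : C, D.flip.app X ≫ D.flip.app X = 𝟙 _
  lift_flip : ∀ X : C, D.lift.app X ≫ D.flip.app X = D.lift.app X
  /-- `(c, id)` is a morphism of additive bundles from `T p : T² X ⟶ T X`, whose addition is
  `T(+)` and whose zero is `T(0)`, to `p_{T X} : T² X ⟶ T X`. -/
  flip_p : ∀ X : C, D.flip.app X ≫ D.p.app (D.T.obj X) = D.T.map (D.p.app X)
  flip_add : ∀ X : C, D.T.map (D.add.app X) ≫ D.flip.app X =
    toHasPairs.pair (D.T.map (D.fst.app X) ≫ D.flip.app X) (D.T.map (D.snd.app X) ≫ D.flip.app X)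
        (by rw [Category.assoc, Category.assoc, flip_p, ← D.T.map_comp, ← D.T.map_comp,
          toHasPairs.w]) ≫ D.add.app (D.T.obj X)
  flip_zero : ∀ X : C, D.T.map (D.zero.app X) ≫ D.flip.app X = D.zero.app (D.T.obj X)
  /-- `(ℓ, 0)` is a morphism of additive bundles. -/
  lift_p : ∀ X : C, D.lift.app X ≫ D.T.map (D.p.app X) = D.p.app X ≫ D.zero.app X
  lift_add : ∀ X : C, D.add.app X ≫ D.lift.app X =
    toHasPairs.pair (D.fst.app X ≫ D.lift.app X) (D.snd.app X ≫ D.lift.app X)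
        (by rw [← lift_flip, Category.assoc, Category.assoc, Category.assoc, Category.assoc,
          flip_p, lift_p, ← Category.assoc, ← Category.assoc, toHasPairs.w]) ≫
      D.add.app (D.T.obj X)
  lift_zero : ∀ X : C,
    D.zero.app X ≫ D.lift.app X = D.zero.app X ≫ D.zero.app (D.T.obj X)
  /-- The coherences between `ℓ` and `c`. -/
  lift_lift : ∀ X : C, D.lift.app X ≫ D.T.map (D.lift.app X) =
    D.lift.app X ≫ D.lift.app (D.T.obj X)
  yangBaxter : ∀ X : C,
    D.T.map (D.flip.app X) ≫ D.flip.app (D.T.obj X) ≫ D.T.map (D.flip.app X) =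
      D.flip.app (D.T.obj X) ≫ D.T.map (D.flip.app X) ≫ D.flip.app (D.T.obj X)
  lift_flip_flip : ∀ X : C,
    D.lift.app (D.T.obj X) ≫ D.T.map (D.flip.app X) ≫ D.flip.app (D.T.obj X) =
      D.flip.app X ≫ D.T.map (D.lift.app X)
  /-- Universality of the vertical lift: with `a = ⟨ℓ ∘ π₁, 0_{T X} ∘ π₂⟩`, the morphism
  `T(+) ∘ a` is an equalizer of `T(p)` and `0 ∘ p ∘ p`. -/
  universal : ∀ X : C, ∃ a : D.T₂.obj X ⟶ D.T.obj (D.T₂.obj X),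
    a ≫ D.T.map (D.fst.app X) = D.fst.app X ≫ D.lift.app X ∧
    a ≫ D.T.map (D.snd.app X) = D.snd.app X ≫ D.zero.app (D.T.obj X) ∧
    ∃ w : (a ≫ D.T.map (D.add.app X)) ≫ D.T.map (D.p.app X) =
        (a ≫ D.T.map (D.add.app X)) ≫ D.p.app (D.T.obj X) ≫ D.p.app X ≫ D.zero.app X,
      Nonempty (IsLimit (Fork.ofι (f := D.T.map (D.p.app X))
        (g := D.p.app (D.T.obj X) ≫ D.p.app X ≫ D.zero.app X) (a ≫ D.T.map (D.add.app X)) w))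

end TangentData

end Tangent

/-- A tangent category. -/
structure Tan where
  carrier : Type u
  [category : Category.{v} carrier]
  data : TangentData carrier
  isTangent : data.IsTangent

attribute [instance] Tan.category

namespace Tan

/-- A (lax) morphism of tangent categories. -/
structure Hom (X Y : Tan.{v, u}) where
  functor : X.carrier ⥤ Y.carrier
  comm : X.data.T ⋙ functor ⟶ functor ⋙ Y.data.T
  comm_p : ∀ A, comm.app A ≫ Y.data.p.app (functor.obj A) = functor.map (X.data.p.app A)
  zero_comm : ∀ A, functor.map (X.data.zero.app A) ≫ comm.app A =
    Y.data.zero.app (functor.obj A)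
  add_comm : ∀ A, functor.map (X.data.add.app A) ≫ comm.app A =
    Y.isTangent.pair (functor.map (X.data.fst.app A) ≫ comm.app A)
        (functor.map (X.data.snd.app A) ≫ comm.app A)
        (by rw [Category.assoc, Category.assoc, comm_p, ← functor.map_comp, ← functor.map_comp,
          X.isTangent.w]) ≫
      Y.data.add.app (functor.obj A)
  lift_comm : ∀ A, functor.map (X.data.lift.app A) ≫ comm.app (X.data.T.obj A) ≫
      Y.data.T.map (comm.app A) =
    comm.app A ≫ Y.data.lift.app (functor.obj A)
  flip_comm : ∀ A, functor.map (X.data.flip.app A) ≫ comm.app (X.data.T.obj A) ≫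
      Y.data.T.map (comm.app A) =
    (comm.app (X.data.T.obj A) ≫ Y.data.T.map (comm.app A)) ≫ Y.data.flip.app (functor.obj A)

/-- A tangent transformation. -/
@[ext]
structure Hom₂ {X Y : Tan.{v, u}} (f g : Hom X Y) where
  natTrans : f.functor ⟶ g.functor
  comm : ∀ A, f.comm.app A ≫ Y.data.T.map (natTrans.app A) =
    natTrans.app (X.data.T.obj A) ≫ g.comm.app A

/-- The natural transformation `α₂ : F ∘ T₂ ⟶ S₂ ∘ F` induced by `α`. -/
noncomputable def Hom.comm₂ {X Y : Tan.{v, u}} (f : Hom X Y) :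
    X.data.T₂ ⋙ f.functor ⟶ f.functor ⋙ Y.data.T₂ where
  app A := Y.isTangent.pair (f.functor.map (X.data.fst.app A) ≫ f.comm.app A)
    (f.functor.map (X.data.snd.app A) ≫ f.comm.app A)
    (by rw [Category.assoc, Category.assoc, f.comm_p, ← f.functor.map_comp,
      ← f.functor.map_comp, X.isTangent.w])
  naturality A B u := by
    have h := f.comm.naturality u
    have h₁ := congrArg f.functor.map (X.data.fst.naturality u)
    have h₂ := congrArg f.functor.map (X.data.snd.naturality u)
    simp only [Functor.comp_map, Functor.comp_obj, Functor.map_comp] at h h₁ h₂ ⊢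
    refine Y.isTangent.hom_ext ?_ ?_
    · simp [reassoc_of% h₁, h]
    · simp [reassoc_of% h₂, h]

@[simp]
lemma Hom.comm₂_fst {X Y : Tan.{v, u}} (f : Hom X Y) (A : X.carrier) :
    f.comm₂.app A ≫ Y.data.fst.app _ = f.functor.map (X.data.fst.app A) ≫ f.comm.app A :=
  Y.isTangent.pair_fst _ _ _

@[simp]
lemma Hom.comm₂_snd {X Y : Tan.{v, u}} (f : Hom X Y) (A : X.carrier) :
    f.comm₂.app A ≫ Y.data.snd.app _ = f.functor.map (X.data.snd.app A) ≫ f.comm.app A :=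
  Y.isTangent.pair_snd _ _ _

lemma Hom.comm₂_add {X Y : Tan.{v, u}} (f : Hom X Y) (A : X.carrier) :
    f.comm₂.app A ≫ Y.data.add.app _ = f.functor.map (X.data.add.app A) ≫ f.comm.app A :=
  (f.add_comm A).symm

/-- The identity tangent morphism. -/
@[reducible, simps]
def Hom.id (X : Tan.{v, u}) : Hom X X where
  functor := 𝟭 _
  comm :=
    { app := fun A => 𝟙 (X.data.T.obj A)
      naturality := fun A B u => by simp }
  comm_p A := by simp
  zero_comm A := by simp
  add_comm A := by
    have : X.isTangent.pair (X.data.fst.app A ≫ 𝟙 _) (X.data.snd.app A ≫ 𝟙 _)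
        (by simpa using X.isTangent.w A) = 𝟙 _ :=
      X.isTangent.hom_ext (by simp) (by simp)
    simp only [Functor.id_map, Functor.id_obj]
    rw [this]
    simp
  lift_comm A := by simp
  flip_comm A := by simp

/-- The composite `(G ∘ F, (β ∗ F) ∘ (G ∗ α))` of tangent morphisms `(F, α)` and `(G, β)`. -/
@[reducible, simps]
def Hom.comp {X Y Z : Tan.{v, u}} (f : Hom X Y) (g : Hom Y Z) : Hom X Z where
  functor := f.functor ⋙ g.functor
  comm :=
    { app := fun A => g.functor.map (f.comm.app A) ≫ g.comm.app (f.functor.obj A)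
      naturality := fun A B u => by
        have h := f.comm.naturality u
        have h' := g.comm.naturality (f.functor.map u)
        simp only [Functor.comp_map, Functor.comp_obj] at h h' ⊢
        rw [← Category.assoc, ← g.functor.map_comp, h, Category.assoc, ← h', g.functor.map_comp,
          Category.assoc] }
  comm_p A := by simp [g.comm_p, ← f.comm_p]
  zero_comm A := by
    simp [← g.zero_comm, ← f.zero_comm]
  add_comm A := by
    have hf : (f.functor.map (X.data.fst.app A) ≫ f.comm.app A) ≫ Y.data.p.app _ =
        (f.functor.map (X.data.snd.app A) ≫ f.comm.app A) ≫ Y.data.p.app _ := by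
      rw [Category.assoc, Category.assoc, f.comm_p, ← f.functor.map_comp, ← f.functor.map_comp,
        X.isTangent.w]
    have hg : (g.functor.map (Y.data.fst.app (f.functor.obj A)) ≫ g.comm.app _) ≫
          Z.data.p.app _ =
        (g.functor.map (Y.data.snd.app (f.functor.obj A)) ≫ g.comm.app _) ≫ Z.data.p.app _ := by
      rw [Category.assoc, Category.assoc, g.comm_p, ← g.functor.map_comp, ← g.functor.map_comp,
        Y.isTangent.w]
    have key := g.add_comm (f.functor.obj A)
    have key' := f.add_comm A
    simp only [Functor.comp_map, Functor.comp_obj]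
    rw [← Category.assoc, ← g.functor.map_comp, key', g.functor.map_comp, Category.assoc, key,
      ← Category.assoc]
    congr 1
    refine Z.isTangent.hom_ext ?_ ?_
    · rw [Category.assoc, Z.isTangent.pair_fst, Z.isTangent.pair_fst, ← Category.assoc,
        ← g.functor.map_comp, Y.isTangent.pair_fst, g.functor.map_comp, Category.assoc]
    · rw [Category.assoc, Z.isTangent.pair_snd, Z.isTangent.pair_snd, ← Category.assoc,
        ← g.functor.map_comp, Y.isTangent.pair_snd, g.functor.map_comp, Category.assoc]
  lift_comm A := by
    have h := g.comm.naturality (f.comm.app A)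
    have hl := congrArg g.functor.map (f.lift_comm A)
    have hl' := g.lift_comm (f.functor.obj A)
    simp only [Functor.comp_map, Functor.comp_obj, Functor.map_comp, Category.assoc] at h hl hl' ⊢
    rw [← reassoc_of% h, reassoc_of% hl, hl']
  flip_comm A := by
    have h := g.comm.naturality (f.comm.app A)
    have hl := congrArg g.functor.map (f.flip_comm A)
    have hl' := g.flip_comm (f.functor.obj A)
    simp only [Functor.comp_map, Functor.comp_obj, Functor.map_comp, Category.assoc] at h hl hl' ⊢
    rw [← reassoc_of% h, reassoc_of% hl, hl', ← reassoc_of% h]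

instance : CategoryStruct Tan.{v, u} where
  Hom := Hom
  id := Hom.id
  comp := Hom.comp

/-- Tangent morphisms and tangent transformations form a category. -/
@[simps]
instance (X Y : Tan.{v, u}) : Category (X ⟶ Y) where
  Hom := Hom₂
  id f := ⟨𝟙 _, by simp⟩
  comp a b := ⟨a.natTrans ≫ b.natTrans, fun A => by
    simp [reassoc_of% a.comm A, b.comm A]⟩

@[ext]
lemma hom₂_ext {X Y : Tan.{v, u}} {f g : X ⟶ Y} {a b : f ⟶ g} (h : a.natTrans = b.natTrans) :
    a = b := Hom₂.ext h

/-- An invertible tangent transformation from a natural isomorphism. -/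
@[simps]
def isoMk {X Y : Tan.{v, u}} {f g : X ⟶ Y} (e : f.functor ≅ g.functor)
    (h : ∀ A, f.comm.app A ≫ Y.data.T.map (e.hom.app A) =
      e.hom.app (X.data.T.obj A) ≫ g.comm.app A) : f ≅ g where
  hom := ⟨e.hom, h⟩
  inv := ⟨e.inv, fun A => by
    rw [← cancel_epi (e.hom.app (X.data.T.obj A)), ← reassoc_of% h A]
    simp [← Functor.map_comp]⟩

/-- Left whiskering of a tangent transformation. -/
@[simps]
def Hom₂.whiskerLeft {X Y Z : Tan.{v, u}} (f : Hom X Y) {g h : Hom Y Z} (b : Hom₂ g h) :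
    Hom₂ (f.comp g) (f.comp h) where
  natTrans := Functor.whiskerLeft f.functor b.natTrans
  comm A := by
    rw [Functor.whiskerLeft_app, Functor.whiskerLeft_app, Hom.comp_comm_app, Hom.comp_comm_app,
      Category.assoc, b.comm]
    simp

/-- Right whiskering of a tangent transformation. -/
@[simps]
def Hom₂.whiskerRight {X Y Z : Tan.{v, u}} {f g : Hom X Y} (a : Hom₂ f g) (h : Hom Y Z) :
    Hom₂ (f.comp h) (g.comp h) where
  natTrans := Functor.whiskerRight a.natTrans h.functor
  comm A := by
    have e := h.comm.naturality (a.natTrans.app A)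
    have e' := congrArg h.functor.map (a.comm A)
    simp only [Functor.comp_map, Functor.comp_obj, Functor.map_comp] at e e'
    rw [Functor.whiskerRight_app, Functor.whiskerRight_app, Hom.comp_comm_app, Hom.comp_comm_app,
      Category.assoc, ← e, reassoc_of% e']

/-- The bicategory of tangent categories, tangent morphisms and tangent transformations. -/
instance : Bicategory Tan.{v, u} where
  whiskerLeft f _ _ b := Hom₂.whiskerLeft f b
  whiskerRight a h := Hom₂.whiskerRight a h
  associator f g h := isoMk (f := Hom.comp (Hom.comp f g) h) (g := Hom.comp f (Hom.comp g h))
    (Functor.associator f.functor g.functor h.functor) (fun A => by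
      change (h.functor.map (g.functor.map (f.comm.app A) ≫ g.comm.app _) ≫ h.comm.app _) ≫
        _ = 𝟙 _ ≫ (h.functor.map (g.functor.map (f.comm.app A)) ≫
          h.functor.map (g.comm.app _) ≫ h.comm.app _)
      simp)
  leftUnitor {X Y} f := isoMk (f := Hom.comp (Hom.id X) f) (g := f)
    (Functor.leftUnitor f.functor) (fun A => by
      change (f.functor.map (𝟙 _) ≫ f.comm.app A) ≫ Y.data.T.map (𝟙 _) = 𝟙 _ ≫ f.comm.app A
      simp)
  rightUnitor {X Y} f := isoMk (f := Hom.comp f (Hom.id Y)) (g := f)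
    (Functor.rightUnitor f.functor) (fun A => by
      change (f.comm.app A ≫ 𝟙 _) ≫ Y.data.T.map (𝟙 _) = 𝟙 _ ≫ f.comm.app A
      simp)
  whiskerLeft_id _ _ := rfl
  whiskerLeft_comp _ _ _ _ _ _ := rfl
  id_whiskerLeft _ := Hom₂.ext <| NatTrans.ext <| funext fun _ =>
    ((Category.id_comp _).trans (Category.comp_id _)).symm
  comp_whiskerLeft _ _ _ _ _ := Hom₂.ext <| NatTrans.ext <| funext fun _ =>
    ((Category.id_comp _).trans (Category.comp_id _)).symm
  id_whiskerRight _ g := Hom₂.ext <| NatTrans.ext <| funext fun _ => g.functor.map_id _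
  comp_whiskerRight _ _ h := Hom₂.ext <| NatTrans.ext <| funext fun _ => h.functor.map_comp _ _
  whiskerRight_id _ := Hom₂.ext <| NatTrans.ext <| funext fun _ =>
    ((Category.id_comp _).trans (Category.comp_id _)).symm
  whiskerRight_comp _ _ _ := Hom₂.ext <| NatTrans.ext <| funext fun _ =>
    ((Category.id_comp _).trans (Category.comp_id _)).symm
  whisker_assoc _ _ _ _ _ := Hom₂.ext <| NatTrans.ext <| funext fun _ =>
    ((Category.id_comp _).trans (Category.comp_id _)).symm
  whisker_exchange η θ := by
    apply Hom₂.ext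
    ext A
    exact (Hom₂.natTrans θ).naturality (Hom₂.natTrans η |>.app A) |>.symm
  pentagon _ _ _ i := by
    apply Hom₂.ext
    ext A
    change i.functor.map (𝟙 _) ≫ 𝟙 _ ≫ 𝟙 _ = 𝟙 _ ≫ 𝟙 _
    simp
  triangle _ g := by
    apply Hom₂.ext
    ext A
    change 𝟙 _ ≫ 𝟙 _ = g.functor.map (𝟙 _)
    simp

end Tan


/-! ### `Ind` on tangent categories -/

section IndTangent

variable {C : Type u} [Category.{v} C]

/-- The data `Ind(𝕋) = (Ind(T), Ind(p), Ind(0), Ind(+), Ind(ℓ), Ind(c))` on `Ind(C)`, up to the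
constraints `Ind(id) ≅ id` and `Ind(T) ∘ Ind(T) ≅ Ind(T ∘ T)`, with `Ind(T₂)` as the chosen
pullback. -/
@[reducible, simps]
def TangentData.ind (D : TangentData C) : TangentData (IndObj.{w} C) where
  T := indMap D.T
  p := indNat D.p ≫ (indId C).hom
  zero := (indId C).inv ≫ indNat D.zero
  T₂ := indMap D.T₂
  fst := indNat D.fst
  snd := indNat D.snd
  add := indNat D.add
  lift := indNat D.lift ≫ (indComp D.T D.T).inv
  flip := (indComp D.T D.T).hom ≫ indNat D.flip ≫ (indComp D.T D.T).inv

/-- The ind-completion of a tangent category, as soon as `Ind(𝕋)` is a tangent structure. -/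
@[reducible, simps]
def Tan.ind (X : Tan.{v, u}) (h : (TangentData.ind.{w} X.data).IsTangent) :
    Tan.{max w v, max (w + 1) u v} where
  carrier := IndObj.{w} X.carrier
  data := TangentData.ind.{w} X.data
  isTangent := h

/-- The tangent morphism `(Ind(F), φ⁻¹ ∘ Ind(α) ∘ φ)` induced by `(F, α)`. -/
@[reducible, simps]
def Tan.Hom.ind {X Y : Tan.{v, u}} (f : X.Hom Y)
    (hX : (TangentData.ind.{w} X.data).IsTangent) (hY : (TangentData.ind.{w} Y.data).IsTangent) :
    (X.ind hX).Hom (Y.ind hY) where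
  functor := indMap f.functor
  comm := (indComp X.data.T f.functor).hom ≫ indNat f.comm ≫ (indComp f.functor Y.data.T).inv
  comm_p A := by
    ext i
    simp [f.comm_p]
  zero_comm A := by
    ext i
    simp [f.zero_comm]
  add_comm A := by
    have key : hY.pair
        ((indMap f.functor).map ((indNat X.data.fst).app A) ≫
          ((indComp X.data.T f.functor).hom ≫ indNat f.comm ≫
            (indComp f.functor Y.data.T).inv).app A)
        ((indMap f.functor).map ((indNat X.data.snd).app A) ≫
          ((indComp X.data.T f.functor).hom ≫ indNat f.comm ≫
            (indComp f.functor Y.data.T).inv).app A)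
        (by ext i; simp [f.comm_p, ← Functor.map_comp, X.isTangent.w]) =
        ((indComp X.data.T₂ f.functor).hom ≫ indNat f.comm₂ ≫
          (indComp f.functor Y.data.T₂).inv).app A := by
      refine hY.hom_ext ?_ ?_
      · rw [hY.pair_fst]
        ext i
        simp
      · rw [hY.pair_snd]
        ext i
        simp
    rw [key]
    ext i
    simp [f.comm₂_add]
  lift_comm A := by
    ext i
    simp [f.lift_comm]
  flip_comm A := by
    ext i
    simp [f.flip_comm]

end IndTangent


/-! ### Weil algebras -/

section Weil

open scoped TensorProduct

/-- The crig `ℕ[x_1, …, x_n] / (x_i x_j : 1 ≤ i, j ≤ n)`, as the free `ℕ`-module on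
`1, x_1, …, x_n` with `x_i x_j = 0`. -/
def W (n : ℕ) : Type := TrivSqZeroExt ℕ (Fin n → ℕ)

instance (n : ℕ) : CommSemiring (W n) :=
  inferInstanceAs (CommSemiring (TrivSqZeroExt ℕ (Fin n → ℕ)))

/-- The generators of `W n`. -/
def W.x {n : ℕ} (i : Fin n) : W n := (TrivSqZeroExt.inr (Pi.single i 1) : TrivSqZeroExt ℕ _)

@[simp]
lemma W.x_mul_x {n : ℕ} (i j : Fin n) : W.x i * W.x j = 0 :=
  TrivSqZeroExt.inr_mul_inr ℕ _ _

/-- The universal property of `W n`: elements `b_i` with `b_i b_j = 0` determine a morphism. -/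
def W.lift {n : ℕ} {B : Type*} [CommSemiring B] (b : Fin n → B) (h : ∀ i j, b i * b j = 0) :
    W n →+* B :=
  (TrivSqZeroExt.liftEquivOfComm (R' := ℕ) (M := Fin n → ℕ) (A := B)
    ⟨Fintype.linearCombination ℕ b, fun x y => by
      simp only [Fintype.linearCombination_apply, Finset.sum_mul_sum, smul_mul_smul_comm, h, smul_zero,
        Finset.sum_const_zero]⟩ : _ →ₐ[ℕ] B).toRingHom

@[simp]
lemma W.lift_x {n : ℕ} {B : Type*} [CommSemiring B] (b : Fin n → B)
    (h : ∀ i j, b i * b j = 0) (i : Fin n) : W.lift b h (W.x i) = b i := by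
  change (TrivSqZeroExt.liftEquivOfComm (R' := ℕ) (M := Fin n → ℕ) (A := B) _)
    (TrivSqZeroExt.inr (Pi.single i 1)) = _
  simp [Fintype.linearCombination_apply, Pi.single_apply]

lemma W.exists_eq_sum {n : ℕ} (w : W n) :
    ∃ (k : ℕ) (m : Fin n → ℕ), w = (k : W n) + ∑ i, m i • W.x i := by
  have h : ∀ m : Fin n → ℕ, ∑ i, m i • (TrivSqZeroExt.inr (Pi.single i 1) :
      TrivSqZeroExt ℕ (Fin n → ℕ)) = TrivSqZeroExt.inr m := fun m => by
    have e : m = ∑ i, m i • Pi.single i (1 : ℕ) := by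
      ext j
      simp [Finset.sum_apply, Pi.single_apply]
    conv_rhs => rw [e]
    simp only [← TrivSqZeroExt.inrHom_apply ℕ, map_sum, map_nsmul]
  refine ⟨TrivSqZeroExt.fst w, TrivSqZeroExt.snd w, ?_⟩
  exact (TrivSqZeroExt.inl_fst_add_inr_snd_eq (R := ℕ) (M := Fin n → ℕ) w).symm.trans
    (congrArg (fun t : TrivSqZeroExt ℕ (Fin n → ℕ) => TrivSqZeroExt.inl (TrivSqZeroExt.fst w) + t)
      (h (TrivSqZeroExt.snd w)).symm)

@[ext]
lemma W.hom_ext {n : ℕ} {B : Type*} [CommSemiring B] {f g : W n →+* B}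
    (h : ∀ i, f (W.x i) = g (W.x i)) : f = g := by
  ext w
  obtain ⟨k, m, rfl⟩ := W.exists_eq_sum w
  simp [h]

section

variable {A B C : Type} [CommSemiring A] [CommSemiring B] [CommSemiring C]

/-- The coprojection `a ↦ a ⊗ 1`. -/
def tensorInl : A →+* A ⊗[ℕ] B := Algebra.TensorProduct.includeLeftRingHom

/-- The coprojection `b ↦ 1 ⊗ b`. -/
def tensorInr : B →+* A ⊗[ℕ] B := (Algebra.TensorProduct.includeRight : B →ₐ[ℕ] _).toRingHom

/-- The morphism out of the coproduct `A ⊗ B` of crigs given by `a ⊗ b ↦ f a * g b`. -/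
def tensorLift (f : A →+* C) (g : B →+* C) : A ⊗[ℕ] B →+* C :=
  (Algebra.TensorProduct.lift f.toNatAlgHom g.toNatAlgHom fun _ _ => Commute.all _ _).toRingHom

@[simp]
lemma tensorLift_inl (f : A →+* C) (g : B →+* C) (a : A) :
    tensorLift f g (tensorInl a) = f a := by
  change tensorLift f g (a ⊗ₜ 1) = f a
  simp [tensorLift]

@[simp]
lemma tensorLift_inr (f : A →+* C) (g : B →+* C) (b : B) :
    tensorLift f g (tensorInr b) = g b := by
  change tensorLift f g (1 ⊗ₜ b) = g b
  simp [tensorLift]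

lemma tensor_hom_ext {f g : A ⊗[ℕ] B →+* C} (h₁ : ∀ a, f (tensorInl a) = g (tensorInl a))
    (h₂ : ∀ b, f (tensorInr b) = g (tensorInr b)) : f = g :=
  Algebra.TensorProduct.ringHom_ext (RingHom.ext h₁) (RingHom.ext h₂)

lemma WTensor_hom_ext {n : ℕ} {f g : W n ⊗[ℕ] B →+* C}
    (h₁ : ∀ i, f (tensorInl (W.x i)) = g (tensorInl (W.x i)))
    (h₂ : ∀ b, f (tensorInr b) = g (tensorInr b)) : f = g :=
  tensor_hom_ext (RingHom.congr_fun (f := f.comp tensorInl) (g := g.comp tensorInl)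
    (W.hom_ext h₁)) h₂

end

/-- The crig `W^{n_1} ⊗ (W^{n_2} ⊗ ⋯ (W^{n_k} ⊗ ℕ))`. -/
def crig : List ℕ → CommSemiRingCat.{0}
  | [] => CommSemiRingCat.of ℕ
  | n :: l => CommSemiRingCat.of (W n ⊗[ℕ] crig l)

/-- The projection of a Weil algebra onto `ℕ`, which kills all generators; its kernel is the
unique maximal ideal. -/
def augmentation : ∀ l : List ℕ, crig l →+* ℕ
  | [] => RingHom.id ℕ
  | _ :: l => tensorLift (W.lift (fun _ => 0) (by simp)) (augmentation l)

lemma augmentation_unique : ∀ {l : List ℕ} (f : crig l →+* ℕ), f = augmentation l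
  | [], f => Subsingleton.elim (α := ℕ →+* ℕ) f _
  | n :: l, f => by
    refine WTensor_hom_ext (fun i => ?_) (fun b => ?_)
    · have h : f (tensorInl (W.x i)) * f (tensorInl (W.x i)) = 0 :=
        (map_mul f _ _).symm.trans ((congrArg f ((map_mul tensorInl _ _).symm.trans
          ((congrArg tensorInl (W.x_mul_x i i)).trans (map_zero tensorInl)))).trans (map_zero f))
      exact (mul_self_eq_zero.1 h).trans (by simp [augmentation])
    · exact (RingHom.congr_fun (augmentation_unique (l := l) (f.comp (tensorInr (A := W n)))) b).trans
        (by simp [augmentation])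

/-- An object of `Weil₁`: a list `n_1, …, n_k`, which stands for the finite coproduct
`W^{n_1} ⊗ ⋯ ⊗ W^{n_k}` of crigs. -/
structure Weil₁ : Type where
  factors : List ℕ

namespace Weil₁

/-- The crig underlying an object of `Weil₁`. -/
abbrev toCrig (A : Weil₁) : CommSemiRingCat.{0} := crig A.factors

/-- A morphism of crigs which commutes with the projections onto `ℕ`. -/
@[ext]
structure Hom (A B : Weil₁) where
  hom : A.toCrig →+* B.toCrig
  comp_augmentation : (augmentation B.factors).comp hom = augmentation A.factors

/-- The category of Weil algebras. -/
instance : Category.{0} Weil₁ where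
  Hom := Hom
  id A := ⟨RingHom.id _, RingHom.comp_id _⟩
  comp f g := ⟨g.hom.comp f.hom, by
    rw [← RingHom.comp_assoc, g.comp_augmentation, f.comp_augmentation]⟩

/-- Every morphism of crigs between Weil algebras commutes with the projections onto `ℕ`. -/
def mkHom {A B : Weil₁} (f : A.toCrig →+* B.toCrig) : A ⟶ B :=
  ⟨f, augmentation_unique _⟩

@[ext]
lemma hom_ext {A B : Weil₁} {f g : A ⟶ B} (h : ∀ a, f.hom a = g.hom a) : f = g :=
  Hom.ext (RingHom.ext h)

@[simp]
lemma comp_hom {A B C : Weil₁} (f : A ⟶ B) (g : B ⟶ C) (a : A.toCrig) :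
    Hom.hom (f ≫ g) a = g.hom (f.hom a) := rfl

@[simp]
lemma id_hom {A : Weil₁} (a : A.toCrig) : Hom.hom (𝟙 A) a = a := rfl

/-- The object `W^n ⊗ A`. -/
abbrev cons (n : ℕ) (A : Weil₁) : Weil₁ := ⟨n :: A.factors⟩

/-- The coprojection of `A` into `W^n ⊗ A`. -/
def inr {n : ℕ} (A : Weil₁) : A.toCrig →+* (A.cons n).toCrig :=
  tensorInr (A := W n) (B := A.toCrig)

/-- The generators of `W^n ⊗ A` over `A`. -/
def gen {n : ℕ} (A : Weil₁) (i : Fin n) : (A.cons n).toCrig :=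
  tensorInl (A := W n) (B := A.toCrig) (W.x i)

@[simp]
lemma gen_mul_gen {n : ℕ} (A : Weil₁) (i j : Fin n) : A.gen i * A.gen j = 0 :=
  (map_mul (tensorInl (A := W n) (B := A.toCrig)) _ _).symm.trans
    ((congrArg tensorInl (W.x_mul_x i j)).trans (map_zero tensorInl))

/-- The morphism from `W^n ⊗ A` given by elements `b_i` with `b_i b_j = 0` and a morphism
from `A`. -/
def desc {n : ℕ} {A : Weil₁} {B : CommSemiRingCat.{0}} (b : Fin n → B) (h : ∀ i j, b i * b j = 0)
    (f : A.toCrig →+* B) : (A.cons n).toCrig →+* B :=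
  tensorLift (A := W n) (B := A.toCrig) (W.lift b h) f

@[simp]
lemma desc_gen {n : ℕ} {A : Weil₁} {B : CommSemiRingCat.{0}} (b : Fin n → B)
    (h : ∀ i j, b i * b j = 0) (f : A.toCrig →+* B) (i : Fin n) : desc b h f (A.gen i) = b i :=
  (tensorLift_inl _ _ _).trans (W.lift_x b h i)

@[simp]
lemma desc_inr {n : ℕ} {A : Weil₁} {B : CommSemiRingCat.{0}} (b : Fin n → B)
    (h : ∀ i j, b i * b j = 0) (f : A.toCrig →+* B) (a : A.toCrig) :
    desc b h f (A.inr a) = f a :=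
  tensorLift_inr _ _ _

lemma cons_hom_ext {n : ℕ} {A B : Weil₁} {f g : A.cons n ⟶ B}
    (h₁ : ∀ i, f.hom (A.gen i) = g.hom (A.gen i))
    (h₂ : ∀ a, f.hom (A.inr a) = g.hom (A.inr a)) : f = g :=
  Hom.ext (WTensor_hom_ext h₁ h₂)

end Weil₁

end Weil


/-! ### The tangent structure on `Weil₁` and free tangent categories -/

namespace Weil₁

lemma cons_cons_hom_ext {m n : ℕ} {A B : Weil₁} {f g : (A.cons m).cons n ⟶ B}
    (h₁ : ∀ i, f.hom ((A.cons m).gen i) = g.hom ((A.cons m).gen i))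
    (h₂ : ∀ i, f.hom ((A.cons m).inr (A.gen i)) = g.hom ((A.cons m).inr (A.gen i)))
    (h₃ : ∀ a, f.hom ((A.cons m).inr (A.inr a)) = g.hom ((A.cons m).inr (A.inr a))) : f = g :=
  cons_hom_ext h₁ (RingHom.congr_fun (f := f.hom.comp (A.cons m).inr)
    (g := g.hom.comp (A.cons m).inr) (WTensor_hom_ext h₂ h₃))

@[simp]
lemma mkHom_hom {A B : Weil₁} (f : A.toCrig →+* B.toCrig) (a : A.toCrig) :
    Hom.hom (mkHom f) a = f a := rfl

/-- The action of `W^n ⊗ -` on morphisms. -/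
def consMap {n : ℕ} {A B : Weil₁} (f : A ⟶ B) : A.cons n ⟶ B.cons n :=
  mkHom (desc B.gen B.gen_mul_gen (B.inr.comp f.hom))

/-- The morphism `W ⊗ A ⟶ A` with `x ↦ 0`. -/
def proj (A : Weil₁) : A.cons 1 ⟶ A := mkHom (desc (fun _ => 0) (fun _ _ => zero_mul _)
  (RingHom.id _))

/-- The morphism `A ⟶ W ⊗ A`. -/
def unit (A : Weil₁) : A ⟶ A.cons 1 := mkHom A.inr

/-- The morphism `W^2 ⊗ A ⟶ W ⊗ A` with `x_1 ↦ x` and `x_2 ↦ 0`. -/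
def proj₁ (A : Weil₁) : A.cons 2 ⟶ A.cons 1 := mkHom (desc ![A.gen 0, 0] (by simp) A.inr)

/-- The morphism `W^2 ⊗ A ⟶ W ⊗ A` with `x_1 ↦ 0` and `x_2 ↦ x`. -/
def proj₂ (A : Weil₁) : A.cons 2 ⟶ A.cons 1 := mkHom (desc ![0, A.gen 0] (by simp) A.inr)

/-- The morphism `W^2 ⊗ A ⟶ W ⊗ A` with `x_1 ↦ x` and `x_2 ↦ x`. -/
def plus (A : Weil₁) : A.cons 2 ⟶ A.cons 1 :=
  mkHom (desc (fun _ => A.gen 0) (fun _ _ => A.gen_mul_gen 0 0) A.inr)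

/-- The morphism `W ⊗ A ⟶ W ⊗ (W ⊗ A)` with `x ↦ x ⊗ (x ⊗ 1)`. -/
def vlift (A : Weil₁) : A.cons 1 ⟶ (A.cons 1).cons 1 :=
  mkHom (desc (fun _ => (A.cons 1).gen 0 * (A.cons 1).inr (A.gen 0))
    (fun _ _ => by rw [mul_mul_mul_comm, gen_mul_gen, zero_mul]) ((A.cons 1).inr.comp A.inr))

/-- The morphism `W ⊗ (W ⊗ A) ⟶ W ⊗ (W ⊗ A)` which exchanges the factors `W`. -/
def swap (A : Weil₁) : (A.cons 1).cons 1 ⟶ (A.cons 1).cons 1 :=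
  mkHom (desc (fun _ => (A.cons 1).inr (A.gen 0))
    (fun _ _ => by rw [← map_mul, gen_mul_gen, map_zero])
    (desc (fun _ => (A.cons 1).gen 0) (fun _ _ => gen_mul_gen _ _ _) ((A.cons 1).inr.comp A.inr)))

/-- The functor `W^n ⊗ -`. -/
@[reducible]
def consFunctor (n : ℕ) : Weil₁ ⥤ Weil₁ where
  obj A := A.cons n
  map f := consMap f
  map_id A := cons_hom_ext (by simp [consMap]) (by simp [consMap])
  map_comp f g := cons_hom_ext (by simp [consMap]) (by simp [consMap])

/-- The tangent structure on `Weil₁`: `T = W ⊗ -` and `T₂ = W^2 ⊗ -`, where `W = W^1`; the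
projection is `x ↦ 0`, the zero is `a ↦ 1 ⊗ a`, the addition is `x_1, x_2 ↦ x`, the vertical lift
is `x ↦ x ⊗ x`, and the canonical flip exchanges the two tensor factors `W`. -/
def tangentData : TangentData Weil₁ where
  T := consFunctor 1
  p :=
    { app := proj
      naturality := fun A B f =>
        cons_hom_ext (by simp [consMap, proj]) (by simp [consMap, proj]) }
  zero :=
    { app := unit
      naturality := fun A B f => hom_ext (by simp [consMap, unit]) }
  T₂ := consFunctor 2
  fst :=
    { app := proj₁
      naturality := fun A B f =>
        cons_hom_ext (by simp [consMap, proj₁, Fin.forall_fin_two]) (by simp [consMap, proj₁]) }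
  snd :=
    { app := proj₂
      naturality := fun A B f =>
        cons_hom_ext (by simp [consMap, proj₂, Fin.forall_fin_two]) (by simp [consMap, proj₂]) }
  add :=
    { app := plus
      naturality := fun A B f => cons_hom_ext (by simp [consMap, plus]) (by simp [consMap, plus]) }
  lift :=
    { app := vlift
      naturality := fun A B f =>
        cons_hom_ext (by simp [consMap, vlift]) (by simp [consMap, vlift]) }
  flip :=
    { app := swap
      naturality := fun A B f =>
        cons_cons_hom_ext (by simp [consMap, swap]) (by simp [consMap, swap])
          (by simp [consMap, swap]) }

end Weil₁

section Free

variable {A : Type u₁} [Category.{v₁} A]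

/-- The product of a tangent structure on `A` with the trivial one on `C`. -/
@[reducible, simps]
def TangentData.prodTrivial (D : TangentData A) (C : Type u) [Category.{v} C] :
    TangentData (A × C) where
  T := D.T.prod (𝟭 C)
  p := { app := fun X => (D.p.app X.1, 𝟙 X.2) }
  zero :=
    { app := fun X => (D.zero.app X.1, 𝟙 X.2)
      naturality := fun X Y f => Prod.ext (D.zero.naturality f.1) (by simp) }
  T₂ := D.T₂.prod (𝟭 C)
  fst := { app := fun X => (D.fst.app X.1, 𝟙 X.2) }
  snd := { app := fun X => (D.snd.app X.1, 𝟙 X.2) }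
  add := { app := fun X => (D.add.app X.1, 𝟙 X.2) }
  lift := { app := fun X => (D.lift.app X.1, 𝟙 X.2) }
  flip :=
    { app := fun X => (D.flip.app X.1, 𝟙 X.2)
      naturality := fun X Y f => Prod.ext (D.flip.naturality f.1) (by simp) }

/-- The tangent structure of the free tangent category `Weil₁ × C`. -/
abbrev freeData (C : Type u) [Category.{v} C] : TangentData (Weil₁ × C) :=
  Weil₁.tangentData.prodTrivial C

end Free


/-! ### The pseudofunctors `Ind` and `Free` into tangent categories -/

section Pseudofunctors

/-- The pseudofunctor `Ind` on tangent categories. -/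
def indTan (hI : ∀ X : Tan.{w, u}, (TangentData.ind.{w} X.data).IsTangent) :
    Pseudofunctor Tan.{w, u} Tan.{w, max u (w + 1)} where
  obj X := X.ind (hI X)
  map {X Y} f := Tan.Hom.ind f (hI X) (hI Y)
  map₂ a := Tan.Hom₂.mk (indNat (Tan.Hom₂.natTrans a)) (fun A => by
    ext i
    simp [Tan.Hom₂.comm a])
  map₂_id f := Tan.Hom₂.ext (indNat_id f.functor)
  map₂_comp a b := Tan.Hom₂.ext (indNat_comp (Tan.Hom₂.natTrans a) (Tan.Hom₂.natTrans b))
  mapId X := Tan.isoMk (f := Tan.Hom.ind (Tan.Hom.id X) (hI X) (hI X)) (g := Tan.Hom.id _)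
    (indId X.carrier) (fun A => by
      ext i
      simp)
  mapComp {X Y Z} f g := Tan.isoMk
    (f := Tan.Hom.ind (Tan.Hom.comp f g) (hI X) (hI Z))
    (g := Tan.Hom.comp (Tan.Hom.ind f (hI X) (hI Y)) (Tan.Hom.ind g (hI Y) (hI Z)))
    (indComp f.functor g.functor).symm (fun A => by
      ext i
      simp)
  map₂_whisker_left F _ _ η := Tan.Hom₂.ext (indNat_whiskerLeft F.functor (Tan.Hom₂.natTrans η))
  map₂_whisker_right η H := Tan.Hom₂.ext (indNat_whiskerRight (Tan.Hom₂.natTrans η) H.functor)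
  map₂_associator F G H := Tan.Hom₂.ext (indNat_associator F.functor G.functor H.functor)
  map₂_left_unitor F := Tan.Hom₂.ext (indNat_leftUnitor F.functor)
  map₂_right_unitor F := Tan.Hom₂.ext (indNat_rightUnitor F.functor)

/-- The product of `A`, with tangent structure `D`, and `C`, with the trivial tangent structure. -/
@[reducible, simps]
def prodObj {A : Type} [Category.{0} A] (D : TangentData A) (C : Type u) [Category.{w} C]
    (h : (D.prodTrivial C).IsTangent) : Tan.{w, u} where
  carrier := A × C
  data := D.prodTrivial C
  isTangent := h

/-- The tangent morphism `id × F`. -/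
@[reducible, simps]
def prodMap {A : Type} [Category.{0} A] (D : TangentData A) {C C' : Type u} [Category.{w} C]
    [Category.{w} C'] (F : C ⥤ C') (h : (D.prodTrivial C).IsTangent)
    (h' : (D.prodTrivial C').IsTangent) : (prodObj D C h).Hom (prodObj D C' h') where
  functor := (𝟭 A).prod F
  comm := { app := fun X => 𝟙 _ }
  comm_p X := by ext <;> simp
  zero_comm X := by ext <;> simp
  add_comm X := by
    have key : h'.pair (X := ((X.1, F.obj X.2) : A × C'))
        (((𝟭 A).prod F).map ((D.prodTrivial C).fst.app X) ≫ 𝟙 ((D.T.obj X.1, F.obj X.2) : A × C'))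
        (((𝟭 A).prod F).map ((D.prodTrivial C).snd.app X) ≫ 𝟙 ((D.T.obj X.1, F.obj X.2) : A × C'))
        (by ext; exacts [by simpa using congrArg Prod.fst (h.w X), by simp]) =
        𝟙 ((D.T₂.obj X.1, F.obj X.2) : A × C') := by
      refine h'.hom_ext ?_ ?_
      · rw [h'.pair_fst]
        ext <;> simp
      · rw [h'.pair_snd]
        ext <;> simp
    refine Eq.trans ?_ (congrArg
      (fun t => t ≫ (D.prodTrivial C').add.app ((X.1, F.obj X.2) : A × C')) key.symm)
    ext <;> simp
  lift_comm X := by ext <;> simp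
  flip_comm X := by ext <;> simp

/-- The pseudofunctor `C ↦ A × C`, `F ↦ id × F`, `α ↦ id × α`. -/
def prodPseudofunctor {A : Type} [Category.{0} A] (D : TangentData A)
    (h : ∀ C : Cat.{w, u}, (D.prodTrivial C).IsTangent) :
    Pseudofunctor Cat.{w, u} Tan.{w, u} where
  obj C := prodObj D C (h C)
  map {C C'} F := prodMap D F.toFunctor (h C) (h C')
  map₂ {C C' F G} α := Tan.Hom₂.mk (X := prodObj D C (h C)) (Y := prodObj D C' (h C'))
    (f := prodMap D F.toFunctor (h C) (h C')) (g := prodMap D G.toFunctor (h C) (h C'))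
    (NatTrans.prod (𝟙 (𝟭 A)) α.toNatTrans) (fun X => by ext <;> simp)
  map₂_id F := Tan.Hom₂.ext <| NatTrans.ext <| funext fun X => rfl
  map₂_comp α β := Tan.Hom₂.ext <| NatTrans.ext <| funext fun X =>
    Prod.ext (Category.id_comp _).symm rfl
  mapId C := Tan.isoMk (f := prodMap D (𝟭 C) (h C) (h C)) (g := Tan.Hom.id _)
    (Iso.refl _) (fun X => by ext <;> simp)
  mapComp {C C' C''} F G := Tan.isoMk
    (f := prodMap D (F.toFunctor ⋙ G.toFunctor) (h C) (h C''))
    (g := Tan.Hom.comp (prodMap D F.toFunctor (h C) (h C'))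
      (prodMap D G.toFunctor (h C') (h C'')))
    (Iso.refl _) (fun X => by ext <;> simp)
  map₂_whisker_left F _ _ η := Tan.Hom₂.ext <| NatTrans.ext <| funext fun _ =>
    ((Category.id_comp _).trans (Category.comp_id _)).symm
  map₂_whisker_right η H := Tan.Hom₂.ext <| NatTrans.ext <| funext fun _ =>
    ((Category.id_comp _).trans (Category.comp_id _)).symm
  map₂_associator F G H := Tan.Hom₂.ext <| NatTrans.ext <| funext fun X => by
    refine Prod.ext ?_ ?_
    · change 𝟙 X.1 = 𝟙 X.1 ≫ 𝟙 X.1 ≫ 𝟙 X.1 ≫ 𝟙 X.1 ≫ 𝟙 X.1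
      simp
    · let Y := G.toFunctor.obj (F.toFunctor.obj X.2)
      change 𝟙 (H.toFunctor.obj Y) = 𝟙 (H.toFunctor.obj Y) ≫ H.toFunctor.map (𝟙 Y) ≫
        𝟙 (H.toFunctor.obj Y) ≫ 𝟙 (H.toFunctor.obj Y) ≫ 𝟙 (H.toFunctor.obj Y)
      simp
  map₂_left_unitor F := Tan.Hom₂.ext <| NatTrans.ext <| funext fun X => by
    refine Prod.ext ?_ ?_
    · change 𝟙 X.1 = 𝟙 X.1 ≫ 𝟙 X.1 ≫ 𝟙 X.1
      simp
    · change 𝟙 (F.toFunctor.obj X.2) = 𝟙 (F.toFunctor.obj X.2) ≫ F.toFunctor.map (𝟙 X.2) ≫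
        𝟙 (F.toFunctor.obj X.2)
      simp
  map₂_right_unitor F := Tan.Hom₂.ext <| NatTrans.ext <| funext fun X => by
    refine Prod.ext ?_ ?_
    · change 𝟙 X.1 = 𝟙 X.1 ≫ 𝟙 X.1 ≫ 𝟙 X.1
      simp
    · change 𝟙 (F.toFunctor.obj X.2) = 𝟙 (F.toFunctor.obj X.2) ≫ 𝟙 (F.toFunctor.obj X.2) ≫
        𝟙 (F.toFunctor.obj X.2)
      simp

/-- The pseudofunctor `Free`, with `Free(C) = Weil₁ × C`. -/
def free (h : ∀ C : Cat.{w, u}, (freeData C).IsTangent) : Pseudofunctor Cat.{w, u} Tan.{w, u} :=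
  prodPseudofunctor Weil₁.tangentData h

/-- The functor `Weil₁ × Ind(C) ⥤ Ind(Weil₁) × Ind(C) ⥤ Ind(Weil₁ × C)`. -/
def comparison (C : Type u) [Category.{w} C] : Weil₁ × IndObj.{w} C ⥤ IndObj.{w} (Weil₁ × C) :=
  (incl.{w} Weil₁).prod (𝟭 (IndObj.{w} C)) ⋙ indProd.{w} Weil₁ C

end Pseudofunctors

end TangentInd

open TangentInd

/-! The tangent structure on `Weil₁` is analysed in coordinates. An element of `W^n ⊗ A` is uniquely
`a + ∑ x_i b_i` with `a, b_i` in `A` (`exists_ofCoords`, `ofCoords_inj`). Hence on underlying sets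
`W^n ⊗ -` is the power `A ↦ A^(1+n)`, naturally in `A`. The pullbacks and the equalizer in the
axioms can be checked on sets, and `W ⊗ -` preserves limits of this kind because powers of sets do.
The other axioms are identities between explicit maps. A trivial factor contributes only identities,
so `Free` follows.

For `Ind`, finite limits commute with filtered colimits of sets, so levelwise finite limits are
limits of ind-objects (`levelIsLimit`). The structure maps are levelwise, hence the axioms are
inherited from the levels. Two points need care. A statement about morphisms out of an arbitrary
ind-object needs representatives at a common stage where the relevant equations already hold
(`ind_pair_val`). And the map in the universality axiom is given object by object, so its naturality
has to be derived from its uniqueness (`exists_universal_natTrans`).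

The functor from `Ind(C) × Ind(D)` to `Ind(C × D)` is fully faithful because filtered categories are
nonempty and connected. It is essentially surjective because an ind-object of pairs is the diagonal
of the external product of its components (`indProdIso`). The comparison `α` has constraints that
are identities in each degree, so its coherence is formal.

The last part is a cardinality argument that uses only the naturality of `β` along `C ⟶ 1`. If `β_C`
is an equivalence, then `Ind(Weil₁ × C) ⟶ Ind(Weil₁ × 1)` factors, up to equivalence, through `Weil₁
× Ind(1)`, whose sets of morphisms are countable (`countable_range_map`). But for an object `c`
there is a morphism from `(W^n, c)_n` to `(W, c)` for each subset of `ℕ`, and these have distinct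
images (`indMap_selectAt_injective`). -/

namespace TangentInd

universe v₁ u₁ v₂ u₂ v₃ u₃ v₄ u₄

/-! ### Limits in `Weil₁` -/

namespace Weil₁

open Limits

/-! ### Coordinates on `W^n ⊗ A` -/

section Coordinates

variable {n : ℕ} {A B : Weil₁}

/-- The element `a + ∑ x_i b_i` of `W^n ⊗ A`. -/
def ofCoords (a : A.toCrig) (b : Fin n → A.toCrig) : (A.cons n).toCrig :=
  A.inr a + ∑ i, A.gen i * A.inr (b i)

/-- The coordinates of an element of `W^n ⊗ A`. -/
def coords : (A.cons n).toCrig →+* TrivSqZeroExt A.toCrig (Fin n → A.toCrig) :=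
  desc (B := CommSemiRingCat.of (TrivSqZeroExt A.toCrig (Fin n → A.toCrig)))
    (fun i => TrivSqZeroExt.inr (Pi.single i 1)) (fun _ _ => TrivSqZeroExt.inr_mul_inr _ _ _)
    (TrivSqZeroExt.inlHom A.toCrig (Fin n → A.toCrig))

lemma coords_gen (i : Fin n) : coords (A.gen i) = TrivSqZeroExt.inr (Pi.single i 1) :=
  desc_gen (B := CommSemiRingCat.of (TrivSqZeroExt A.toCrig (Fin n → A.toCrig))) _ _ _ i

lemma coords_inr (a : A.toCrig) : coords (n := n) (A.inr a) = TrivSqZeroExt.inl a :=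
  desc_inr (B := CommSemiRingCat.of (TrivSqZeroExt A.toCrig (Fin n → A.toCrig))) _ _ _ a

lemma coords_ofCoords (a : A.toCrig) (b : Fin n → A.toCrig) :
    coords (ofCoords a b) = TrivSqZeroExt.inl a + TrivSqZeroExt.inr b := by
  rw [ofCoords, map_add, coords_inr, map_sum]
  congr 1
  simp only [map_mul, coords_gen, coords_inr, TrivSqZeroExt.inr_mul_inl]
  rw [← TrivSqZeroExt.inr_sum]
  congr 1
  ext j
  simp [Finset.sum_apply, Pi.single_apply]

/-- The morphism `coords` to the trivial square-zero extension recovers `a` and `b` as the two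
components. -/
lemma ofCoords_inj {a a' : A.toCrig} {b b' : Fin n → A.toCrig} :
    ofCoords a b = ofCoords a' b' ↔ a = a' ∧ b = b' := by
  refine ⟨fun h => ?_, fun ⟨h, h'⟩ => by rw [h, h']⟩
  have e := congrArg coords h
  rw [coords_ofCoords, coords_ofCoords] at e
  exact ⟨by simpa using congrArg TrivSqZeroExt.fst e, by simpa using congrArg TrivSqZeroExt.snd e⟩

/-- Such expressions are closed under addition, so pure tensors `w ⊗ a` suffice; there one
multiplies the expansion of `w` in `1, x_1, …, x_n` by `a`. -/
lemma exists_ofCoords (t : (A.cons n).toCrig) :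
    ∃ (a : A.toCrig) (b : Fin n → A.toCrig), t = ofCoords a b := by
  refine TensorProduct.induction_on (R := ℕ) (M := W n) (N := A.toCrig)
    (motive := fun t => ∃ (a : A.toCrig) (b : Fin n → A.toCrig), t = ofCoords a b) t ?_ ?_ ?_
  · exact ⟨0, 0, by simp [ofCoords]; rfl⟩
  · intro w a
    obtain ⟨k, m, rfl⟩ := W.exists_eq_sum w
    refine ⟨k * a, fun i => m i * a, ?_⟩
    have h : ∀ (w : W n) (a : A.toCrig), TensorProduct.tmul ℕ w a =
        tensorInl (A := W n) (B := A.toCrig) w * tensorInr (A := W n) (B := A.toCrig) a :=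
      fun w a => ((Algebra.TensorProduct.tmul_mul_tmul w 1 1 a).trans (by simp)).symm
    let l : W n →+* (A.cons n).toCrig := tensorInl (A := W n) (B := A.toCrig)
    have e : l ((k : W n) + ∑ i, m i • W.x i) =
        A.inr (k : A.toCrig) + ∑ i, A.gen i * A.inr (m i : A.toCrig) := by
      simp only [map_add, map_natCast, map_sum, nsmul_eq_mul, map_mul]
      congr 1
      exact Finset.sum_congr rfl fun i _ => mul_comm _ _
    have e' : (A.inr (k : A.toCrig) + ∑ i, A.gen i * A.inr (m i : A.toCrig)) * A.inr a =
        ofCoords ((k : A.toCrig) * a) (fun i => (m i : A.toCrig) * a) := by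
      rw [add_mul, Finset.sum_mul]
      simp [ofCoords, mul_assoc]
    exact (h _ _).trans ((congrArg (fun t : (A.cons n).toCrig => t * A.inr a) e).trans e')
  · rintro _ _ ⟨a, b, rfl⟩ ⟨a', b', rfl⟩
    refine ⟨a + a', b + b', ?_⟩
    change ofCoords a b + ofCoords a' b' = _
    simp only [ofCoords, map_add, Pi.add_apply, mul_add, Finset.sum_add_distrib]
    abel

/-- Naturality of the coordinates: on sets, `W^n ⊗ f` is the power `f^(1+n)`. -/
lemma consMap_ofCoords (f : A ⟶ B) (a : A.toCrig) (b : Fin n → A.toCrig) :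
    (consMap (n := n) f).hom (ofCoords a b) = ofCoords (f.hom a) (fun i => f.hom (b i)) := by
  simp [consMap, ofCoords]

end Coordinates

/-! ### Limits detected on underlying sets -/

section SetLimit

universe v' u'

variable {J : Type u'} [Category.{v'} J] {K : J ⥤ Weil₁}

/-- The cone `c` is a limit cone on underlying sets. -/
def IsSetLimit (c : Cone K) : Prop :=
  ∀ s : (∀ j, (K.obj j).toCrig), (∀ {j j'} (f : j ⟶ j'), (K.map f).hom (s j) = s j') →
    ∃! x : c.pt.toCrig, ∀ j, (c.π.app j).hom x = s j

lemma IsSetLimit.ext {c : Cone K} (h : IsSetLimit c) {x y : c.pt.toCrig}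
    (e : ∀ j, (c.π.app j).hom x = (c.π.app j).hom y) : x = y :=
  (h (fun j => (c.π.app j).hom y) (fun f => by rw [← comp_hom, c.w])).unique e fun _ => rfl

/-- A cone which is a limit on underlying sets is a limit. -/
noncomputable def IsSetLimit.isLimit {c : Cone K} (h : IsSetLimit c) : IsLimit c := by
  -- The lift is chosen pointwise; it respects sums, products and units because the projections are
  -- jointly injective. Compatibility with augmentations is then automatic through `mkHom`.
  have key : ∀ s : Cone K, ∃ f : s.pt.toCrig →+* c.pt.toCrig,
      ∀ j z, (c.π.app j).hom (f z) = (s.π.app j).hom z := fun s => by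
    choose f hf using fun z : s.pt.toCrig =>
      (h (fun j => (s.π.app j).hom z) (fun f => by rw [← comp_hom, s.w])).exists
    exact ⟨{ toFun := f
             map_one' := h.ext fun j => by simp [hf]
             map_mul' := fun x y => h.ext fun j => by simp [hf]
             map_zero' := h.ext fun j => by simp [hf]
             map_add' := fun x y => h.ext fun j => by simp [hf] }, fun j z => hf z j⟩
  choose f hf using key
  exact
    { lift := fun s => mkHom (f s)
      fac := fun s j => hom_ext fun z => hf s j z
      uniq := fun s m hm => hom_ext fun z => h.ext fun j => by
        rw [mkHom_hom, hf, ← hm j, comp_hom] }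

/-- A compatible family in the `W^n ⊗ K_j` amounts to `1 + n` compatible families in the `K_j`, one
for each coordinate, and each has a unique solution. -/
lemma IsSetLimit.consFunctor {c : Cone K} (h : IsSetLimit c) (n : ℕ) :
    IsSetLimit ((consFunctor n).mapCone c) := by
  intro s hs
  choose a b hab using fun j => exists_ofCoords (s j)
  have hs' : ∀ {j j'} (f : j ⟶ j'), (K.map f).hom (a j) = a j' ∧
      (fun i => (K.map f).hom (b j i)) = b j' := fun {j j'} f => by
    have e := hs f
    rw [hab, hab] at e
    exact ofCoords_inj.1 ((consMap_ofCoords (K.map f) (a j) (b j)).symm.trans e)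
  obtain ⟨x, hx, -⟩ := h a (fun f => (hs' f).1)
  choose y hy _ using fun i => h (fun j => b j i) (fun f => congrFun (hs' f).2 i)
  refine ⟨ofCoords x y, fun j => ?_, fun z hz => ?_⟩
  · refine (consMap_ofCoords (c.π.app j) x y).trans ?_
    rw [hab j, ofCoords_inj]
    exact ⟨hx j, funext fun i => hy i j⟩
  · obtain ⟨x', y', rfl⟩ := exists_ofCoords (A := c.pt) z
    have e : ∀ j, (c.π.app j).hom x' = a j ∧ (fun i => (c.π.app j).hom (y' i)) = b j := fun j =>
      ofCoords_inj.1 ((consMap_ofCoords (c.π.app j) x' y').symm.trans ((hz j).trans (hab j)))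
    refine ofCoords_inj.2 ⟨h.ext fun j => ?_, funext fun i => h.ext fun j => ?_⟩
    · rw [(e j).1, hx]
    · rw [congrFun (e j).2 i, hy]

lemma IsSetLimit.functorPow {c : Cone K} (h : IsSetLimit c) :
    ∀ m, IsSetLimit ((functorPow tangentData.T m).mapCone c)
  | 0 => h
  | m + 1 => (h.functorPow m).consFunctor 1

end SetLimit

/-! ### Pullback powers of the projection and universality of the lift -/

section Powers

variable {n : ℕ} (A : Weil₁)

/-- The morphism `W^n ⊗ A ⟶ W ⊗ A` with `x_i ↦ x` and `x_j ↦ 0` for `j ≠ i`. -/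
def projAt (i : Fin n) : A.cons n ⟶ A.cons 1 :=
  mkHom (desc (Pi.single i (A.gen 0)) (fun j k => by
    by_cases hj : j = i
    · by_cases hk : k = i
      · subst hj hk; simp
      · simp [hk]
    · simp [hj]) A.inr)

/-- The morphism `W^n ⊗ A ⟶ A` with `x_i ↦ 0`. -/
def projAll : A.cons n ⟶ A := mkHom (desc (fun _ => 0) (fun _ _ => zero_mul _) (RingHom.id _))

lemma projAt_ofCoords (i : Fin n) (a : A.toCrig) (b : Fin n → A.toCrig) :
    (A.projAt i).hom (ofCoords a b) = ofCoords a (fun _ => b i) := by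
  simp [projAt, ofCoords, Pi.single_apply, ite_mul]

lemma projAll_ofCoords (a : A.toCrig) (b : Fin n → A.toCrig) :
    (A.projAll (n := n)).hom (ofCoords a b) = a := by
  simp [projAll, ofCoords]

lemma proj_ofCoords (a : A.toCrig) (b : Fin 1 → A.toCrig) :
    (A.proj).hom (ofCoords a b) = a := by
  simp [proj, ofCoords]

lemma proj₁_ofCoords (a : A.toCrig) (b : Fin 2 → A.toCrig) :
    (A.proj₁).hom (ofCoords a b) = ofCoords a (fun _ => b 0) := by
  simp [proj₁, ofCoords]

lemma proj₂_ofCoords (a : A.toCrig) (b : Fin 2 → A.toCrig) :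
    (A.proj₂).hom (ofCoords a b) = ofCoords a (fun _ => b 1) := by
  simp [proj₂, ofCoords]

variable (n) in
/-- `W^n ⊗ A` as a cone over `n` copies of `W ⊗ A ⟶ A`. -/
def powerCone : WidePullbackCone (fun _ : Fin n => A.proj) :=
  WidePullbackCone.mk A.projAll A.projAt (fun i => cons_hom_ext
    (fun j => by by_cases h : j = i <;> simp [projAt, proj, projAll, h])
    (fun a => by simp [projAt, proj, projAll]))

/-- A point of the pullback power consists of elements `a_i + x b_i` whose images `a_i` in `A` all
equal the base component `a`; it comes from `a + ∑ x_i b_i` alone. Using the base component for `a`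
also covers `n = 0`. -/
lemma powerCone_isSetLimit : IsSetLimit (A.powerCone n) := by
  intro s hs
  choose a b hab using fun i : Fin n => exists_ofCoords (A := A) (n := 1) (s (some i))
  have ha : ∀ i, a i = s none := fun i => by
    have e := hs (WidePullbackShape.Hom.term i)
    rw [hab] at e
    exact (proj_ofCoords A _ _).symm.trans e
  refine ⟨ofCoords (A := A) (s none) (fun i => b i 0), ?_, fun z hz => ?_⟩
  · rintro (_ | i)
    · exact projAll_ofCoords A _ _
    · refine (projAt_ofCoords A i _ _).trans ?_
      rw [hab, ha]
      exact ofCoords_inj.2 ⟨rfl, funext fun j => by rw [Subsingleton.elim j 0]⟩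
  · obtain ⟨x, y, rfl⟩ := exists_ofCoords (A := A) z
    refine ofCoords_inj.2 ⟨(projAll_ofCoords A x y).symm.trans (hz none), funext fun i => ?_⟩
    have e := (projAt_ofCoords A i x y).symm.trans (hz (some i))
    rw [hab] at e
    exact congrFun (ofCoords_inj.1 e).2 0

/-- `W^2 ⊗ A` as a cone over two copies of `W ⊗ A ⟶ A`. -/
lemma pairs_isPullback : IsPullback A.proj₁ A.proj₂ A.proj A.proj where
  w := cons_hom_ext (by simp [Fin.forall_fin_two, proj₁, proj₂, proj]) (by simp [proj₁, proj₂, proj])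
  isLimit' := ⟨IsSetLimit.isLimit (by
    intro s hs
    obtain ⟨a, b, h₁⟩ := exists_ofCoords (A := A) (n := 1) (s WalkingCospan.left)
    obtain ⟨a', b', h₂⟩ := exists_ofCoords (A := A) (n := 1) (s WalkingCospan.right)
    have e₁ : a = s WalkingCospan.one := by
      have e := hs WalkingCospan.Hom.inl
      rw [h₁] at e
      exact (proj_ofCoords A _ _).symm.trans e
    have e₂ : a' = s WalkingCospan.one := by
      have e := hs WalkingCospan.Hom.inr
      rw [h₂] at e
      exact (proj_ofCoords A _ _).symm.trans e
    -- The pair `a + x b`, `a + x b'` comes from `a + x_1 b + x_2 b'`.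
    refine ⟨ofCoords (A := A) a ![b 0, b' 0], ?_, fun z hz => ?_⟩
    · have l : (A.proj₁).hom (ofCoords a ![b 0, b' 0]) = s WalkingCospan.left := by
        rw [proj₁_ofCoords, h₁]
        exact ofCoords_inj.2 ⟨rfl, funext fun j => by rw [Subsingleton.elim j 0]; rfl⟩
      rintro (_ | _ | _)
      · refine Eq.trans ?_ (hs WalkingCospan.Hom.inl)
        rw [← l]
        rfl
      · exact l
      · refine (proj₂_ofCoords A _ _).trans ?_
        rw [h₂]
        exact ofCoords_inj.2 ⟨e₁.trans e₂.symm, funext fun j => by rw [Subsingleton.elim j 0]; rfl⟩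
    · obtain ⟨x, y, rfl⟩ := exists_ofCoords (A := A) z
      have z₁ := (proj₁_ofCoords A x y).symm.trans (hz WalkingCospan.left)
      have z₂ := (proj₂_ofCoords A x y).symm.trans (hz WalkingCospan.right)
      rw [h₁, ofCoords_inj] at z₁
      rw [h₂, ofCoords_inj] at z₂
      refine ofCoords_inj.2 ⟨z₁.1, funext fun i => ?_⟩
      fin_cases i
      · exact congrFun z₁.2 0
      · exact congrFun z₂.2 0)⟩

end Powers

lemma hasPairs : tangentData.HasPairs := ⟨fun A => A.pairs_isPullback⟩

/-- Replaces a pairing, known only through its universal property, by an explicit morphism that can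
be evaluated on generators. -/
lemma pair_eq {Z A : Weil₁} {f g : Z ⟶ A.cons 1} {w : f ≫ A.proj = g ≫ A.proj} (k : Z ⟶ A.cons 2)
    (h₁ : k ≫ A.proj₁ = f) (h₂ : k ≫ A.proj₂ = g) : hasPairs.pair f g w = k :=
  hasPairs.hom_ext ((hasPairs.pair_fst _ _ _).trans h₁.symm)
    ((hasPairs.pair_snd _ _ _).trans h₂.symm)

/-- The morphism `W^2 ⊗ A ⟶ W ⊗ (W^2 ⊗ A)` with `x_1 ↦ x ⊗ x_1` and `x_2 ↦ 1 ⊗ x_2`. -/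
def liftPair (A : Weil₁) : A.cons 2 ⟶ (A.cons 2).cons 1 :=
  mkHom (desc ![(A.cons 2).gen 0 * (A.cons 2).inr (A.gen 0), (A.cons 2).inr (A.gen 1)] (by
    have h : ∀ i j, (A.cons 2).inr (n := 1) (A.gen i) * (A.cons 2).inr (A.gen j) = 0 := fun i j => by
      rw [← map_mul, gen_mul_gen, map_zero]
    simp [Fin.forall_fin_two, h, mul_assoc, mul_left_comm]) ((A.cons 2).inr.comp A.inr))

lemma universalFork_w (A : Weil₁) : (A.liftPair ≫ consMap A.plus) ≫ consMap A.proj =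
    (A.liftPair ≫ consMap A.plus) ≫ (A.cons 1).proj ≫ A.proj ≫ A.unit :=
  cons_hom_ext (by simp [Fin.forall_fin_two, liftPair, consMap, plus, proj, unit])
    (by simp [liftPair, consMap, plus, proj, unit])

lemma universalFork_hom_ofCoords (A : Weil₁) (a : A.toCrig) (b : Fin 2 → A.toCrig) :
    (A.liftPair ≫ consMap A.plus).hom (ofCoords a b) =
      ofCoords (A := A.cons 1) (ofCoords a (fun _ => b 1)) (fun _ => ofCoords 0 (fun _ => b 0)) := by
  simp [liftPair, consMap, plus, ofCoords]
  ring

/-- Write an element of `W ⊗ (W ⊗ A)` as `(a + y b) + x (a' + y b')`, with `x` the outer and `y` the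
inner generator. The two parallel maps send it to `a + x a'` and to `a`, so the equalizer is cut out
by `a' = 0`. The fork map hits exactly these elements, once each. -/
lemma universalFork_isSetLimit (A : Weil₁) : IsSetLimit (Fork.ofι _ A.universalFork_w) := by
  intro s hs
  obtain ⟨t, t', h⟩ := exists_ofCoords (A := A.cons 1) (n := 1) (s WalkingParallelPair.zero)
  obtain ⟨a, b, rfl⟩ := exists_ofCoords t
  obtain ⟨t'', rfl⟩ : ∃ t'', t' = fun _ => t'' :=
    ⟨t' 0, funext fun j => by rw [Subsingleton.elim j 0]⟩
  obtain ⟨a', b', rfl⟩ := exists_ofCoords t''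
  have e := (hs WalkingParallelPairHom.left).trans (hs WalkingParallelPairHom.right).symm
  have e₁ : (consMap A.proj).hom (s WalkingParallelPair.zero) = ofCoords a (fun _ => a') := by
    rw [h, consMap_ofCoords, proj_ofCoords]
    simp only [proj_ofCoords]
  have e₂ : ((A.cons 1).proj ≫ A.proj ≫ A.unit).hom (s WalkingParallelPair.zero) =
      ofCoords a (fun _ => 0) := by
    rw [h, comp_hom, proj_ofCoords, comp_hom, proj_ofCoords]
    simp [unit, ofCoords]
  have ha : a' = 0 := congrFun (ofCoords_inj.1 (e₁.symm.trans (e.trans e₂))).2 0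
  subst ha
  -- The order is reversed because `x_1` maps to the product of the two generators, with coefficient
  -- `b'`, and `x_2` to the inner generator, with coefficient `b`.
  refine ⟨ofCoords (A := A) a ![b' 0, b 0], ?_, fun z hz => ?_⟩
  · have l : (A.liftPair ≫ consMap A.plus).hom (ofCoords a ![b' 0, b 0]) =
        s WalkingParallelPair.zero := by
      rw [universalFork_hom_ofCoords, h]
      have c : ∀ b : Fin 1 → A.toCrig, (fun _ => b 0) = b := fun b =>
        funext fun j => by rw [Subsingleton.elim j 0]
      exact ofCoords_inj.2 ⟨ofCoords_inj.2 ⟨rfl, c b⟩, funext fun _ => ofCoords_inj.2 ⟨rfl, c b'⟩⟩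
    rintro (_ | _)
    · exact l
    · refine Eq.trans ?_ (hs WalkingParallelPairHom.left)
      rw [← l]
      rfl
  · obtain ⟨x, y, rfl⟩ := exists_ofCoords (A := A) z
    have e := (universalFork_hom_ofCoords A x y).symm.trans ((hz WalkingParallelPair.zero).trans h)
    rw [ofCoords_inj, ofCoords_inj] at e
    refine ofCoords_inj.2 ⟨e.1.1, funext fun i => ?_⟩
    fin_cases i
    · exact congrFun (ofCoords_inj.1 (congrFun e.2 0)).2 0
    · exact congrFun e.1.2 0

/-! ### Equational axioms for `Weil₁` -/

lemma cons_cons_cons_hom_ext {k m n : ℕ} {A B : Weil₁} {f g : ((A.cons k).cons m).cons n ⟶ B}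
    (h₁ : ∀ i, f.hom (((A.cons k).cons m).gen i) = g.hom (((A.cons k).cons m).gen i))
    (h₂ : ∀ i, f.hom (((A.cons k).cons m).inr ((A.cons k).gen i)) =
      g.hom (((A.cons k).cons m).inr ((A.cons k).gen i)))
    (h₃ : ∀ i, f.hom (((A.cons k).cons m).inr ((A.cons k).inr (A.gen i))) =
      g.hom (((A.cons k).cons m).inr ((A.cons k).inr (A.gen i))))
    (h₄ : ∀ a, f.hom (((A.cons k).cons m).inr ((A.cons k).inr (A.inr a))) =
      g.hom (((A.cons k).cons m).inr ((A.cons k).inr (A.inr a)))) : f = g :=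
  cons_hom_ext h₁ fun a => congrArg (fun u : (A.cons k).cons m ⟶ B => u.hom a)
    (cons_cons_hom_ext (f := mkHom (f.hom.comp ((A.cons k).cons m).inr))
      (g := mkHom (g.hom.comp ((A.cons k).cons m).inr)) h₂ h₃ h₄)

/-- In coordinates the addition adds the coefficients of `x` over a common base `a`. The commutative
monoid axioms thereby reduce to those of addition in `A`. -/
lemma pair_plus_hom {Z A : Weil₁} {f g : Z ⟶ A.cons 1} (w : f ≫ A.proj = g ≫ A.proj)
    {z : Z.toCrig} {a a' : A.toCrig} {b b' : Fin 1 → A.toCrig} (hf : f.hom z = ofCoords a b)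
    (hg : g.hom z = ofCoords a' b') :
    (hasPairs.pair f g w ≫ A.plus).hom z = ofCoords a (b + b') := by
  obtain ⟨x, y, h⟩ := exists_ofCoords (A := A) ((hasPairs.pair f g w).hom z)
  have h₁ := congrArg (fun u : Z ⟶ A.cons 1 => u.hom z) (hasPairs.pair_fst f g w)
  have h₂ := congrArg (fun u : Z ⟶ A.cons 1 => u.hom z) (hasPairs.pair_snd f g w)
  replace h₁ : A.proj₁.hom ((hasPairs.pair f g w).hom z) = f.hom z := h₁
  replace h₂ : A.proj₂.hom ((hasPairs.pair f g w).hom z) = g.hom z := h₂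
  rw [h, proj₁_ofCoords, hf, ofCoords_inj] at h₁
  rw [h, proj₂_ofCoords, hg, ofCoords_inj] at h₂
  refine (congrArg A.plus.hom h).trans ?_
  rw [← h₁.1, ← h₁.2, ← h₂.2]
  simp [plus, ofCoords, mul_add]

lemma swap_swap (A : Weil₁) : A.swap ≫ A.swap = 𝟙 _ := by
  apply cons_cons_hom_ext <;> simp [swap]

lemma vlift_swap (A : Weil₁) : A.vlift ≫ A.swap = A.vlift := by
  apply cons_hom_ext <;> simp [swap, vlift, mul_comm]

lemma swap_proj (A : Weil₁) : A.swap ≫ (A.cons 1).proj = consMap A.proj := by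
  apply cons_cons_hom_ext <;> simp [swap, proj, consMap]

lemma unit_swap (A : Weil₁) : consMap A.unit ≫ A.swap = (A.cons 1).unit := by
  apply cons_hom_ext <;> simp [swap, unit, consMap]

lemma vlift_proj (A : Weil₁) : A.vlift ≫ consMap A.proj = A.proj ≫ A.unit := by
  apply cons_hom_ext <;> simp [vlift, unit, consMap, proj]

lemma unit_vlift (A : Weil₁) : A.unit ≫ A.vlift = A.unit ≫ (A.cons 1).unit :=
  hom_ext (by simp [vlift, unit])

lemma vlift_vlift (A : Weil₁) : A.vlift ≫ consMap A.vlift = A.vlift ≫ (A.cons 1).vlift := by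
  apply cons_hom_ext <;> simp [vlift, consMap, mul_assoc]

lemma swap_yangBaxter (A : Weil₁) : consMap A.swap ≫ (A.cons 1).swap ≫ consMap A.swap =
    (A.cons 1).swap ≫ consMap A.swap ≫ (A.cons 1).swap := by
  apply cons_cons_cons_hom_ext <;> simp [swap, consMap]

lemma vlift_swap_swap (A : Weil₁) : (A.cons 1).vlift ≫ consMap A.swap ≫ (A.cons 1).swap =
    A.swap ≫ consMap A.vlift := by
  apply cons_cons_hom_ext <;> simp [swap, consMap, vlift]

lemma plus_proj (A : Weil₁) : A.plus ≫ A.proj = A.proj₁ ≫ A.proj := by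
  apply cons_hom_ext <;> simp [Fin.forall_fin_two, plus, proj, proj₁]

/-- The morphism `W ⊗ (W^2 ⊗ A) ⟶ W^2 ⊗ (W ⊗ A)` which exchanges the first two factors. -/
def swapPair (A : Weil₁) : (A.cons 2).cons 1 ⟶ (A.cons 1).cons 2 :=
  mkHom (desc (fun _ => (A.cons 1).inr (A.gen 0))
    (fun _ _ => by rw [← map_mul, gen_mul_gen, map_zero])
    (desc (A.cons 1).gen (gen_mul_gen _) ((A.cons 1).inr.comp A.inr)))

/-- The morphism `W^2 ⊗ A ⟶ W^2 ⊗ (W ⊗ A)` with `x_i ↦ x_i ⊗ x`. -/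
def vliftPair (A : Weil₁) : A.cons 2 ⟶ (A.cons 1).cons 2 :=
  mkHom (desc (fun i => (A.cons 1).gen i * (A.cons 1).inr (A.gen 0))
    (fun _ _ => by rw [mul_mul_mul_comm, gen_mul_gen, zero_mul]) ((A.cons 1).inr.comp A.inr))

/-- `Weil₁` is a tangent category. -/
theorem isTangent : tangentData.IsTangent where
  toHasPairs := hasPairs
  hasPowers n A := ⟨⟨⟨_, (A.powerCone_isSetLimit (n := n)).isLimit⟩⟩⟩
  preservesPowers m n A := preservesLimit_of_preserves_limit_cone
    (A.powerCone_isSetLimit (n := n)).isLimit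
    ((A.powerCone_isSetLimit (n := n)).functorPow m).isLimit
  zero_p A := hom_ext (by simp [tangentData, unit, proj])
  add_p := plus_proj
  zero_add A := hom_ext fun z => by
    obtain ⟨a, b, rfl⟩ := exists_ofCoords (A := A) z
    refine (pair_plus_hom _ (a := a) (b := 0) (a' := a) (b' := b) ?_ rfl).trans (by rw [_root_.zero_add]; rfl)
    change A.unit.hom (A.proj.hom _) = _
    rw [proj_ofCoords]
    simp [unit, ofCoords]
  add_comm A := hom_ext fun z => by
    obtain ⟨a, b, rfl⟩ := exists_ofCoords (A := A) z
    refine (pair_plus_hom _ (proj₂_ofCoords A a b) (proj₁_ofCoords A a b)).trans ?_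
    change _ = A.plus.hom (ofCoords a b)
    simp [plus, ofCoords, mul_add, _root_.add_comm]
  add_assoc {Z A} f g k h h' := hom_ext fun z => by
    obtain ⟨a, b, hf⟩ := exists_ofCoords (A := A) (n := 1) (f.hom z)
    obtain ⟨a', b', hg⟩ := exists_ofCoords (A := A) (n := 1) (g.hom z)
    obtain ⟨a'', b'', hk⟩ := exists_ofCoords (A := A) (n := 1) (k.hom z)
    refine (pair_plus_hom _ (pair_plus_hom h hf hg) hk).trans ?_
    refine Eq.trans ?_ (pair_plus_hom _ hf (pair_plus_hom h' hg hk)).symm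
    rw [_root_.add_assoc]
  flip_flip := swap_swap
  lift_flip := vlift_swap
  flip_p := swap_proj
  flip_add A := by
    -- The pairing on the right is `swapPair`; what remains are comparisons on generators.
    refine Eq.trans ?_ (congrArg (fun u => u ≫ (A.cons 1).plus)
      (pair_eq (A := A.cons 1) A.swapPair ?_ ?_).symm)
    · change consMap A.plus ≫ A.swap = A.swapPair ≫ (A.cons 1).plus
      apply cons_cons_hom_ext <;> simp [swap, consMap, plus, swapPair]
    · change A.swapPair ≫ (A.cons 1).proj₁ = consMap A.proj₁ ≫ A.swap
      apply cons_cons_hom_ext <;> simp [Fin.forall_fin_two, swap, consMap, proj₁, swapPair]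
    · change A.swapPair ≫ (A.cons 1).proj₂ = consMap A.proj₂ ≫ A.swap
      apply cons_cons_hom_ext <;> simp [Fin.forall_fin_two, swap, consMap, proj₂, swapPair]
  flip_zero := unit_swap
  lift_p := vlift_proj
  lift_add A := by
    refine Eq.trans ?_ (congrArg (fun u => u ≫ (A.cons 1).plus)
      (pair_eq (A := A.cons 1) A.vliftPair ?_ ?_).symm)
    · change A.plus ≫ A.vlift = A.vliftPair ≫ (A.cons 1).plus
      apply cons_hom_ext <;> simp [vlift, plus, vliftPair]
    · change A.vliftPair ≫ (A.cons 1).proj₁ = A.proj₁ ≫ A.vlift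
      apply cons_hom_ext <;> simp [Fin.forall_fin_two, vlift, proj₁, vliftPair]
    · change A.vliftPair ≫ (A.cons 1).proj₂ = A.proj₂ ≫ A.vlift
      apply cons_hom_ext <;> simp [Fin.forall_fin_two, vlift, proj₂, vliftPair]
  lift_zero := unit_vlift
  lift_lift := vlift_vlift
  yangBaxter := swap_yangBaxter
  lift_flip_flip := vlift_swap_swap
  universal A := by
    refine ⟨A.liftPair, ?_, ?_, A.universalFork_w, ⟨A.universalFork_isSetLimit.isLimit⟩⟩
    · change A.liftPair ≫ consMap A.proj₁ = A.proj₁ ≫ A.vlift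
      apply cons_hom_ext <;> simp [Fin.forall_fin_two, liftPair, consMap, proj₁, vlift]
    · change A.liftPair ≫ consMap A.proj₂ = A.proj₂ ≫ (A.cons 1).unit
      apply cons_hom_ext <;> simp [Fin.forall_fin_two, liftPair, consMap, proj₂, unit]

end Weil₁

/-! ### The product with a trivial tangent structure -/

/-! ### The universal property of wide pullbacks in elementary form -/

section WidePullbacks

open Limits

variable {ι : Type*} {C : Type u} [Category.{v} C] {D : Type u₁} [Category.{v₁} D]
  {X : C} {Y : ι → C} {f : ∀ i, Y i ⟶ X}

/-- The image of a wide pullback cone is a limit if and only if it has the universal property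
of a wide pullback. -/
lemma nonempty_isLimit_mapCone_iff (G : C ⥤ D) (c : WidePullbackCone f) :
    Nonempty (IsLimit (G.mapCone c)) ↔
      ∀ {Z : D} (b : Z ⟶ G.obj X) (a : ∀ i, Z ⟶ G.obj (Y i)), (∀ i, a i ≫ G.map (f i) = b) →
        ∃! u : Z ⟶ G.obj c.pt, u ≫ G.map c.base = b ∧ ∀ i, u ≫ G.map (c.π i) = a i := by
  constructor
  · rintro ⟨h⟩ Z b a w
    let s : Cone (WidePullbackShape.wideCospan X Y f ⋙ G) :=
      { pt := Z
        π :=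
          { app := fun j => match j with
              | none => b
              | some i => a i
            naturality := by
              rintro _ _ (_ | i)
              · exact (Category.id_comp _).trans ((congrArg (fun t => _ ≫ t)
                  (CategoryTheory.Functor.map_id (WidePullbackShape.wideCospan X Y f ⋙ G) _)).trans
                    (Category.comp_id _)).symm
              · exact (Category.id_comp _).trans (w i).symm } }
    refine ⟨h.lift s, ⟨h.fac s none, fun i => h.fac s (some i)⟩, fun u hu => h.uniq s u ?_⟩
    rintro (_ | i)
    exacts [hu.1, hu.2 i]
  · intro h
    have w : ∀ (s : Cone (WidePullbackShape.wideCospan X Y f ⋙ G)) (i : ι),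
        (s.π.app (some i) : s.pt ⟶ G.obj (Y i)) ≫ G.map (f i) = s.π.app none :=
      fun s i => s.w (WidePullbackShape.Hom.term i)
    exact ⟨{
      lift := fun s => (h (s.π.app none) (fun i => s.π.app (some i)) (w s)).choose
      fac := fun s j => by
        obtain ⟨h₁, h₂⟩ := (h (s.π.app none) (fun i => s.π.app (some i)) (w s)).choose_spec.1
        cases j
        exacts [h₁, h₂ _]
      uniq := fun s m hm => (h (s.π.app none) (fun i => s.π.app (some i)) (w s)).choose_spec.2 m
        ⟨hm none, fun i => hm (some i)⟩ }⟩

lemma nonempty_isLimit_iff (c : WidePullbackCone f) :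
    Nonempty (IsLimit c) ↔
      ∀ {Z : C} (b : Z ⟶ X) (a : ∀ i, Z ⟶ Y i), (∀ i, a i ≫ f i = b) →
        ∃! u : Z ⟶ c.pt, u ≫ c.base = b ∧ ∀ i, u ≫ c.π i = a i :=
  nonempty_isLimit_mapCone_iff (𝟭 C) c

end WidePullbacks

section ProdTrivial

open Limits

variable {A : Type u₁} [Category.{v₁} A] {C : Type u} [Category.{v} C]

/-- The powers of `T × id` are the functors `T^m × id`. -/
def functorPowProd (T : A ⥤ A) : ∀ m, functorPow (T.prod (𝟭 C)) m ≅ (functorPow T m).prod (𝟭 C)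
  | 0 => NatIso.ofComponents (fun _ => Iso.refl _)
      (fun _ => (Category.comp_id _).trans (Category.id_comp _).symm)
  | m + 1 => Functor.isoWhiskerRight (functorPowProd T m) _ ≪≫
      NatIso.ofComponents (fun _ => Iso.refl _)
        (fun _ => (Category.comp_id _).trans (Category.id_comp _).symm)

/-- The cone with vertex `(c.pt, X.2)` over the pullback power of `p_X × id`. -/
def prodPowerCone (D : TangentData A) (X : A × C) {n : ℕ}
    (c : WidePullbackCone (fun _ : Fin n => D.p.app X.1)) :
    WidePullbackCone (fun _ : Fin n => (D.prodTrivial C).p.app X) :=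
  WidePullbackCone.mk (W := (c.pt, X.2)) (c.base, 𝟙 _) (fun i => (c.π i, 𝟙 _))
    (fun i => Prod.ext (c.condition i) (Category.id_comp _))

/-- The image of a limit cone under `F × id` is a limit if its image under `F` is. -/
lemma nonempty_isLimit_prodPowerCone (D : TangentData A) (X : A × C) {n : ℕ}
    (c : WidePullbackCone (fun _ : Fin n => D.p.app X.1)) (F : A ⥤ A)
    (hc : Nonempty (IsLimit (F.mapCone c))) :
    Nonempty (IsLimit ((F.prod (𝟭 C)).mapCone (prodPowerCone D X c))) := by
  rw [nonempty_isLimit_mapCone_iff] at hc ⊢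
  intro Z b a w
  obtain ⟨u, hu, hu'⟩ := hc b.1 (fun i => (a i).1) (fun i => congrArg Prod.fst (w i))
  have w₂ : ∀ i, (a i).2 = b.2 := fun i =>
    (Category.comp_id _).symm.trans (congrArg Prod.snd (w i))
  -- The second coordinate is read from the base leg, which is the only leg when `n = 0`.
  refine ⟨(u, b.2), ⟨Prod.ext hu.1 (Category.comp_id _),
    fun i => Prod.ext (hu.2 i) ((Category.comp_id _).trans (w₂ i).symm)⟩, fun m hm => ?_⟩
  exact Prod.ext (hu' m.1 ⟨congrArg Prod.fst hm.1, fun i => congrArg Prod.fst (hm.2 i)⟩)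
    ((Category.comp_id _).symm.trans (congrArg Prod.snd hm.1))

variable {D : TangentData A}

/-- The projection is the identity on the trivial factor. -/
lemma snd_eq {Z X : A × C} {f g : Z ⟶ (D.prodTrivial C).T.obj X}
    (w : f ≫ (D.prodTrivial C).p.app X = g ≫ (D.prodTrivial C).p.app X) : f.2 = g.2 :=
  (Category.comp_id _).symm.trans ((congrArg Prod.snd w).trans (Category.comp_id _))

lemma prodTrivial_hasPairs (h : D.HasPairs) : (D.prodTrivial C).HasPairs where
  isPullback X :=
    { w := Prod.ext (h.w X.1) rfl
      isLimit' := ⟨PullbackCone.IsLimit.mk _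
        (fun s => (h.pair s.fst.1 s.snd.1 (congrArg Prod.fst s.condition), s.fst.2))
        (fun _ => Prod.ext (h.pair_fst _ _ _) (Category.comp_id _))
        (fun s => Prod.ext (h.pair_snd _ _ _) ((Category.comp_id _).trans <| snd_eq s.condition))
        (fun _ _ hm hm' => Prod.ext
          (h.hom_ext ((congrArg Prod.fst hm).trans (h.pair_fst _ _ _).symm)
            ((congrArg Prod.fst hm').trans (h.pair_snd _ _ _).symm))
          ((Category.comp_id _).symm.trans (congrArg Prod.snd hm)))⟩ }

/-- A pairing in `A × C` is a pairing in `A` next to a single morphism of `C`. Each axiom that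
involves a pairing is reduced to `A` in this way. -/
lemma prodTrivial_pair_comp (h : D.HasPairs) (h' : (D.prodTrivial C).HasPairs) {Z X : A × C}
    (f g : Z ⟶ (D.prodTrivial C).T.obj X) (w w') {Y : A} (k : D.T₂.obj X.1 ⟶ Y) :
    h'.pair f g w ≫ (show (D.prodTrivial C).T₂.obj X ⟶ (Y, X.2) from (k, 𝟙 _)) =
      (h.pair f.1 g.1 w' ≫ k, f.2) := by
  have e : h'.pair f g w = (h.pair f.1 g.1 w', f.2) := by
    refine h'.hom_ext ?_ ?_
    · rw [h'.pair_fst]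
      exact Prod.ext (h.pair_fst _ _ _).symm (Category.comp_id _).symm
    · rw [h'.pair_snd]
      exact Prod.ext (h.pair_snd _ _ _).symm ((snd_eq w).symm.trans (Category.comp_id _).symm)
  rw [e]
  exact Prod.ext rfl (Category.comp_id _)

/-- The product of a tangent category with a trivial one is a tangent category. -/
theorem prodTrivial_isTangent (h : D.IsTangent) : (D.prodTrivial C).IsTangent where
  toHasPairs := prodTrivial_hasPairs h.toHasPairs
  hasPowers n X := by
    obtain ⟨⟨c⟩⟩ := h.hasPowers n X.1
    exact ⟨⟨⟨_, ((nonempty_isLimit_prodPowerCone D X c.cone (𝟭 A) ⟨c.isLimit⟩).some :)⟩⟩⟩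
  preservesPowers m n X := by
    have h₁ := h.hasPowers n X.1
    have h₂ := h.preservesPowers m n X.1
    let c := limit.cone (WidePullbackShape.wideCospan X.1 (fun _ : Fin n => D.T.obj X.1)
      (fun _ => D.p.app X.1))
    have hc : IsLimit c := limit.isLimit _
    -- Preservation is shown for `T^m × id` and then carried to the `m`-th power of `T × id` along
    -- `functorPowProd`.
    have l : PreservesLimit (WidePullbackShape.wideCospan X
        (fun _ : Fin n => (D.prodTrivial C).T.obj X) (fun _ => (D.prodTrivial C).p.app X))
        ((functorPow D.T m).prod (𝟭 C)) :=
      preservesLimit_of_preserves_limit_cone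
        (nonempty_isLimit_prodPowerCone D X c (𝟭 A) ⟨hc⟩).some
        (nonempty_isLimit_prodPowerCone D X c _ (h₂.preserves hc)).some
    exact preservesLimit_of_natIso _ (functorPowProd D.T m).symm
  zero_p X := Prod.ext (h.zero_p X.1) (Category.comp_id _)
  add_p X := Prod.ext (h.add_p X.1) rfl
  zero_add X := (prodTrivial_pair_comp h.toHasPairs _ _ _ _
    (by simp [h.zero_p]) (D.add.app X.1)).trans (Prod.ext (h.zero_add X.1) (Category.comp_id _))
  add_comm X := (prodTrivial_pair_comp h.toHasPairs _ _ _ _ (h.w X.1).symm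
    (D.add.app X.1)).trans (Prod.ext (h.add_comm X.1) rfl)
  add_assoc {Z X} f g k hfg hgk := by
    have p := fun (f g : Z ⟶ (D.prodTrivial C).T.obj X) w =>
      prodTrivial_pair_comp h.toHasPairs (prodTrivial_hasPairs h.toHasPairs) f g w
        (congrArg Prod.fst w) (D.add.app X.1)
    -- The compatibility proof inside a pairing depends on its arguments, so replacing them by equal
    -- morphisms is isolated here.
    have q : ∀ {a a' b b' : Z.1 ⟶ D.T.obj X.1} (w : a ≫ D.p.app X.1 = b ≫ D.p.app X.1)
        (w' : a' ≫ D.p.app X.1 = b' ≫ D.p.app X.1), a = a' → b = b' →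
        h.pair a b w ≫ D.add.app X.1 = h.pair a' b' w' ≫ D.add.app X.1 := by
      rintro a _ b _ _ _ rfl rfl
      rfl
    refine (p _ _ _).trans (Eq.trans ?_ (p _ _ _).symm)
    have e := congrArg Prod.fst (p f g hfg)
    have e' := congrArg Prod.snd (p f g hfg)
    have e'' := congrArg Prod.fst (p g k hgk)
    refine Prod.ext ?_ e'
    exact (q _ _ e rfl).trans
      ((h.add_assoc f.1 g.1 k.1 (congrArg Prod.fst hfg) (congrArg Prod.fst hgk)).trans
        (q _ _ rfl e''.symm))
  flip_flip X := Prod.ext (h.flip_flip X.1) (Category.comp_id _)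
  lift_flip X := Prod.ext (h.lift_flip X.1) (Category.comp_id _)
  flip_p X := Prod.ext (h.flip_p X.1) (Category.comp_id _)
  flip_add X := by
    have w : (D.T.map (D.fst.app X.1) ≫ D.flip.app X.1) ≫ D.p.app (D.T.obj X.1) =
        (D.T.map (D.snd.app X.1) ≫ D.flip.app X.1) ≫ D.p.app (D.T.obj X.1) := by
      simp [h.flip_p, ← Functor.map_comp, h.w]
    refine Eq.trans ?_ (prodTrivial_pair_comp h.toHasPairs (prodTrivial_hasPairs h.toHasPairs)
      (X := (D.prodTrivial C).T.obj X) _ _ _ w (D.add.app (D.T.obj X.1))).symm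
    exact Prod.ext (h.flip_add X.1) rfl
  flip_zero X := Prod.ext (h.flip_zero X.1) (Category.comp_id _)
  lift_p X := Prod.ext (h.lift_p X.1) rfl
  lift_add X := by
    have w : (D.fst.app X.1 ≫ D.lift.app X.1) ≫ D.p.app (D.T.obj X.1) =
        (D.snd.app X.1 ≫ D.lift.app X.1) ≫ D.p.app (D.T.obj X.1) := by
      rw [← h.lift_flip, Category.assoc, Category.assoc, Category.assoc, Category.assoc,
        h.flip_p, h.lift_p, ← Category.assoc, ← Category.assoc, h.w]
    refine Eq.trans ?_ (prodTrivial_pair_comp h.toHasPairs (prodTrivial_hasPairs h.toHasPairs)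
      (X := (D.prodTrivial C).T.obj X) _ _ _ w (D.add.app (D.T.obj X.1))).symm
    exact Prod.ext (h.lift_add X.1) rfl
  lift_zero X := Prod.ext (h.lift_zero X.1) rfl
  lift_lift X := Prod.ext (h.lift_lift X.1) rfl
  yangBaxter X := Prod.ext (h.yangBaxter X.1) rfl
  lift_flip_flip X := Prod.ext (h.lift_flip_flip X.1) (by simp)
  universal X := by
    obtain ⟨a, h₁, h₂, w, ⟨l⟩⟩ := h.universal X.1
    refine ⟨(a, 𝟙 _), Prod.ext h₁ rfl, Prod.ext h₂ rfl, Prod.ext w ?_, ⟨Fork.IsLimit.mk _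
      (fun s => (Fork.IsLimit.lift l s.ι.1 (congrArg Prod.fst s.condition), s.ι.2))
      (fun s => Prod.ext (Fork.IsLimit.lift_ι' l _ _) ?_)
      (fun s m hm => Prod.ext (Fork.IsLimit.hom_ext l ((congrArg Prod.fst hm).trans
        (Fork.IsLimit.lift_ι' l _ _).symm)) ?_)⟩⟩
    · simp
    · simp
    · simpa using congrArg Prod.snd hm

/-- The free tangent category. -/
theorem freeData_isTangent (C : Type u) [Category.{v} C] : (freeData C).IsTangent :=
  prodTrivial_isTangent Weil₁.isTangent

end ProdTrivial

/-! ### Levelwise finite limits of ind-objects -/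

section LevelLimits

open Limits

variable {C : Type u} [Category.{v} C] {I : Type w} [SmallCategory I] [IsFiltered I]

/-- The functor which sends a diagram indexed by `I` to the corresponding ind-object. -/
def level (C : Type u) [Category.{v} C] (I : Type w) [SmallCategory I] [IsFiltered I] :
    (I ⥤ C) ⥤ IndObj.{w} C where
  obj F := ⟨I, F⟩
  map ρ := levelHom ρ
  map_id F := by ext i; simp
  map_comp ρ σ := by ext i; simp

lemma level_bind_germ {F G : I ⥤ C} (ρ : F ⟶ G) {d : C} (i : I) (u : d ⟶ F.obj i) :
    (levelHom ρ).bind ((IndObj.mk I F : IndObj.{w} C).germ i u) =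
      (IndObj.mk I G : IndObj.{w} C).germ i (u ≫ ρ.app i) := by
  simp

/-- Finitely many stages of a filtered category have an upper bound. -/
lemma exists_common_germ {ι : Type*} [Finite ι] (F : ι → (I ⥤ C)) {d : C}
    (x : ∀ a, (IndObj.mk I (F a) : IndObj.{w} C).Germ d) :
    ∃ (k : I) (u : ∀ a, d ⟶ (F a).obj k), ∀ a, x a = IndObj.germ _ k (u a) := by
  classical
  have := Fintype.ofFinite ι
  choose i u h using fun a => IndObj.germ_surj _ (x a)
  obtain ⟨k, hk⟩ := IsFiltered.sup_objs_exists (Finset.univ.image i : Finset I)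
  have f : ∀ a, i a ⟶ k := fun a =>
    (hk (Finset.mem_image_of_mem i (Finset.mem_univ a))).some
  refine ⟨k, fun a => u a ≫ (F a).map (f a), fun a => ?_⟩
  rw [h a]
  exact (IndObj.germ_map (IndObj.mk I (F a) : IndObj.{w} C) (u a) (f a)).symm

lemma exists_map_eq_of_germ_eq {F : I ⥤ C} {d : C} {k : I} {u v : d ⟶ F.obj k}
    (h : (IndObj.mk I F : IndObj.{w} C).germ k u = IndObj.germ _ k v) :
    ∃ (m : I) (f : k ⟶ m), u ≫ F.map f = v ≫ F.map f := by
  obtain ⟨m, f, g, e⟩ := (IndObj.germ_eq_iff _ _ _).1 h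
  -- Equality of germs may use two different arrows out of `k`; coequalizing them yields a single
  -- one.
  refine ⟨_, f ≫ IsFiltered.coeqHom f g, ?_⟩
  change u ≫ F.map f = v ≫ F.map g at e
  conv_rhs => rw [IsFiltered.coeq_condition f g]
  simp only [F.map_comp, ← Category.assoc, e]

/-- Induction over finite subsets: the arrow obtained so far and the arrow for the next equation are
completed to a commutative square. -/
lemma exists_common_map_eq {ι : Type*} [Finite ι] (F : ι → (I ⥤ C)) {d : C} {k : I}
    {u v : ∀ a, d ⟶ (F a).obj k}
    (h : ∀ a, (IndObj.mk I (F a) : IndObj.{w} C).germ k (u a) = IndObj.germ _ k (v a)) :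
    ∃ (m : I) (f : k ⟶ m), ∀ a, u a ≫ (F a).map f = v a ≫ (F a).map f := by
  classical
  have := Fintype.ofFinite ι
  have key : ∀ s : Finset ι, ∃ (m : I) (f : k ⟶ m),
      ∀ a ∈ s, u a ≫ (F a).map f = v a ≫ (F a).map f := fun s => by
    induction s using Finset.induction with
    | empty => exact ⟨k, 𝟙 k, by simp⟩
    | insert a s _ hs =>
      obtain ⟨m, f, hf⟩ := hs
      obtain ⟨m', f', hf'⟩ := exists_map_eq_of_germ_eq (h a)
      obtain ⟨n, g, g', e⟩ := IsFiltered.span f f'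
      refine ⟨n, f ≫ g, fun b hb => ?_⟩
      obtain rfl | hb := Finset.mem_insert.1 hb
      · rw [e]
        simp only [Functor.map_comp, ← Category.assoc, hf']
      · simp only [Functor.map_comp, ← Category.assoc, hf b hb]
  obtain ⟨m, f, hf⟩ := key Finset.univ
  exact ⟨m, f, fun a => hf a (Finset.mem_univ a)⟩

/-- Germs are determined by their images under a finite family of levelwise jointly monic
transformations. -/
lemma germ_ext {ι : Type*} [Finite ι] {F : I ⥤ C} {G : ι → (I ⥤ C)} (ρ : ∀ a, F ⟶ G a) {d : C}
    (hρ : ∀ (i : I) (u v : d ⟶ F.obj i), (∀ a, u ≫ (ρ a).app i = v ≫ (ρ a).app i) → u = v)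
    {x y : (IndObj.mk I F : IndObj.{w} C).Germ d}
    (h : ∀ a, (levelHom (ρ a)).bind x = (levelHom (ρ a)).bind y) : x = y := by
  -- The two germs are indexed by `Bool` to obtain representatives at one stage.
  obtain ⟨k, u, hu⟩ := exists_common_germ (fun _ : Bool => F) (fun b => bif b then x else y)
  obtain rfl := hu true
  obtain rfl := hu false
  obtain ⟨m, f, hf⟩ := exists_common_map_eq G (fun a =>
    (level_bind_germ (ρ a) k (u true)).symm.trans ((h a).trans (level_bind_germ (ρ a) k (u false))))
  refine (IndObj.germ_eq_iff _ _ _).2 ⟨m, f, f, hρ m _ _ fun a => ?_⟩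
  have e := hf a
  simp only [Category.assoc, ← (ρ a).naturality] at e ⊢
  exact e

variable {J : Type} [SmallCategory J] [FinCategory J] {G : J ⥤ I ⥤ C}

/-- This is the commutation of finite limits with filtered colimits of sets. Finitely many
representatives live at one stage, their finitely many compatibilities hold at a later stage `m`,
and there the limit at level `m` gives the lift. Uniqueness is `germ_ext`. -/
lemma existsUnique_germ (c : Cone G) (hc : ∀ i, IsLimit (((evaluation I C).obj i).mapCone c))
    {d : C} (x : ∀ j, (IndObj.mk I (G.obj j) : IndObj.{w} C).Germ d)
    (hx : ∀ {j j'} (f : j ⟶ j'), (levelHom (G.map f)).bind (x j) = x j') :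
    ∃! y : (IndObj.mk I c.pt : IndObj.{w} C).Germ d, ∀ j, (levelHom (c.π.app j)).bind y = x j := by
  obtain ⟨k, u, hu⟩ := exists_common_germ G.obj x
  -- One equation for each arrow of `J`; the set of all arrows is finite.
  obtain ⟨m, f, hf⟩ := exists_common_map_eq (fun a : Σ j j' : J, (j ⟶ j') => G.obj a.2.1)
    (u := fun a => u a.1 ≫ (G.map a.2.2).app k) (v := fun a => u a.2.1) (fun a => by
      rw [← level_bind_germ, ← hu, ← hu, hx])
  let s : Cone (G ⋙ (evaluation I C).obj m) :=
    { pt := d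
      π :=
        { app := fun j => u j ≫ (G.obj j).map f
          naturality := fun j j' g => by
            have e := hf ⟨j, j', g⟩
            simp only [Category.assoc, ← (G.map g).naturality] at e
            simpa using e.symm } }
  let t : d ⟶ c.pt.obj m := (hc m).lift s
  have e : ∀ j, t ≫ (c.π.app j).app m = u j ≫ (G.obj j).map f := (hc m).fac s
  refine ⟨IndObj.germ _ m t, fun j => ?_, fun y hy => ?_⟩
  · refine (level_bind_germ (c.π.app j) m t).trans ?_
    rw [e, hu]
    exact IndObj.germ_map (IndObj.mk I (G.obj j) : IndObj.{w} C) _ _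
  · refine germ_ext (fun j => c.π.app j) (fun i a b h => (hc i).hom_ext h) fun j => ?_
    refine (hy j).trans (Eq.trans ?_ (level_bind_germ (c.π.app j) m t).symm)
    rw [e, hu]
    exact (IndObj.germ_map (IndObj.mk I (G.obj j) : IndObj.{w} C) _ _).symm

/-- Levelwise finite limits are limits of ind-objects. -/
noncomputable def levelIsLimit (c : Cone G)
    (hc : ∀ i, IsLimit (((evaluation I C).obj i).mapCone c)) :
    IsLimit ((level C I).mapCone c) := by
  have key : ∀ s : Cone (G ⋙ level C I), ∃! f : s.pt ⟶ (level C I).obj c.pt,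
      ∀ j, f ≫ (level C I).map (c.π.app j) = s.π.app j := fun s => by
    have hx : ∀ (i : s.pt.I) {j j' : J} (f : j ⟶ j'),
        (levelHom (G.map f)).bind ((s.π.app j).val i) = (s.π.app j').val i := fun i j j' f =>
      congrArg (fun t : s.pt ⟶ (level C I).obj (G.obj j') => t.val i) (s.w f)
    choose y hy hy' using fun i : s.pt.I => existsUnique_germ (d := s.pt.F.obj i) c hc
      (fun j => (s.π.app j).val i) (hx i)
    -- Compatibility of the chosen germs in `i` follows from their uniqueness.
    refine ⟨IndObj.Hom.mk y fun {i i'} f => hy' i _ fun j => ?_, fun j => ?_, fun g hg => ?_⟩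
    · exact (IndObj.Hom.bind_restrict _ _ _).trans
        ((congrArg (IndObj.restrict _ _) (hy i' j)).trans ((s.π.app j).compat f))
    · ext i
      exact hy i j
    · ext i
      exact hy' i _ fun j => congrArg (fun t : s.pt ⟶ (level C I).obj (G.obj j) => t.val i) (hg j)
  exact
    { lift := fun s => (key s).choose
      fac := fun s => (key s).choose_spec.1
      uniq := fun s m hm => (key s).choose_spec.2 m hm }

lemma level_isPullback {P F F' H : I ⥤ C} {fst : P ⟶ F} {snd : P ⟶ F'} {f : F ⟶ H} {g : F' ⟶ H}
    (h : ∀ i, IsPullback (fst.app i) (snd.app i) (f.app i) (g.app i)) :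
    IsPullback (levelHom fst : (IndObj.mk I P : IndObj.{w} C) ⟶ _) (levelHom snd) (levelHom f)
      (levelHom g) := by
  have w : fst ≫ f = snd ≫ g := by
    ext i
    exact (h i).w
  refine ⟨⟨?_⟩, ⟨isLimitMapConePullbackConeEquiv (level C I) w (levelIsLimit _ fun i =>
    (isLimitMapConePullbackConeEquiv ((evaluation I C).obj i) w).symm (h i).isLimit)⟩⟩
  exact ((level C I).map_comp _ _).symm.trans ((congrArg _ w).trans ((level C I).map_comp _ _))

lemma level_isLimit_fork {E F H : I ⥤ C} {ι : E ⟶ F} {f g : F ⟶ H}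
    (h : ∀ i, ∃ w : ι.app i ≫ f.app i = ι.app i ≫ g.app i, Nonempty (IsLimit (Fork.ofι _ w))) :
    ∃ w : (levelHom ι : (IndObj.mk I E : IndObj.{w} C) ⟶ _) ≫ levelHom f =
      levelHom ι ≫ levelHom g, Nonempty (IsLimit (Fork.ofι _ w)) := by
  have w : ι ≫ f = ι ≫ g := by
    ext i
    exact (h i).1
  exact ⟨_, ⟨isLimitMapConeForkEquiv (level C I) w (levelIsLimit _ fun i =>
    (isLimitMapConeForkEquiv ((evaluation I C).obj i) w).symm (h i).2.some)⟩⟩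

end LevelLimits

/-! ### Ind-completions of tangent categories -/

section IndTangentAxioms

open Limits

variable {C : Type u} [Category.{v} C] {D : TangentData C}

lemma ind_hasPairs (h : D.HasPairs) : (TangentData.ind.{w} D).HasPairs where
  isPullback X := by
    have e := level_isPullback.{w} (I := X.I) (fst := Functor.whiskerLeft X.F D.fst)
      (snd := Functor.whiskerLeft X.F D.snd)
      (f := Functor.whiskerLeft X.F D.p ≫ (Functor.rightUnitor X.F).hom)
      (g := Functor.whiskerLeft X.F D.p ≫ (Functor.rightUnitor X.F).hom)
      (fun i => by simpa using h.isPullback (X.F.obj i))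
    have hp : (TangentData.ind.{w} D).p.app X =
        levelHom (Functor.whiskerLeft X.F D.p ≫ (Functor.rightUnitor X.F).hom) := by
      ext i
      simp
    rw [hp]
    exact e

/-- By `germ_ext`, a germ in `Ind(T₂)` is determined by its two projections. The equation `e` only
ensures that representatives agree over `X` after moving to a later stage, so agreement at stage `j`
is the separate hypothesis `e'`. -/
lemma ind_pair_val (h : D.HasPairs) {Z X : IndObj.{w} C} (f g : Z ⟶ (TangentData.ind D).T.obj X)
    (e : f ≫ (TangentData.ind D).p.app X = g ≫ (TangentData.ind D).p.app X) {i : Z.I} {j : X.I}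
    {a b : Z.F.obj i ⟶ D.T.obj (X.F.obj j)} (e' : a ≫ D.p.app _ = b ≫ D.p.app _)
    (hf : f.val i = IndObj.germ ((TangentData.ind D).T.obj X) j a)
    (hg : g.val i = IndObj.germ ((TangentData.ind D).T.obj X) j b) :
    ((ind_hasPairs h).pair f g e).val i =
      IndObj.germ ((TangentData.ind D).T₂.obj X) j (h.pair a b e') := by
  refine germ_ext (F := X.F ⋙ D.T₂) (G := fun _ : Bool => X.F ⋙ D.T)
    (fun b => bif b then Functor.whiskerLeft X.F D.fst else Functor.whiskerLeft X.F D.snd)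
    (fun k u v huv => h.hom_ext (huv true) (huv false)) ?_
  rintro (_ | _)
  · refine (congrArg (fun t : Z ⟶ _ => t.val i) ((ind_hasPairs h).pair_snd f g e)).trans ?_
    refine hg.trans (Eq.trans ?_ (level_bind_germ (Functor.whiskerLeft X.F D.snd) j _).symm)
    exact congrArg (IndObj.germ ((TangentData.ind D).T.obj X) j) (h.pair_snd _ _ _).symm
  · refine (congrArg (fun t : Z ⟶ _ => t.val i) ((ind_hasPairs h).pair_fst f g e)).trans ?_
    refine hf.trans (Eq.trans ?_ (level_bind_germ (Functor.whiskerLeft X.F D.fst) j _).symm)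
    exact congrArg (IndObj.germ ((TangentData.ind D).T.obj X) j) (h.pair_fst _ _ _).symm

lemma ind_pair_add_val (h : D.HasPairs) {Z X : IndObj.{w} C}
    (f g : Z ⟶ (TangentData.ind D).T.obj X)
    (e : f ≫ (TangentData.ind D).p.app X = g ≫ (TangentData.ind D).p.app X) {i : Z.I} {j : X.I}
    {a b : Z.F.obj i ⟶ D.T.obj (X.F.obj j)} (e' : a ≫ D.p.app _ = b ≫ D.p.app _)
    (hf : f.val i = IndObj.germ ((TangentData.ind D).T.obj X) j a)
    (hg : g.val i = IndObj.germ ((TangentData.ind D).T.obj X) j b) :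
    IndObj.Hom.val ((ind_hasPairs h).pair f g e ≫ (TangentData.ind D).add.app X) i =
      IndObj.germ ((TangentData.ind D).T.obj X) j (h.pair a b e' ≫ D.add.app (X.F.obj j)) :=
  (congrArg (IndObj.Hom.bind _) (ind_pair_val h f g e e' hf hg)).trans
    (level_bind_germ (Functor.whiskerLeft X.F D.add) j _)

/-- The diagrams of the pullback powers of the levels of `p_X`. -/
abbrev levelProj (D : TangentData C) (X : IndObj.{w} C) : X.F ⋙ D.T ⟶ X.F :=
  Functor.whiskerLeft X.F D.p ≫ (Functor.rightUnitor X.F).hom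

lemma ind_p_app (X : IndObj.{w} C) : (TangentData.ind.{w} D).p.app X = levelHom (levelProj D X) := by
  ext i
  simp

/-- A cone over the pullback power of `p_X` given by cones over the powers of its levels. -/
def indPowerCone {X : IndObj.{w} C} {n : ℕ} (c : WidePullbackCone (fun _ : Fin n => levelProj D X)) :
    WidePullbackCone (fun _ : Fin n => (TangentData.ind.{w} D).p.app X) :=
  WidePullbackCone.mk (W := ⟨X.I, c.pt⟩) (levelHom c.base) (fun i => levelHom (c.π i)) (fun i => by
    rw [ind_p_app]
    exact ((level C X.I).map_comp _ _).symm.trans (congrArg _ (c.condition i)))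

lemma nonempty_isLimit_indPowerCone {X : IndObj.{w} C} {n : ℕ}
    {c : WidePullbackCone (fun _ : Fin n => levelProj D X)}
    (hc : ∀ i, IsLimit (((evaluation X.I C).obj i).mapCone c)) :
    Nonempty (IsLimit (indPowerCone c)) := by
  rw [nonempty_isLimit_iff]
  intro Z b a e
  exact (nonempty_isLimit_mapCone_iff _ _).1 ⟨levelIsLimit c hc⟩ b a (fun i => by rw [← e i, ind_p_app]; rfl)

lemma indMap_map_levelHom {E : Type u₁} [Category.{v₁} E] (F : C ⥤ E) {I : Type w}
    [SmallCategory I] [IsFiltered I] {G H : I ⥤ C} (ρ : G ⟶ H) :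
    (indMap F).map (levelHom ρ) = levelHom (Functor.whiskerRight ρ F) := by
  ext i
  simp

/-- Since `Ind(F)` acts on levelwise morphisms level by level, the image cone is again levelwise and
`levelIsLimit` applies to it. -/
lemma nonempty_isLimit_map_indPowerCone {X : IndObj.{w} C} {n : ℕ} (F : C ⥤ C)
    {c : WidePullbackCone (fun _ : Fin n => levelProj D X)}
    (hc : ∀ i, IsLimit (F.mapCone (((evaluation X.I C).obj i).mapCone c))) :
    Nonempty (IsLimit ((indMap F).mapCone (indPowerCone c))) := by
  rw [nonempty_isLimit_mapCone_iff]
  intro Z b a e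
  obtain ⟨u, hu, hu'⟩ := (nonempty_isLimit_mapCone_iff
    ((Functor.whiskeringRight X.I C C).obj F ⋙ level C X.I) c).1
    ⟨levelIsLimit (((Functor.whiskeringRight X.I C C).obj F).mapCone c) hc⟩ b a (fun i => by
      rw [← e i, ind_p_app, indMap_map_levelHom]
      rfl)
  refine ⟨u, ⟨?_, fun i => ?_⟩, fun m hm => hu' m ⟨?_, fun i => ?_⟩⟩
  · exact (congrArg _ (indMap_map_levelHom F c.base)).trans hu.1
  · exact (congrArg _ (indMap_map_levelHom F (c.π i))).trans (hu.2 i)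
  · exact (congrArg _ (indMap_map_levelHom F c.base).symm).trans hm.1
  · exact (congrArg _ (indMap_map_levelHom F (c.π i)).symm).trans (hm.2 i)

/-- The powers of `Ind(T)` are the functors `Ind(T^m)`. -/
def functorPowInd (T : C ⥤ C) :
    ∀ m, functorPow (indMap T : IndObj.{w} C ⥤ _) m ≅ indMap (functorPow T m)
  | 0 => (indId C).symm
  | m + 1 => Functor.isoWhiskerRight (functorPowInd T m) _ ≪≫ indComp (functorPow T m) T

/-- The levels of a pullback power of `p_X` form a pullback power of the level of `p_X`. -/
def evaluationIso (D : TangentData C) (X : IndObj.{w} C) (n : ℕ) (i : X.I) :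
    WidePullbackShape.wideCospan (X.F.obj i) (fun _ : Fin n => D.T.obj (X.F.obj i))
      (fun _ => D.p.app (X.F.obj i)) ≅
    WidePullbackShape.wideCospan X.F (fun _ : Fin n => X.F ⋙ D.T) (fun _ => levelProj D X) ⋙
      (evaluation X.I C).obj i :=
  WidePullbackShape.functorExt (Iso.refl _) (fun _ => Iso.refl _) (fun _ =>
    (Category.comp_id _).trans ((Category.id_comp _).trans (Category.comp_id _)).symm)

/-- Limits of functors are computed pointwise, so the pullback powers at the single levels assemble
into one diagram. -/
lemma exists_levelCone (h : D.IsTangent) (X : IndObj.{w} C) (n : ℕ) :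
    ∃ c : WidePullbackCone (fun _ : Fin n => levelProj D X),
      ∀ i, Nonempty (IsLimit (((evaluation X.I C).obj i).mapCone c)) := by
  have h₁ : ∀ i, HasLimit ((WidePullbackShape.wideCospan X.F (fun _ : Fin n => X.F ⋙ D.T)
      (fun _ => levelProj D X)).flip.obj i) := fun i => by
    have := h.hasPowers n (X.F.obj i)
    exact hasLimit_of_iso (evaluationIso D X n i)
  exact ⟨limit.cone _, fun i => ⟨isLimitOfPreserves _ (limit.isLimit _)⟩⟩

/-- The morphism `a` in the universality of the vertical lift is natural. -/
lemma exists_universal_natTrans (h : D.IsTangent) : ∃ a : D.T₂ ⟶ D.T₂ ⋙ D.T, ∀ X,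
    a.app X ≫ D.T.map (D.fst.app X) = D.fst.app X ≫ D.lift.app X ∧
    a.app X ≫ D.T.map (D.snd.app X) = D.snd.app X ≫ D.zero.app (D.T.obj X) ∧
    ∃ w : (a.app X ≫ D.T.map (D.add.app X)) ≫ D.T.map (D.p.app X) =
        (a.app X ≫ D.T.map (D.add.app X)) ≫ D.p.app (D.T.obj X) ≫ D.p.app X ≫ D.zero.app X,
      Nonempty (IsLimit (Fork.ofι (f := D.T.map (D.p.app X))
        (g := D.p.app (D.T.obj X) ≫ D.p.app X ≫ D.zero.app X)
          (a.app X ≫ D.T.map (D.add.app X)) w)) := by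
  -- `T` preserves the pullback `T₂ X`, so `T(π₁)` and `T(π₂)` are jointly monic. Preservation is an
  -- axiom about wide pullbacks, hence `T₂ X` is first rewritten as one over `Fin 2`.
  have mono : ∀ {Z X : C} (u v : Z ⟶ D.T.obj (D.T₂.obj X)),
      u ≫ D.T.map (D.fst.app X) = v ≫ D.T.map (D.fst.app X) →
      u ≫ D.T.map (D.snd.app X) = v ≫ D.T.map (D.snd.app X) → u = v := fun {Z X} u v h₁ h₂ => by
    let c : WidePullbackCone (fun _ : Fin 2 => D.p.app X) :=
      WidePullbackCone.mk (W := D.T₂.obj X) (D.fst.app X ≫ D.p.app X) ![D.fst.app X, D.snd.app X]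
        (by simp [Fin.forall_fin_two, h.w])
    have hc : Nonempty (IsLimit c) := by
      rw [nonempty_isLimit_iff]
      intro Z b a e
      refine ⟨h.pair (a 0) (a 1) ((e 0).trans (e 1).symm), ⟨?_, ?_⟩, fun m hm => ?_⟩
      · exact (h.pair_fst_assoc _ _ _ _).trans (e 0)
      · exact Fin.forall_fin_two.2 ⟨h.pair_fst _ _ _, h.pair_snd _ _ _⟩
      · exact h.hom_ext ((hm.2 0).trans (h.pair_fst _ _ _).symm)
          ((hm.2 1).trans (h.pair_snd _ _ _).symm)
    -- The first power of `T` and two copies of `p_X`.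
    have hT := (h.preservesPowers 1 2 X).preserves hc.some
    obtain ⟨t, -, ht⟩ := (nonempty_isLimit_mapCone_iff _ _).1 hT
      (v ≫ D.T.map (D.fst.app X ≫ D.p.app X))
      (fun i => v ≫ D.T.map (c.π i)) (fun i => (Category.assoc _ _ _).trans
        (congrArg _ ((D.T.map_comp _ _).symm.trans (congrArg _ (c.condition i)))))
    refine (ht u ⟨?_, Fin.forall_fin_two.2 ⟨h₁, h₂⟩⟩).trans (ht v ⟨rfl, fun _ => rfl⟩).symm
    change u ≫ D.T.map (D.fst.app X ≫ D.p.app X) = _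
    rw [D.T.map_comp, reassoc_of% h₁]
    rfl
  choose a h₁ h₂ h₃ using h.universal
  -- Naturality is tested on the two projections, where it reduces to that of `ℓ` and of `0`.
  refine ⟨{ app := a, naturality := fun X Y f => mono _ _ ?_ ?_ }, fun X => ⟨h₁ X, h₂ X, h₃ X⟩⟩
  · have e₁ := D.fst.naturality f
    have e₂ := D.lift.naturality f
    simp only [Functor.comp_map, Category.assoc, h₁, ← D.T.map_comp] at e₂ ⊢
    rw [e₁, D.T.map_comp, reassoc_of% h₁, ← e₂, reassoc_of% e₁]
  · have e₁ := D.snd.naturality f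
    have e₂ := D.zero.naturality (D.T.map f)
    simp only [Functor.comp_map, Functor.id_map, Category.assoc, h₂, ← D.T.map_comp] at e₂ ⊢
    rw [e₁, D.T.map_comp, reassoc_of% h₂, ← e₂, reassoc_of% e₁]

/-- The fork in the axiom for `Ind(𝕋)` involves the constraints of `Ind`; it equals the levelwise
fork morphism by morphism, and this transports the limit property. -/
lemma exists_isLimit_fork_congr {X Y Z : C} {ι ι' : X ⟶ Y} {f f' g g' : Y ⟶ Z} (hι : ι' = ι)
    (hf : f' = f) (hg : g' = g)
    (h : ∃ w : ι ≫ f = ι ≫ g, Nonempty (IsLimit (Fork.ofι ι w))) :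
    ∃ w : ι' ≫ f' = ι' ≫ g', Nonempty (IsLimit (Fork.ofι ι' w)) := by
  subst hι hf hg
  exact h

/-- The ind-completion of a tangent category is a tangent category. -/
theorem ind_isTangent (h : D.IsTangent) : (TangentData.ind.{w} D).IsTangent where
  toHasPairs := ind_hasPairs h.toHasPairs
  hasPowers n X := by
    obtain ⟨c, hc⟩ := exists_levelCone h X n
    exact ⟨⟨⟨_, (nonempty_isLimit_indPowerCone fun i => (hc i).some).some⟩⟩⟩
  preservesPowers m n X := by
    obtain ⟨c, hc⟩ := exists_levelCone h X n
    have l : PreservesLimit (WidePullbackShape.wideCospan X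
        (fun _ : Fin n => (TangentData.ind.{w} D).T.obj X)
        (fun _ => (TangentData.ind.{w} D).p.app X)) (indMap (functorPow D.T m)) :=
      preservesLimit_of_preserves_limit_cone
        (nonempty_isLimit_indPowerCone fun i => (hc i).some).some
        (nonempty_isLimit_map_indPowerCone _ fun i => by
          have := h.preservesPowers m n (X.F.obj i)
          have := preservesLimit_of_iso_diagram (functorPow D.T m) (evaluationIso D X n i)
          exact isLimitOfPreserves _ (hc i).some).some
    exact preservesLimit_of_natIso _ (functorPowInd D.T m).symm
  zero_p X := by ext i; simp [h.zero_p]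
  add_p X := by ext i; simp [h.add_p]
  zero_add X := by
    ext i
    have e : (D.p.app (X.F.obj i) ≫ D.zero.app _) ≫ D.p.app _ = 𝟙 _ ≫ D.p.app (X.F.obj i) := by
      simp [h.zero_p]
    refine (ind_pair_add_val h.toHasPairs _ _ _ (X := X) (i := i) (j := i) e (by simp)
      (by simp)).trans ?_
    exact congrArg (IndObj.germ ((TangentData.ind D).T.obj X) i) (h.zero_add _)
  add_comm X := by
    ext i
    refine (ind_pair_add_val h.toHasPairs _ _ _ (X := X) (i := i) (j := i)
      (h.w (X.F.obj i)).symm (by simp) (by simp)).trans ?_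
    exact (congrArg (IndObj.germ ((TangentData.ind D).T.obj X) i) (h.add_comm _)).trans (by simp)
  add_assoc {Z X} f g k e e' := by
    ext i
    -- The morphisms are arbitrary, so representatives are first brought to one stage `j`.
    obtain ⟨j, u, hu⟩ := exists_common_germ (fun _ : Fin 3 => X.F ⋙ D.T)
      ![f.val i, g.val i, k.val i]
    have hp : ∀ {f : Z ⟶ (TangentData.ind D).T.obj X} {j : X.I}
        {u : Z.F.obj i ⟶ D.T.obj (X.F.obj j)}, f.val i = IndObj.germ ((TangentData.ind D).T.obj X) j u →
        IndObj.Hom.val (f ≫ (TangentData.ind D).p.app X) i = X.germ j (u ≫ D.p.app _) := by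
      intro f j u h
      simp [h]
    have e₁ := congrArg (fun t : Z ⟶ X => t.val i) e
    have e₂ := congrArg (fun t : Z ⟶ X => t.val i) e'
    -- At the later stage `m` all three representatives lie over the same morphism to `X_m`, so
    -- associativity at that level applies.
    obtain ⟨m, a, ha⟩ := exists_common_map_eq (fun _ : Fin 2 => X.F)
      (u := fun b => u b.castSucc ≫ D.p.app _) (v := fun b => u b.succ ≫ D.p.app _)
      (Fin.forall_fin_two.2 ⟨(hp (hu 0)).symm.trans (e₁.trans (hp (hu 1))),
        (hp (hu 1)).symm.trans (e₂.trans (hp (hu 2)))⟩)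
    have hv : ∀ b, ![f.val i, g.val i, k.val i] b =
        IndObj.germ ((TangentData.ind D).T.obj X) m (u b ≫ D.T.map (X.F.map a)) := fun b =>
      (hu b).trans (IndObj.germ_map ((TangentData.ind D).T.obj X) (u b) a).symm
    have w : ∀ b : Fin 2, (u b.castSucc ≫ D.T.map (X.F.map a)) ≫ D.p.app _ =
        (u b.succ ≫ D.T.map (X.F.map a)) ≫ D.p.app _ := fun b => by
      have := ha b
      simp only [Category.assoc] at this ⊢
      have n := D.p.naturality (X.F.map a)
      simp only [Functor.id_map] at n
      rw [n]
      exact this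
    have w₁ := w 0
    have w₂ := w 1
    have q : ∀ {u v : Z.F.obj i ⟶ D.T.obj (X.F.obj m)} (w : u ≫ D.p.app _ = v ≫ D.p.app _),
        (h.pair u v w ≫ D.add.app _) ≫ D.p.app _ = u ≫ D.p.app _ := fun w => by simp [h.add_p]
    refine (ind_pair_add_val h.toHasPairs _ _ _ (i := i) (j := m) ?_
      (ind_pair_add_val h.toHasPairs _ _ e w₁ (hv 0) (hv 1)) (hv 2)).trans
      (Eq.trans ?_ (ind_pair_add_val h.toHasPairs _ _ _ (i := i) (j := m) ?_ (hv 0)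
        (ind_pair_add_val h.toHasPairs _ _ e' w₂ (hv 1) (hv 2))).symm)
    · exact (q w₁).trans (w₁.trans w₂)
    · exact congrArg (IndObj.germ ((TangentData.ind D).T.obj X) m) (h.add_assoc _ _ _ w₁ w₂)
    · exact w₁.trans (q w₂).symm
  flip_flip X := by ext i; simp [h.flip_flip]
  lift_flip X := by ext i; simp [h.lift_flip]
  flip_p X := by ext i; simp [h.flip_p]
  flip_add X := by
    ext i
    have e : (D.T.map (D.fst.app (X.F.obj i)) ≫ D.flip.app _) ≫ D.p.app _ =
        (D.T.map (D.snd.app (X.F.obj i)) ≫ D.flip.app _) ≫ D.p.app _ := by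
      simp [h.flip_p, ← Functor.map_comp, h.w]
    refine Eq.trans ?_ (ind_pair_add_val h.toHasPairs _ _ _ (i := i) (j := i)
      (X := (TangentData.ind D).T.obj X) e (by simp) (by simp)).symm
    refine Eq.trans ?_ (congrArg (IndObj.germ ((TangentData.ind D).T.obj
      ((TangentData.ind D).T.obj X)) i) (h.flip_add _))
    simp
  flip_zero X := by ext i; simp [h.flip_zero]
  lift_p X := by ext i; simp [h.lift_p]
  lift_add X := by
    ext i
    have e : (D.fst.app (X.F.obj i) ≫ D.lift.app _) ≫ D.p.app _ =
        (D.snd.app (X.F.obj i) ≫ D.lift.app _) ≫ D.p.app _ := by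
      rw [← h.lift_flip, Category.assoc, Category.assoc, Category.assoc, Category.assoc,
        h.flip_p, h.lift_p, ← Category.assoc, ← Category.assoc, h.w]
    refine Eq.trans ?_ (ind_pair_add_val h.toHasPairs _ _ _ (i := i) (j := i)
      (X := (TangentData.ind D).T.obj X) e (by simp) (by simp)).symm
    refine Eq.trans ?_ (congrArg (IndObj.germ ((TangentData.ind D).T.obj
      ((TangentData.ind D).T.obj X)) i) (h.lift_add _))
    simp
  lift_zero X := by ext i; simp [h.lift_zero]
  lift_lift X := by ext i; simp [h.lift_lift]
  yangBaxter X := by ext i; simp [h.yangBaxter]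
  lift_flip_flip X := by ext i; simp [h.lift_flip_flip]
  universal X := by
    obtain ⟨a, ha⟩ := exists_universal_natTrans h
    -- Naturality of `a` is what makes the levelwise family a morphism of ind-objects.
    let b : (TangentData.ind.{w} D).T₂.obj X ⟶
        (TangentData.ind.{w} D).T.obj ((TangentData.ind.{w} D).T₂.obj X) :=
      levelHom (Functor.whiskerLeft X.F a)
    have hb : ∀ i, b.val i = IndObj.germ ((TangentData.ind.{w} D).T.obj
      ((TangentData.ind.{w} D).T₂.obj X)) i (a.app (X.F.obj i)) := fun i => rfl
    refine ⟨b, ?_, ?_, ?_⟩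
    · ext i
      simp [hb, (ha _).1]
    · ext i
      simp [hb, (ha _).2.1]
    · refine exists_isLimit_fork_congr ?_ ?_ ?_ (level_isLimit_fork.{w} (I := X.I)
        (ι := Functor.whiskerLeft X.F (a ≫ Functor.whiskerRight D.add D.T))
        (f := Functor.whiskerLeft X.F (Functor.whiskerRight D.p D.T))
        (g := Functor.whiskerLeft X.F (Functor.whiskerLeft D.T D.p ≫ D.p ≫ D.zero))
        (fun i => (ha (X.F.obj i)).2.2))
      · ext i
        simp [hb]
        rfl
      · ext i
        simp
        rfl
      · ext i
        simp
        rfl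

end IndTangentAxioms

/-! ### Ind-objects of a product of two categories -/

section IndProd

variable {C : Type u₁} [Category.{v₁} C] {D : Type u₂} [Category.{v₂} D]

/-- The first component of a germ of an external product. -/
def germFst (X : IndObj.{w} C) (Y : IndObj.{w} D) {c : C} {d : D} :
    (IndObj.mk (X.I × Y.I) (X.F.prod Y.F) : IndObj.{w} (C × D)).Germ (c, d) → X.Germ c :=
  Quotient.map (fun x => ⟨x.1.1, x.2.1⟩) (by
    rintro x y ⟨k, f, g, h⟩
    exact ⟨k.1, f.1, g.1, congrArg Prod.fst h⟩)

/-- The second component of a germ of an external product. -/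
def germSnd (X : IndObj.{w} C) (Y : IndObj.{w} D) {c : C} {d : D} :
    (IndObj.mk (X.I × Y.I) (X.F.prod Y.F) : IndObj.{w} (C × D)).Germ (c, d) → Y.Germ d :=
  Quotient.map (fun x => ⟨x.1.2, x.2.2⟩) (by
    rintro x y ⟨k, f, g, h⟩
    exact ⟨k.2, f.2, g.2, congrArg Prod.snd h⟩)

lemma exists_germProd (X : IndObj.{w} C) (Y : IndObj.{w} D) {c : C} {d : D}
    (z : (IndObj.mk (X.I × Y.I) (X.F.prod Y.F) : IndObj.{w} (C × D)).Germ (c, d)) :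
    ∃ (i : X.I) (j : Y.I) (u : c ⟶ X.F.obj i) (v : d ⟶ Y.F.obj j),
      z = germProd X Y (X.germ i u) (Y.germ j v) := by
  obtain ⟨j, u, rfl⟩ := IndObj.germ_surj _ z
  exact ⟨j.1, j.2, u.1, u.2, rfl⟩

lemma germFst_germProd (X : IndObj.{w} C) (Y : IndObj.{w} D) {c : C} {d : D} (x : X.Germ c)
    (y : Y.Germ d) : germFst X Y (germProd X Y x y) = x := by
  obtain ⟨i, u, rfl⟩ := X.germ_surj x
  obtain ⟨j, v, rfl⟩ := Y.germ_surj y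
  rfl

lemma germSnd_germProd (X : IndObj.{w} C) (Y : IndObj.{w} D) {c : C} {d : D} (x : X.Germ c)
    (y : Y.Germ d) : germSnd X Y (germProd X Y x y) = y := by
  obtain ⟨i, u, rfl⟩ := X.germ_surj x
  obtain ⟨j, v, rfl⟩ := Y.germ_surj y
  rfl

lemma germProd_germFst_germSnd (X : IndObj.{w} C) (Y : IndObj.{w} D) {c : C} {d : D}
    (z : (IndObj.mk (X.I × Y.I) (X.F.prod Y.F) : IndObj.{w} (C × D)).Germ (c, d)) :
    germProd X Y (germFst X Y z) (germSnd X Y z) = z := by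
  obtain ⟨i, j, u, v, rfl⟩ := exists_germProd X Y z
  rfl

lemma germFst_restrict (X : IndObj.{w} C) (Y : IndObj.{w} D) {c c' : C} {d d' : D}
    (a : c' ⟶ c) (b : d' ⟶ d)
    (z : (IndObj.mk (X.I × Y.I) (X.F.prod Y.F) : IndObj.{w} (C × D)).Germ (c, d)) :
    germFst X Y (IndObj.restrict _ (show ((c', d') : C × D) ⟶ (c, d) from (a, b)) z) =
      X.restrict a (germFst X Y z) := by
  obtain ⟨i, j, u, v, rfl⟩ := exists_germProd X Y z
  rfl

lemma germSnd_restrict (X : IndObj.{w} C) (Y : IndObj.{w} D) {c c' : C} {d d' : D}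
    (a : c' ⟶ c) (b : d' ⟶ d)
    (z : (IndObj.mk (X.I × Y.I) (X.F.prod Y.F) : IndObj.{w} (C × D)).Germ (c, d)) :
    germSnd X Y (IndObj.restrict _ (show ((c', d') : C × D) ⟶ (c, d) from (a, b)) z) =
      Y.restrict b (germSnd X Y z) := by
  obtain ⟨i, j, u, v, rfl⟩ := exists_germProd X Y z
  rfl

/-- The components of a product of germs are recovered from it. A filtered category is nonempty, so
each component of a morphism occurs in some pair. -/
instance indProd_faithful : (indProd.{w} C D).Faithful where
  map_injective {X Y f g} h := by
    have e : ∀ (i : X.1.I) (j : X.2.I), germProd Y.1 Y.2 (f.1.val i) (f.2.val j) =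
        germProd Y.1 Y.2 (g.1.val i) (g.2.val j) := fun i j =>
      congrArg (fun t : (indProd.{w} C D).obj X ⟶ (indProd.{w} C D).obj Y => t.val (i, j)) h
    obtain ⟨i₀⟩ := IsFiltered.nonempty (C := X.1.I)
    obtain ⟨j₀⟩ := IsFiltered.nonempty (C := X.2.I)
    refine Prod.ext (IndObj.hom_ext fun i => ?_) (IndObj.hom_ext fun j => ?_)
    · simpa only [germFst_germProd] using congrArg (germFst Y.1 Y.2) (e i j₀)
    · simpa only [germSnd_germProd] using congrArg (germSnd Y.1 Y.2) (e i₀ j)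

/-- The first component of `h` at `(i, j)` does not depend on `j`, since any two indices have an
upper bound, and symmetrically for the second. So the components at fixed `j₀` and `i₀` define a
preimage. -/
instance indProd_full : (indProd.{w} C D).Full where
  map_surjective {X Y} h := by
    obtain ⟨i₀⟩ := IsFiltered.nonempty (C := X.1.I)
    obtain ⟨j₀⟩ := IsFiltered.nonempty (C := X.2.I)
    have e₁ : ∀ (i i' : X.1.I) (j j' : X.2.I) (a : i ⟶ i') (b : j ⟶ j'),
        Y.1.restrict (X.1.F.map a) (germFst Y.1 Y.2 (h.val (i', j'))) =
          germFst Y.1 Y.2 (h.val (i, j)) := fun i i' j j' a b =>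
      (germFst_restrict Y.1 Y.2 (X.1.F.map a) (X.2.F.map b) (h.val (i', j'))).symm.trans
        (congrArg (germFst Y.1 Y.2) (h.compat (show ((i, j) : X.1.I × X.2.I) ⟶ (i', j') from (a, b))))
    have e₂ : ∀ (i i' : X.1.I) (j j' : X.2.I) (a : i ⟶ i') (b : j ⟶ j'),
        Y.2.restrict (X.2.F.map b) (germSnd Y.1 Y.2 (h.val (i', j'))) =
          germSnd Y.1 Y.2 (h.val (i, j)) := fun i i' j j' a b =>
      (germSnd_restrict Y.1 Y.2 (X.1.F.map a) (X.2.F.map b) (h.val (i', j'))).symm.trans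
        (congrArg (germSnd Y.1 Y.2) (h.compat (show ((i, j) : X.1.I × X.2.I) ⟶ (i', j') from (a, b))))
    have c₁ : ∀ i j j', germFst Y.1 Y.2 (h.val (i, j)) = germFst Y.1 Y.2 (h.val (i, j')) :=
      fun i j j' => (e₁ i i j _ (𝟙 i) (IsFiltered.leftToMax j j')).symm.trans
        (e₁ i i j' _ (𝟙 i) (IsFiltered.rightToMax j j'))
    have c₂ : ∀ i i' j, germSnd Y.1 Y.2 (h.val (i, j)) = germSnd Y.1 Y.2 (h.val (i', j)) :=
      fun i i' j => (e₂ i _ j j (IsFiltered.leftToMax i i') (𝟙 j)).symm.trans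
        (e₂ i' _ j j (IsFiltered.rightToMax i i') (𝟙 j))
    refine ⟨(IndObj.Hom.mk (fun i => germFst Y.1 Y.2 (h.val (i, j₀))) fun f => e₁ _ _ _ _ f (𝟙 _),
      IndObj.Hom.mk (fun j => germSnd Y.1 Y.2 (h.val (i₀, j))) fun f => e₂ _ _ _ _ (𝟙 _) f),
      IndObj.hom_ext fun i => ?_⟩
    refine Eq.trans ?_ (germProd_germFst_germSnd Y.1 Y.2 (h.val i))
    exact congrArg₂ (germProd Y.1 Y.2) (c₁ i.1 j₀ i.2) (c₂ i₀ i.1 i.2)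

/-- Two upper bounds of the same pair of indices can be merged compatibly with all four arrows.
Hence the choice of upper bound in `indProdIso` is immaterial. -/
lemma germ_diag_eq (Z : IndObj.{w} (C × D)) {i i' k k' : Z.I} (f : i ⟶ k) (g : i' ⟶ k)
    (f' : i ⟶ k') (g' : i' ⟶ k') :
    Z.germ k (show ((Z.F.obj i).1, (Z.F.obj i').2) ⟶ Z.F.obj k from
      ((Z.F.map f).1, (Z.F.map g).2)) =
    Z.germ k' (show ((Z.F.obj i).1, (Z.F.obj i').2) ⟶ Z.F.obj k' from
      ((Z.F.map f').1, (Z.F.map g').2)) := by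
  obtain ⟨m, a, b, h, h'⟩ := IsFiltered.bowtie f f' g g'
  refine (Z.germ_eq_iff _ _).2 ⟨m, a, b, Prod.ext ?_ ?_⟩
  · have := congrArg (fun t => (Z.F.map t).1) h
    simpa using this
  · have := congrArg (fun t => (Z.F.map t).2) h'
    simpa using this

/-- The external product of the components of an ind-object of pairs. -/
abbrev diagObj (Z : IndObj.{w} (C × D)) : IndObj.{w} (C × D) :=
  (indProd.{w} C D).obj (⟨Z.I, Z.F ⋙ CategoryTheory.Prod.fst C D⟩,
    ⟨Z.I, Z.F ⋙ CategoryTheory.Prod.snd C D⟩)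

/-- An ind-object of pairs is isomorphic to the external product of its components. -/
noncomputable def indProdIso (Z : IndObj.{w} (C × D)) : diagObj Z ≅ Z where
  hom := IndObj.Hom.mk (X := diagObj Z)
    (fun i => Z.germ (IsFiltered.max i.1 i.2)
      (show ((Z.F.obj i.1).1, (Z.F.obj i.2).2) ⟶ Z.F.obj (IsFiltered.max i.1 i.2) from
        ((Z.F.map (IsFiltered.leftToMax i.1 i.2)).1, (Z.F.map (IsFiltered.rightToMax i.1 i.2)).2)))
    (fun {i i'} f => by
      refine Eq.trans ?_ (germ_diag_eq Z (f.1 ≫ IsFiltered.leftToMax i'.1 i'.2)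
        (f.2 ≫ IsFiltered.rightToMax i'.1 i'.2) _ _)
      have e₁ := congrArg Prod.fst (Z.F.map_comp f.1 (IsFiltered.leftToMax i'.1 i'.2)).symm
      have e₂ := congrArg Prod.snd (Z.F.map_comp f.2 (IsFiltered.rightToMax i'.1 i'.2)).symm
      exact congrArg (Z.germ _) (Prod.ext e₁ e₂))
  inv := IndObj.Hom.mk (Y := diagObj Z)
    (fun i => (diagObj Z).germ (i, i) (𝟙 (Z.F.obj i)))
    (fun {i i'} f => by
      refine Eq.trans ?_ ((diagObj Z).germ_map (𝟙 (Z.F.obj i))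
        (show ((i, i) : Z.I × Z.I) ⟶ (i', i') from (f, f)))
      exact congrArg ((diagObj Z).germ (i', i'))
        ((Category.comp_id (Z.F.map f)).trans (Category.id_comp (Z.F.map f)).symm))
  -- The composite at `i` is the transition map from `i` to the diagonal index given by its maximum,
  -- which represents the identity.
  hom_inv_id := IndObj.hom_ext fun i => by
    refine Eq.trans ?_ ((diagObj Z).germ_map (𝟙 ((diagObj Z).F.obj i))
      (show i ⟶ (IsFiltered.max i.1 i.2, IsFiltered.max i.1 i.2) from
        (IsFiltered.leftToMax i.1 i.2, IsFiltered.rightToMax i.1 i.2)))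
    exact congrArg ((diagObj Z).germ _) ((Category.comp_id _).trans (Category.id_comp _).symm)
  inv_hom_id := IndObj.hom_ext fun i => by
    refine Eq.trans ?_ ((germ_diag_eq Z (IsFiltered.leftToMax i i) (IsFiltered.rightToMax i i)
      (𝟙 i) (𝟙 i)).trans ?_)
    · exact congrArg (Z.germ _) (Category.id_comp _)
    · exact congrArg (Z.germ i) (Prod.ext (congrArg Prod.fst (Z.F.map_id i))
        (congrArg Prod.snd (Z.F.map_id i)))

instance indProd_isEquivalence : (indProd.{w} C D).IsEquivalence where
  essSurj := ⟨fun Z => ⟨_, ⟨indProdIso Z⟩⟩⟩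

end IndProd

/-! ### The comparison of free tangent categories and ind-completions -/

section Comparison

variable {C : Type u} [Category.{w} C]

/-- The factor from `Weil₁` is indexed by a point, so a representative of the second component
already gives one of the pair. -/
lemma comparison_map_val {X Y : Weil₁ × IndObj.{w} C} (f : X ⟶ Y) (i : X.2.I) {j : Y.2.I}
    {v : X.2.F.obj i ⟶ Y.2.F.obj j} (h : f.2.val i = Y.2.germ j v) (k k' : Discrete PUnit.{w + 1}) :
    ((comparison C).map f).val (k, i) =
      ((comparison C).obj Y).germ (k', j)
        (show (X.1, X.2.F.obj i) ⟶ (Y.1, Y.2.F.obj j) from (f.1, v)) := by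
  obtain rfl : k = k' := Subsingleton.elim _ _
  change germProd ((incl Weil₁).obj Y.1) Y.2 (((incl Weil₁).map f.1).val k) (f.2.val i) = _
  rw [h]
  rfl

/-- The identification of `((S A, Y_j))_j` with `Ind(S × id)((A, Y_j)_j)`, the identity in each
degree. -/
def levelComm (S : Weil₁ ⥤ Weil₁) (X : Weil₁ × IndObj.{w} C) :
    (comparison C).obj (S.obj X.1, X.2) ⟶
      (indMap (S.prod (𝟭 C))).obj ((comparison C).obj X) :=
  levelHom (I := Discrete PUnit.{w + 1} × X.2.I)
    (G := (((Functor.const _).obj X.1).prod X.2.F) ⋙ S.prod (𝟭 C))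
    { app := fun i => 𝟙 _
      naturality := fun i j f => by
        refine (Category.comp_id _).trans (Eq.trans ?_ (Category.id_comp _).symm)
        exact Prod.ext (S.map_id X.1).symm rfl }

/-- The constraint between `comparison ∘ T` and `Ind(T) ∘ comparison`. -/
def comparisonComm (C : Type u) [Category.{w} C] :
    (freeData (IndObj.{w} C)).T ⋙ comparison.{w} C ⟶
      comparison.{w} C ⋙ (TangentData.ind.{w} (freeData C)).T where
  app X := levelComm Weil₁.tangentData.T X
  naturality X Y f := by
    ext ⟨k, i⟩
    obtain ⟨j, v, h⟩ := Y.2.germ_surj (f.2.val i)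
    have e₁ := comparison_map_val f i h k k
    have e₂ := comparison_map_val ((freeData (IndObj.{w} C)).T.map f) i h k k
    refine (congrArg (IndObj.Hom.bind _) e₂).trans (Eq.trans ?_ (congrArg (fun t =>
      IndObj.restrict _ (𝟙 _) (germMap (freeData C).T ((comparison C).obj Y) t)) e₁).symm)
    exact congrArg (IndObj.germ ((TangentData.ind (freeData C)).T.obj ((comparison C).obj Y)) (k, j))
      ((Category.comp_id _).trans (Category.id_comp _).symm)

variable (hC : (freeData C).IsTangent) (h : (freeData (IndObj.{w} C)).IsTangent)
  (h' : (TangentData.ind.{w} (freeData C)).IsTangent)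

/-- The constraint induced on `T₂` is again the identity in each degree; both projections confirm
this. -/
lemma pair_comparison (X : Weil₁ × IndObj.{w} C) (e) :
    h'.pair ((comparison C).map ((freeData (IndObj.{w} C)).fst.app X) ≫ (comparisonComm C).app X)
      ((comparison C).map ((freeData (IndObj.{w} C)).snd.app X) ≫ (comparisonComm C).app X) e =
      levelComm Weil₁.tangentData.T₂ X := by
  refine h'.hom_ext ?_ ?_
  · rw [h'.pair_fst]
    ext i
    refine congrArg (IndObj.germ ((TangentData.ind (freeData C)).T.obj ((comparison C).obj X)) i)
      (Prod.ext ?_ ?_)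
    · change Weil₁.tangentData.fst.app X.1 ≫ 𝟙 _ = 𝟙 _ ≫ Weil₁.tangentData.fst.app X.1
      simp
    · change 𝟙 (X.2.F.obj i.2) ≫ 𝟙 _ = 𝟙 _ ≫ 𝟙 _
      simp
  · rw [h'.pair_snd]
    ext i
    refine congrArg (IndObj.germ ((TangentData.ind (freeData C)).T.obj ((comparison C).obj X)) i)
      (Prod.ext ?_ ?_)
    · change Weil₁.tangentData.snd.app X.1 ≫ 𝟙 _ = 𝟙 _ ≫ Weil₁.tangentData.snd.app X.1
      simp
    · change 𝟙 (X.2.F.obj i.2) ≫ 𝟙 _ = 𝟙 _ ≫ 𝟙 _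
      simp

/-- The comparison functor preserves the tangent structure strictly. -/
def comparisonTan :
    Tan.Hom (prodObj Weil₁.tangentData (IndObj.{w} C) h)
      ((prodObj Weil₁.tangentData C hC).ind h') where
  functor := comparison C
  comm := comparisonComm C
  comm_p X := by
    ext i
    refine congrArg (IndObj.germ ((comparison C).obj X) i) (Prod.ext ?_ ?_)
    · change 𝟙 _ ≫ Weil₁.tangentData.p.app X.1 ≫ 𝟙 X.1 = Weil₁.tangentData.p.app X.1
      simp
    · change 𝟙 (X.2.F.obj i.2) ≫ 𝟙 _ ≫ 𝟙 _ = 𝟙 _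
      simp
  zero_comm X := by
    ext i
    refine congrArg (IndObj.germ ((TangentData.ind (freeData C)).T.obj ((comparison C).obj X)) i)
      (Prod.ext ?_ ?_)
    · change Weil₁.tangentData.zero.app X.1 ≫ 𝟙 _ = 𝟙 X.1 ≫ Weil₁.tangentData.zero.app X.1
      simp
    · change 𝟙 (X.2.F.obj i.2) ≫ 𝟙 _ = 𝟙 _ ≫ 𝟙 _
      simp
  add_comm X := by
    refine Eq.trans ?_ (congrArg (fun t => t ≫ (TangentData.ind (freeData C)).add.app
      ((comparison C).obj X)) (pair_comparison h' X _).symm)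
    ext i
    refine congrArg (IndObj.germ ((TangentData.ind (freeData C)).T.obj ((comparison C).obj X)) i)
      (Prod.ext ?_ ?_)
    · change Weil₁.tangentData.add.app X.1 ≫ 𝟙 _ = 𝟙 _ ≫ Weil₁.tangentData.add.app X.1
      simp
    · change 𝟙 (X.2.F.obj i.2) ≫ 𝟙 _ = 𝟙 _ ≫ 𝟙 _
      simp
  lift_comm X := by
    ext i
    refine congrArg (IndObj.germ ((TangentData.ind (freeData C)).T.obj
      ((TangentData.ind (freeData C)).T.obj ((comparison C).obj X))) i) (Prod.ext ?_ ?_)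
    · change Weil₁.tangentData.lift.app X.1 ≫ 𝟙 _ ≫ Weil₁.tangentData.T.map (𝟙 _) =
        𝟙 _ ≫ Weil₁.tangentData.lift.app X.1 ≫ 𝟙 _
      simp
    · change 𝟙 (X.2.F.obj i.2) ≫ 𝟙 _ ≫ 𝟙 _ = 𝟙 _ ≫ 𝟙 _ ≫ 𝟙 _
      simp
  flip_comm X := by
    ext i
    refine congrArg (IndObj.germ ((TangentData.ind (freeData C)).T.obj
      ((TangentData.ind (freeData C)).T.obj ((comparison C).obj X))) i) (Prod.ext ?_ ?_)
    · change Weil₁.tangentData.flip.app X.1 ≫ 𝟙 _ ≫ Weil₁.tangentData.T.map (𝟙 _) =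
        (𝟙 _ ≫ Weil₁.tangentData.T.map (𝟙 _)) ≫ 𝟙 _ ≫ Weil₁.tangentData.flip.app X.1 ≫ 𝟙 _
      simp
    · change 𝟙 (X.2.F.obj i.2) ≫ 𝟙 _ ≫ 𝟙 _ = (𝟙 _ ≫ 𝟙 _) ≫ 𝟙 _ ≫ 𝟙 _ ≫ 𝟙 _
      simp

section StrongTransformation

variable {D : Type u} [Category.{w} D]

/-- The comparison functors are natural up to isomorphisms which are identities in each degree. -/
def comparisonIso (F : C ⥤ D) : (𝟭 Weil₁).prod (indMap F) ⋙ comparison.{w} D ≅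
    comparison.{w} C ⋙ indMap ((𝟭 Weil₁).prod F) :=
  NatIso.ofComponents (fun X => (level (Weil₁ × D) (Discrete PUnit.{w + 1} × X.2.I)).mapIso
    (X := ((Functor.const _).obj X.1).prod (X.2.F ⋙ F))
    (Y := (((Functor.const _).obj X.1).prod X.2.F) ⋙ (𝟭 Weil₁).prod F)
    (NatIso.ofComponents (fun i => Iso.refl _)
      (fun f => (Category.comp_id _).trans (Category.id_comp _).symm))) (fun {X Y} f => by
    ext ⟨k, i⟩
    obtain ⟨j, v, h⟩ := Y.2.germ_surj (f.2.val i)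
    have e₁ := comparison_map_val f i h k k
    have e₂ := comparison_map_val (((𝟭 Weil₁).prod (indMap F)).map f) i
      (v := F.map v) (congrArg (germMap F Y.2) h) k k
    refine (congrArg (IndObj.Hom.bind _) e₂).trans (Eq.trans ?_ (congrArg (fun t =>
      IndObj.restrict _ (𝟙 _) (germMap ((𝟭 Weil₁).prod F) ((comparison C).obj Y) t)) e₁).symm)
    exact congrArg (IndObj.germ ((indMap ((𝟭 Weil₁).prod F)).obj ((comparison C).obj Y)) (k, j))
      ((Category.comp_id _).trans (Category.id_comp _).symm))

end StrongTransformation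

/-- The pseudonatural transformation `Free ∘ Ind ⇒ Ind ∘ Free`. -/
def comparisonTrans (hF : ∀ C : Cat.{w, u}, (freeData C).IsTangent)
    (hF' : ∀ C : Cat.{w, max u (w + 1)}, (freeData C).IsTangent)
    (hI : ∀ X : Tan.{w, u}, (TangentData.ind.{w} X.data).IsTangent) :
    Pseudofunctor.StrongTrans (indCat.{w, u}.comp (free hF')) ((free hF).comp (indTan hI)) where
  app C := comparisonTan (hF C) (hF' (Cat.of (IndObj.{w} C))) (hI ((free hF).obj C))
  naturality {C D} F := Tan.isoMk (comparisonIso F.toFunctor) (fun (X : Weil₁ × IndObj.{w} C) => by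
    -- All constraints are identities in each degree, so in either coordinate both sides are
    -- composites of identities and images of identities.
    refine IndObj.hom_ext (C := Weil₁ × D) fun i => ?_
    refine congrArg (IndObj.germ ((TangentData.ind (freeData D)).T.obj
      ((indMap ((𝟭 Weil₁).prod F.toFunctor)).obj ((comparison C).obj X))) i) (Prod.ext ?_ ?_)
    · change (𝟙 (X.1.cons 1) ≫ 𝟙 (X.1.cons 1)) ≫ (Weil₁.consFunctor 1).map (𝟙 X.1) =
        𝟙 (X.1.cons 1) ≫ 𝟙 (X.1.cons 1) ≫ 𝟙 (X.1.cons 1) ≫ 𝟙 (X.1.cons 1) ≫ 𝟙 (X.1.cons 1)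
      rw [CategoryTheory.Functor.map_id]
      simp
    · let Y := X.2.F.obj i.2
      let Z : D := F.toFunctor.obj Y
      change (𝟙 Z ≫ 𝟙 Z) ≫ 𝟙 Z = 𝟙 Z ≫ F.toFunctor.map (𝟙 Y) ≫ 𝟙 Z ≫ 𝟙 Z ≫ 𝟙 Z
      simp [Z])
  naturality_naturality {C D F G} η := Tan.Hom₂.ext <| NatTrans.ext <| funext
      fun (X : Weil₁ × IndObj.{w} C) => by
    refine IndObj.hom_ext (C := Weil₁ × D) fun i => ?_
    refine congrArg (IndObj.germ
      ((indMap ((𝟭 Weil₁).prod G.toFunctor)).obj ((comparison C).obj X)) i) (Prod.ext ?_ ?_)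
    · rfl
    · exact (Category.comp_id (η.toNatTrans.app (X.2.F.obj i.2))).trans (Category.id_comp _).symm
  naturality_id C := Tan.Hom₂.ext <| NatTrans.ext <| funext
      fun (X : Weil₁ × IndObj.{w} C) => by
    refine IndObj.hom_ext (C := Weil₁ × C) fun i => ?_
    refine congrArg (IndObj.germ ((comparison C).obj X) i) (Prod.ext ?_ ?_)
    · change 𝟙 X.1 ≫ 𝟙 X.1 ≫ 𝟙 X.1 = (𝟙 X.1 ≫ 𝟙 X.1) ≫ 𝟙 X.1 ≫ 𝟙 X.1
      simp
    · let Y := X.2.F.obj i.2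
      change 𝟙 Y ≫ 𝟙 Y ≫ 𝟙 Y = (𝟙 Y ≫ 𝟙 Y) ≫ 𝟙 Y ≫ 𝟙 Y
      simp
  naturality_comp {C D E} F G := Tan.Hom₂.ext <| NatTrans.ext <| funext
      fun (X : Weil₁ × IndObj.{w} C) => by
    refine IndObj.hom_ext (C := Weil₁ × E) fun i => ?_
    refine congrArg (IndObj.germ ((indMap ((𝟭 Weil₁).prod G.toFunctor)).obj
      ((indMap ((𝟭 Weil₁).prod F.toFunctor)).obj ((comparison C).obj X))) i) (Prod.ext ?_ ?_)
    · change 𝟙 X.1 ≫ 𝟙 X.1 ≫ 𝟙 X.1 =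
        (𝟙 X.1 ≫ 𝟙 X.1) ≫ 𝟙 X.1 ≫ 𝟙 X.1 ≫ 𝟙 X.1 ≫ 𝟙 X.1 ≫ 𝟙 X.1
      simp
    · let Y := F.toFunctor.obj (X.2.F.obj i.2)
      let Z : E := G.toFunctor.obj Y
      change 𝟙 Z ≫ 𝟙 Z ≫ 𝟙 Z = (𝟙 Z ≫ 𝟙 Z) ≫ 𝟙 Z ≫ 𝟙 Z ≫ 𝟙 Z ≫ G.toFunctor.map (𝟙 Y) ≫ 𝟙 Z
      simp [Z]

end Comparison

/-! ### Pseudonatural transformations from `Free ∘ Ind` to `Ind ∘ Free` -/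

/-! ### Countability of the sets of morphisms in `Weil₁` -/

section Countability

/-- If a full and essentially surjective functor `B` intertwines `R` with a functor `S` into a
category with countable sets of morphisms, then `R` has countable image on morphisms. -/
lemma countable_range_map {A : Type u₁} [Category.{v₁} A] {M : Type u₂} [Category.{v₂} M]
    {A' : Type u₃} [Category.{v₃} A'] {N : Type u₄} [Category.{v₄} N]
    (B : A ⥤ M) [B.EssSurj] [B.Full] (R : M ⥤ N) (S : A ⥤ A') (B' : A' ⥤ N)
    (η : S ⋙ B' ≅ B ⋙ R) (hS : ∀ p q, Countable (S.obj p ⟶ S.obj q)) (P Q : M) :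
    (Set.range (fun φ : P ⟶ Q => R.map φ)).Countable := by
  let i := B.objObjPreimageIso P
  let j := B.objObjPreimageIso Q
  have := hS (B.objPreimage P) (B.objPreimage Q)
  -- Up to fixed isomorphisms each `φ` is `B` of some morphism, so by naturality of `η` the value
  -- `R(φ)` depends only on an element of one countable set of morphisms in the target of `S`.
  refine (Set.countable_range (fun t : S.obj (B.objPreimage P) ⟶ S.obj (B.objPreimage Q) =>
    R.map i.inv ≫ η.inv.app _ ≫ B'.map t ≫ η.hom.app _ ≫ R.map j.hom)).mono ?_
  rintro _ ⟨φ, rfl⟩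
  refine ⟨S.map (B.preimage (i.hom ≫ φ ≫ j.inv)), ?_⟩
  have h := η.hom.naturality_assoc (B.preimage (i.hom ≫ φ ≫ j.inv)) (R.map j.hom)
  simp only [Functor.comp_map, Functor.comp_obj] at h ⊢
  rw [h]
  simp [← Functor.map_comp]

namespace Weil₁

/-- By induction, coordinates give a surjection from a finite power of a countable set. -/
instance countable_crig : ∀ l : List ℕ, Countable (crig l)
  | [] => inferInstanceAs (Countable ℕ)
  | n :: l => by
    have := countable_crig l
    refine Function.Surjective.countable (α := crig l × (Fin n → crig l))
      (f := fun t => ofCoords (A := ⟨l⟩) t.1 t.2) fun t => ?_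
    obtain ⟨a, b, h⟩ := exists_ofCoords (A := ⟨l⟩) t
    exact ⟨(a, b), h.symm⟩

/-- A morphism is determined by its values on finitely many generators. -/
lemma countable_crig_hom (B : Weil₁) : ∀ l : List ℕ, Countable (crig l →+* B.toCrig)
  | [] => @Finite.to_countable _ (@Finite.of_subsingleton _
      (inferInstanceAs (Subsingleton (ℕ →+* B.toCrig))))
  | n :: l => by
    have := countable_crig_hom B l
    refine Function.Injective.countable
      (f := fun f : crig (n :: l) →+* B.toCrig =>
        ((fun i => f (gen ⟨l⟩ i), f.comp (inr ⟨l⟩)) : (Fin n → B.toCrig) × (crig l →+* B.toCrig)))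
      fun f g h => ?_
    exact WTensor_hom_ext (fun i => congrFun (congrArg Prod.fst h) i)
      (RingHom.congr_fun (congrArg Prod.snd h))

instance countable_hom (A B : Weil₁) : Countable (A ⟶ B) :=
  have := countable_crig_hom B A.factors
  Function.Injective.countable (f := fun f : A ⟶ B => Hom.hom f) fun _ _ h => Hom.ext h

end Weil₁

end Countability

/-- The category with one object and one morphism. -/
def Point : Type u := PUnit

instance : Category.{w} Point.{u} where
  Hom _ _ := PUnit
  id _ := ⟨⟩
  comp _ _ := ⟨⟩

instance (a b : Point.{u}) : Subsingleton (a ⟶ b) := inferInstanceAs (Subsingleton PUnit)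

/-- The functor to the category with one object and one morphism. -/
def toPoint (C : Type u) [Category.{w} C] : C ⥤ Point.{u} where
  obj _ := PUnit.unit
  map _ := PUnit.unit

/-- Two germs have representatives at a common stage, where they are parallel morphisms and so
coincide. -/
lemma IndObj.subsingleton_hom {D : Type u} [Category.{v} D]
    (hD : ∀ a b : D, Subsingleton (a ⟶ b)) (X Y : IndObj.{w} D) : Subsingleton (X ⟶ Y) where
  allEq f g := by
    ext i
    obtain ⟨j, a, ha⟩ := Y.germ_surj (f.val i)
    obtain ⟨k, b, hb⟩ := Y.germ_surj (g.val i)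
    rw [ha, hb]
    exact (Y.germ_eq_iff _ _).2 ⟨IsFiltered.max j k, IsFiltered.leftToMax j k,
      IsFiltered.rightToMax j k, Subsingleton.elim _ _⟩

/-! ### Uncountably many morphisms of ind-objects -/

section Cofree

variable {C : Type u} [Category.{w} C]

open Weil₁

/-- The sequence `W^0 ⟶ W^1 ⟶ W^2 ⟶ ⋯` of Weil algebras. -/
def powers : ULift.{w} ℕ ⥤ Weil₁ where
  obj n := cons n.down ⟨[]⟩
  map {m n} f := mkHom (desc
    (fun i => gen ⟨[]⟩ (Fin.castLE (ULift.down_le.2 (leOfHom f)) i))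
    (fun _ _ => gen_mul_gen _ _ _) (inr ⟨[]⟩))
  map_id n := cons_hom_ext (by simp) (by simp)
  map_comp f g := cons_hom_ext (by simp) (by simp)

/-- The ind-object `((W^n, c))_n` of `Weil₁ × C`. -/
def powersAt (c : C) : IndObj.{w} (Weil₁ × C) :=
  ⟨ULift.{w} ℕ, powers.prod' ((Functor.const _).obj c)⟩

open Classical in
/-- The morphism `W^n ⟶ W` which maps the generators in `s` to the generator and the others
to `0`. -/
noncomputable def select (s : Set ℕ) (n : ℕ) : cons n ⟨[]⟩ ⟶ cons 1 ⟨[]⟩ :=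
  mkHom (desc (fun i => if (i : ℕ) ∈ s then gen ⟨[]⟩ 0 else 0)
    (fun i j => by split_ifs <;> simp) (inr ⟨[]⟩))

/-- The morphism from `((W^n, c))_n` to the constant ind-object `(W, c)` given by a set of
generators. -/
noncomputable def selectAt (c : C) (s : Set ℕ) :
    powersAt c ⟶ (incl.{w} (Weil₁ × C)).obj (cons 1 ⟨[]⟩, c) :=
  IndObj.Hom.mk (X := powersAt c) (Y := (incl.{w} (Weil₁ × C)).obj (cons 1 ⟨[]⟩, c))
    (fun n => IndObj.germ ((incl.{w} (Weil₁ × C)).obj (cons 1 ⟨[]⟩, c)) ⟨⟨⟩⟩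
      (show (cons n.down ⟨[]⟩, c) ⟶ (cons 1 ⟨[]⟩, c) from (select s n.down, 𝟙 c)))
    (fun {m n} f => by
      refine congrArg (IndObj.germ ((incl.{w} (Weil₁ × C)).obj (cons 1 ⟨[]⟩, c)) ⟨⟨⟩⟩)
        (Prod.ext ?_ (Category.comp_id _))
      change powers.map f ≫ select s n.down = select s m.down
      -- The transition maps keep the number of a generator, hence also its membership in `s`.
      exact cons_hom_ext (by simp [powers, select]) (by simp [powers, select]))

lemma gen_ne_zero : gen ⟨[]⟩ (0 : Fin 1) ≠ 0 := by
  intro h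
  have e := congrArg coords h
  rw [coords_gen, map_zero] at e
  have e' := congrFun (congrArg TrivSqZeroExt.snd e) 0
  simp at e'

/-- The functor changes only the second coordinate, while `s` is encoded in the first: `n ∈ s`
exactly when the generator number `n` is not sent to `0`. -/
lemma indMap_selectAt_injective {D : Type u} [Category.{w} D] (F : C ⥤ D) (c : C) :
    Function.Injective fun s => (indMap ((𝟭 Weil₁).prod F)).map (selectAt c s) := by
  intro s t h
  ext n
  -- Generators are numbered from `0`, so `W^(n+1)` is the first level that contains number `n`, as
  -- its last generator.
  have e := congrArg (fun f => IndObj.Hom.val f (ULift.up (n + 1))) h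
  obtain ⟨l, a, b, e⟩ := (IndObj.germ_eq_iff _ _ _).1 e
  -- The target is a constant ind-object, so equality of germs is equality of morphisms.
  have e₁ : select s (n + 1) ≫ 𝟙 _ = select t (n + 1) ≫ 𝟙 _ := congrArg Prod.fst e
  have e₂ := congrArg (fun f => f.hom (gen ⟨[]⟩ (Fin.last n))) e₁
  by_cases hs : n ∈ s <;> by_cases ht : n ∈ t <;>
    simp [select, hs, ht, gen_ne_zero, gen_ne_zero.symm] at e₂ ⊢

end Cofree

/-- The natural isomorphism underlying an isomorphism of tangent morphisms. -/
def Tan.functorIso {X Y : Tan.{v, u}} {f g : X ⟶ Y} (e : f ≅ g) :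
    Tan.Hom.functor f ≅ Tan.Hom.functor g where
  hom := Tan.Hom₂.natTrans e.hom
  inv := Tan.Hom₂.natTrans e.inv
  hom_inv_id := congrArg Tan.Hom₂.natTrans e.hom_inv_id
  inv_hom_id := congrArg Tan.Hom₂.natTrans e.inv_hom_id

lemma IndObj.isEmpty_iff {C : Type u} [Category.{v} C] : IsEmpty (IndObj.{w} C) ↔ IsEmpty C :=
  ⟨fun h => ⟨fun c => h.false ((incl C).obj c)⟩,
    fun h => ⟨fun X => h.false (X.F.obj IsFiltered.nonempty.some)⟩⟩

lemma isEquivalence_of_isEmpty {A : Type u₁} [Category.{v₁} A] {B : Type u₂} [Category.{v₂} B]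
    (F : A ⥤ B) [IsEmpty B] : F.IsEquivalence where
  faithful := ⟨fun {X} => (IsEmpty.false (F.obj X)).elim⟩
  full := ⟨fun {X} => (IsEmpty.false (F.obj X)).elim⟩
  essSurj := ⟨fun Y => isEmptyElim Y⟩

/-- An object `c` would make the power set of `ℕ` countable, by naturality of `β` along the functor
from `C` to the point. Conversely, if `C` is empty, then so is the target of `β_C`. -/
lemma isEquivalence_iff_isEmpty {hF : ∀ C : Cat.{w, u}, (freeData C).IsTangent}
    {hF' : ∀ C : Cat.{w, max u (w + 1)}, (freeData C).IsTangent}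
    {hI : ∀ X : Tan.{w, u}, (TangentData.ind.{w} X.data).IsTangent}
    (β : Pseudofunctor.StrongTrans (indCat.{w, u}.comp (free hF')) ((free hF).comp (indTan hI)))
    (C : Cat.{w, u}) : (β.app C).functor.IsEquivalence ↔ IsEmpty C := by
  refine ⟨fun h => ⟨fun c => ?_⟩, fun h => ?_⟩
  · have key := countable_range_map (β.app C).functor
      (indMap ((𝟭 Weil₁).prod (toPoint C))) ((𝟭 Weil₁).prod (indMap (toPoint C)))
      (β.app (Cat.of Point)).functor
      (Tan.functorIso (β.naturality (toPoint C).toCatHom))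
      -- `Ind` of the point has at most one morphism between two objects, so only the countable
      -- contribution of `Weil₁` remains.
      (fun p q => by
        have (X Y : IndObj.{w} Point.{u}) : Subsingleton (X ⟶ Y) :=
          IndObj.subsingleton_hom inferInstance X Y
        exact inferInstanceAs (Countable ((p.1 ⟶ q.1) ×
          ((indMap (toPoint C)).obj p.2 ⟶ (indMap (toPoint C)).obj q.2))))
      (powersAt c) ((incl.{w} (Weil₁ × C)).obj (Weil₁.cons 1 ⟨[]⟩, c))
    -- The subsets of `ℕ` inject into the countable image through `selectAt`, against Cantor's
    -- theorem.
    have : Countable (Set ℕ) := Set.countable_univ_iff.1 <|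
      Set.MapsTo.countable_of_injOn (fun s _ => Set.mem_range_self (selectAt c s))
        (indMap_selectAt_injective (toPoint C) c).injOn key
    obtain ⟨f, hf⟩ := exists_surjective_nat (Set ℕ)
    exact Function.cantor_surjective f hf
  · have : IsEmpty (IndObj.{w} (Weil₁ × C)) := IndObj.isEmpty_iff.2 inferInstance
    exact isEquivalence_of_isEmpty (B := IndObj.{w} (Weil₁ × C)) (β.app C).functor

end TangentInd

theorem mainTheorem10 :
    ∃ (hF : ∀ C : Cat.{w, u}, (freeData C).IsTangent)
      (hF' : ∀ C : Cat.{w, max u (w + 1)}, (freeData C).IsTangent)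
      (hI : ∀ X : Tan.{w, u}, (TangentData.ind.{w} X.data).IsTangent),
      (∀ C : Cat.{w, u}, (indProd.{w} Weil₁ C).IsEquivalence) ∧
      (∃ α : Pseudofunctor.StrongTrans
          (indCat.{w, u}.comp (free hF')) ((free hF).comp (indTan hI)),
        ∀ C : Cat.{w, u}, (α.app C).functor = comparison.{w} C) ∧
      ∀ (β : Pseudofunctor.StrongTrans
          (indCat.{w, u}.comp (free hF')) ((free hF).comp (indTan hI))) (C : Cat.{w, u}),
        (β.app C).functor.IsEquivalence ↔ IsEmpty C :=
  ⟨fun C => freeData_isTangent C, fun C => freeData_isTangent C,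
    fun X => ind_isTangent X.isTangent, fun _ => inferInstance,
    ⟨comparisonTrans _ _ _, fun _ => rfl⟩, fun β C => isEquivalence_iff_isEmpty β C⟩
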